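/- \textbf{Notation.} Fix an integer $n\ge 0$ and let $\rho_n=(n,n-1,\dots,1)$. A partition is strict if its nonzero parts are distinct. For a strict partition $\lambda\subset\rho_n$ let $\lambda^\vee$ be the strict partition whose parts are the elements of $\{1,\dots,n\}$ that are not parts of $\lambda$. The shifted diagram $\mathcal S(\lambda)$ is obtained from the Young diagram of $\lambda$ by indenting the $i$th row by $i-1$ columns for each $i\ge1$; put $\mathcal S(\lambda/\mu)=\mathcal S(\lambda)\smallsetminus\mathcal S(\mu)$. For an integer $p$, write $\lambda\xrightarrow{p}\widetilde\lambda$ if $\widetilde\lambda\subset\rho_n$ is a strict partition containing $\lambda$ whose (unshifted) Young diagram is obtained from that of $\lambda$ by adding $p$ boxes, no two in the same column. In this case $N(\widetilde\lambda/\lambda)$ is one less than the number of border strip components (that is, edge-connected components) of $\mathcal S(\widetilde\lambda/\lambda)$; thus $N(\lambda/\lambda)=-1$. Let $A$ be the ordered alphabet $1'<1<2'<2<\cdots$. A shifted tableau of shape $\mathcal S(\lambda/\mu)$ is a filling of its boxes with symbols from $A$ that is weakly increasing along rows (left to right) and down columns, such that for every $i\ge 1$ each row contains at most one $i'$ and each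 column contains at most one $i$. Its content is the sequence whose $i$th term is the number of boxes with entry $i$ or $i'$. Its word is obtained by reading the entries from right to left in successive rows, starting with the top row. Put $\widehat{i'}=i$ and $\widehat{i}=(i+1)'$, and $\widehat{\mathbf w}=\widehat w_r\cdots\widehat w_1$ for a word $\mathbf w=w_1\cdots w_r$. The word $\mathbf w$ is an LRS word if (i) for all $i\ge2$, every $i$ or $i'$ in the concatenation $\mathbf w\widehat{\mathbf w}$ is preceded by more occurrences of the unmarked symbol $i-1$ than of the unmarked symbol $i$, and (ii) for all $i\ge1$, the last occurrence of $i'$ in $\mathbf w$ (if any) is followed by at least one $i$. An LRS tableau is a shifted tableau whose word is an LRS word. For strict $\lambda,\mu,\nu\subset\rho_n$ let $f(\lambda,\mu;\nu)$ be the number of LRS tableaux of shape $\mathcal S(\lambda^\vee/\mu)$ with content $\nu^\vee$, and put $f(\lambda,\mu;\nu)=0$ if $\mu\not\subset\lambda^\vee$. \textbf{Proposition.} For any three strict partitions $\lambda,\mu,\nu\subset\rho_n$ and any integer $p\le n$, $$\sum_{\lambda\xrightarrow{p}\widetilde\lambda}2^{N(\widetilde\lambda/\lambda)}f(\widetilde\lambda,\mu;\nu)=\sum_{\mu\xrightarrow{p}\widetilde\mu}2^{N(\widetilde\mu/\mu)}f(\lambda,\widetilde\mu;\nu).$$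 -/

import Mathlib

/-- A strict partition: a finite set of positive integers, namely its set of (distinct) parts. -/
@[ext]
structure StrictPartition where
  /-- the set of parts -/
  parts : Finset ℕ
  /-- all parts are positive -/
  pos : ∀ k ∈ parts, 0 < k

namespace StrictPartition

/-- `lam.part i` is the `(i+1)`-st largest part of `lam`, and `0` if there is no such part.
Rows are indexed from `0`. -/
def part (lam : StrictPartition) (i : ℕ) : ℕ :=
  (lam.parts.sort (fun a b => a ≥ b)).getD i 0

/-- The Young diagram of `lam`: row `i` consists of the boxes `(i, 0), …, (i, lam.part i - 1)`. -/
def young (lam : StrictPartition) : Finset (ℕ × ℕ) :=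
  (Finset.range lam.parts.card).biUnion fun i =>
    (Finset.range (lam.part i)).image fun j => (i, j)

/-- The shifted diagram of `lam`: row `i` of the Young diagram is indented by `i` columns. -/
def shifted (lam : StrictPartition) : Finset (ℕ × ℕ) :=
  (Finset.range lam.parts.card).biUnion fun i =>
    (Finset.range (lam.part i)).image fun j => (i, i + j)

/-- Containment `lam ⊂ mu` of (Young diagrams of) partitions. -/
instance : LE StrictPartition := ⟨fun lam mu => ∀ i, lam.part i ≤ mu.part i⟩

/-- The staircase partition `(n, n-1, …, 1)`. -/
def rho (n : ℕ) : StrictPartition where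
  parts := Finset.Icc 1 n
  pos := fun _ hk => (Finset.mem_Icc.mp hk).1

/-- The dual partition: its parts complement the parts of `lam` in `{1, …, n}`. -/
def dual (n : ℕ) (lam : StrictPartition) : StrictPartition where
  parts := Finset.Icc 1 n \ lam.parts
  pos := fun _ hk => (Finset.mem_Icc.mp (Finset.mem_sdiff.mp hk).1).1

/-- The shifted skew diagram obtained by removing the boxes of `mu` from those of `lam`. -/
def shiftedSkew (lam mu : StrictPartition) : Finset (ℕ × ℕ) := lam.shifted \ mu.shifted

/-- `lamt` is obtained from `lam` by adding a horizontal strip with `p` boxes, i.e. `p` boxes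
of the (unshifted) Young diagram, no two of which lie in the same column. -/
def AddsHorizontalStrip (p : ℤ) (lam lamt : StrictPartition) : Prop :=
  lam ≤ lamt ∧ ((lamt.young \ lam.young).card : ℤ) = p ∧
    ∀ a ∈ lamt.young \ lam.young, ∀ b ∈ lamt.young \ lam.young, a.2 = b.2 → a = b

theorem part_mem_or (lam : StrictPartition) (i : ℕ) :
    lam.part i ∈ lam.parts ∨ lam.part i = 0 := by
  unfold part
  by_cases h : i < (lam.parts.sort (fun a b => a ≥ b)).length
  · left
    rw [List.getD_eq_getElem _ _ h]
    exact (Finset.mem_sort _).mp (List.getElem_mem h)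
  · right
    exact List.getD_eq_default _ _ (by omega)

theorem le_part_zero (lam : StrictPartition) {k : ℕ} (hk : k ∈ lam.parts) : k ≤ lam.part 0 := by
  have hk' := (Finset.mem_sort (fun a b : ℕ => a ≥ b)).mpr hk
  have hp := Finset.pairwise_sort lam.parts (fun a b : ℕ => a ≥ b)
  unfold part
  cases h : lam.parts.sort (fun a b => a ≥ b) with
  | nil => rw [h] at hk'; simp at hk'
  | cons x l =>
    rw [h] at hk' hp
    rcases List.mem_cons.mp hk' with rfl | hm
    · simp
    · simpa using List.rel_of_pairwise_cons hp hm

theorem parts_subset_of_le_rho {n : ℕ} {lam : StrictPartition} (h : lam ≤ rho n) :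
    lam.parts ⊆ Finset.Icc 1 n := by
  intro k hk
  refine Finset.mem_Icc.mpr ⟨lam.pos k hk, (lam.le_part_zero hk).trans ((h 0).trans ?_)⟩
  rcases (rho n).part_mem_or 0 with hm | hm
  · exact (Finset.mem_Icc.mp hm).2
  · omega

theorem finite_pieri (n : ℕ) (p : ℤ) (lam : StrictPartition) :
    {lamt : StrictPartition | lamt ≤ rho n ∧ AddsHorizontalStrip p lam lamt}.Finite := by
  refine Set.Finite.of_finite_image (f := parts)
    ((Finset.finite_toSet (Finset.Icc 1 n).powerset).subset ?_)
    (fun a _ b _ hab => StrictPartition.ext hab)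
  rintro _ ⟨lamt, h, rfl⟩
  exact Finset.mem_coe.mpr (Finset.mem_powerset.mpr (parts_subset_of_le_rho h.1))

/-- The finite set of all strict partitions contained in `rho n` that are obtained from `lam` by
adding a horizontal strip with `p` boxes. -/
noncomputable def pieri (n : ℕ) (p : ℤ) (lam : StrictPartition) : Finset StrictPartition :=
  (finite_pieri n p lam).toFinset

/-- One less than the number of edge-connected components of the shifted skew diagram of
`lamt / lam`. (If the skew shape comes from a horizontal strip, these components are border
strips.) In the grid `hasse (ℕ × ℕ)` two boxes are adjacent if and only if they share an edge. -/
noncomputable def borderN (lamt lam : StrictPartition) : ℤ :=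
  (Nat.card (((SimpleGraph.hasse (ℕ × ℕ)).induce
    (shiftedSkew lamt lam : Set (ℕ × ℕ))).ConnectedComponent) : ℤ) - 1

/-- The ordered alphabet `1' < 1 < 2' < 2 < ⋯`, ordered lexicographically: the symbol `i'` is
`(i, false)` and the symbol `i` is `(i, true)`. -/
abbrev Letter := ℕ+ ×ₗ Bool

/-- The marked symbol `i'`. -/
def marked (i : ℕ+) : Letter := toLex (i, false)

/-- The unmarked symbol `i`. -/
def unmarked (i : ℕ+) : Letter := toLex (i, true)

/-- The operation on symbols that sends `i'` to `i` and `i` to `(i+1)'`. -/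
def hatLetter (a : Letter) : Letter :=
  if (ofLex a).2 then marked ((ofLex a).1 + 1) else unmarked (ofLex a).1

/-- Apply `hatLetter` to all letters of a word and reverse it. -/
def hatWord (w : List Letter) : List Letter := (w.map hatLetter).reverse

/-- Every `i` or `i'` with `i ≥ 2` is preceded by more occurrences of the (unmarked) symbol `i-1`
than of the (unmarked) symbol `i`; written with `i + 1` for `i`. -/
def IsLatticeWord (v : List Letter) : Prop :=
  ∀ (i : ℕ+) (x y : List Letter) (a : Letter), v = x ++ a :: y →
    (a = unmarked (i + 1) ∨ a = marked (i + 1)) →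
      x.count (unmarked (i + 1)) < x.count (unmarked i)

/-- `w` followed by its hat is a lattice word, and the last occurrence of each `i'` in `w`,
if any, is followed by at least one `i`. -/
def IsLRSWord (w : List Letter) : Prop :=
  IsLatticeWord (w ++ hatWord w) ∧
    ∀ (i : ℕ+) (x y : List Letter), w = x ++ marked i :: y → marked i ∉ y → unmarked i ∈ y

/-- A filling of the boxes of the shifted skew shape `S(lam / mu)` with symbols. -/
abbrev Filling (lam mu : StrictPartition) := {b // b ∈ shiftedSkew lam mu} → Letter

/-- Rows and columns are weakly increasing, each row contains at most one `i'` and each column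
contains at most one `i`. -/
def IsShiftedTableau {lam mu : StrictPartition} (T : Filling lam mu) : Prop :=
  (∀ a b, a.1.1 = b.1.1 → a.1.2 ≤ b.1.2 → T a ≤ T b) ∧
  (∀ a b, a.1.2 = b.1.2 → a.1.1 ≤ b.1.1 → T a ≤ T b) ∧
  (∀ i a b, a.1.1 = b.1.1 → T a = marked i → T b = marked i → a = b) ∧
  (∀ i a b, a.1.2 = b.1.2 → T a = unmarked i → T b = unmarked i → a = b)

/-- The boxes of `S(lam / mu)` from right to left in successive rows, starting with the top
row. -/
def readingOrder (lam mu : StrictPartition) : List (ℕ × ℕ) :=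
  (List.range lam.parts.card).flatMap fun i =>
    ((List.range (i + lam.part i)).reverse.map fun j => (i, j)).filter
      fun b => b ∈ shiftedSkew lam mu

theorem mem_of_mem_readingOrder {lam mu : StrictPartition} {b : ℕ × ℕ}
    (hb : b ∈ readingOrder lam mu) : b ∈ shiftedSkew lam mu := by
  obtain ⟨i, -, hi⟩ := List.mem_flatMap.mp hb
  simpa using (List.mem_filter.mp hi).2

/-- The word of a filling: its entries in reading order. -/
def word {lam mu : StrictPartition} (T : Filling lam mu) : List Letter :=
  (readingOrder lam mu).attach.map fun b => T ⟨b.1, mem_of_mem_readingOrder b.2⟩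

/-- `T` has content `kap`: for all `i ≥ 1`, the `i`-th part of `kap` (`kap.part (i - 1)`, as rows
are indexed from `0`) is the number of boxes with entry `i` or `i'`. -/
def HasContent {lam mu : StrictPartition} (T : Filling lam mu) (kap : StrictPartition) : Prop :=
  ∀ i : ℕ+, (Finset.univ.filter fun b => T b = marked i ∨ T b = unmarked i).card
    = kap.part (i.natPred)

/-- The set of all Littlewood-Richardson-Stembridge tableaux of shape `S(lam / mu)` with
content `kap`. -/
def lrsTableaux (lam mu kap : StrictPartition) : Set (Filling lam mu) :=
  {T | IsShiftedTableau T ∧ IsLRSWord (word T) ∧ HasContent T kap}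

/-- There are only finitely many such tableaux, so that they can be counted by `Set.ncard`. -/
theorem finite_lrsTableaux (lam mu kap : StrictPartition) : (lrsTableaux lam mu kap).Finite := by
  refine (Set.Finite.pi' (t := fun _ : {b // b ∈ shiftedSkew lam mu} =>
    {a : Letter | ((ofLex a).1 : ℕ) ≤ kap.parts.card}) fun _ => ?_).subset ?_
  · refine Set.Finite.of_finite_image (f := fun a : Letter => (((ofLex a).1 : ℕ), (ofLex a).2))
      (((Set.finite_Iic kap.parts.card).prod (Set.finite_univ (α := Bool))).subset ?_) ?_
    · rintro _ ⟨a, ha, rfl⟩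
      exact ⟨ha, Set.mem_univ _⟩
    · intro a _ b _ h
      simp only [Prod.mk.injEq, PNat.coe_inj] at h
      exact ofLex.injective (Prod.ext h.1 h.2)
  · rintro T ⟨-, -, hT⟩ b
    by_contra hb
    have h1 : kap.parts.card < ((ofLex (T b)).1 : ℕ) := not_le.mp hb
    have h2 := hT (ofLex (T b)).1
    have h3 : kap.part (PNat.natPred (ofLex (T b)).1) = 0 := by
      apply List.getD_eq_default
      rw [Finset.length_sort]
      have := PNat.natPred_add_one (ofLex (T b)).1
      omega
    rw [h3, Finset.card_eq_zero] at h2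
    have h4 : b ∈ (∅ : Finset {b // b ∈ shiftedSkew lam mu}) := by
      rw [← h2, Finset.mem_filter]
      refine ⟨Finset.mem_univ _, ?_⟩
      cases h : (ofLex (T b)).2
      · left
        exact ofLex.injective (Prod.ext rfl h)
      · right
        exact ofLex.injective (Prod.ext rfl h)
    simp at h4

open Classical in
/-- The number of LRS tableaux of shape `S(dual lam / mu)` with content `dual nu`; it is `0` if
`mu` is not contained in `dual lam`. -/
noncomputable def lrsNumber (n : ℕ) (lam mu nu : StrictPartition) : ℕ :=
  if mu ≤ dual n lam then (lrsTableaux (dual n lam) mu (dual n nu)).ncard else 0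

end StrictPartition

/-! Both sides count pairs consisting of an LRS tableau and a marked horizontal strip, stacked in
the two possible orders between the shapes `μ` and `λ^∨`, and tableau switching is a bijection
between the two kinds of pairs.

Strips. The `c`-th column of the Young diagram of a strict partition has as many boxes as the
diagonal of content `c` of the shifted diagram. Hence a horizontal strip adds at most one box to
each diagonal, and passing to duals turns a strip from `λ` to `λ̃` into a strip from `λ̃^∨` to `λ^∨`
on the same diagonals (`stripSet_dual`). Fill a nonempty strip with the letters `1'` and `1` so that
the box of least content is unmarked. Within a component the marks are forced except at its first
diagonal, so there are `2 ^ N` fillings (`bijOn_markedSet`). For the empty strip `2 ^ N` is `1/2`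
instead of `1`; this factor depends on `p` only and occurs on both sides.

Words. List the boxes of a tableau in standard order: by letter, marked before unmarked, marked ones
by decreasing and unmarked ones by increasing content. Only the word of contents is kept, cut into
one block for each pair `i', i`. The shapes make the word `Valid`; a block comes from a pair `i', i`
exactly if it decreases and then increases (`NoPeak`); and condition (ii) on LRS words decides the
mark of its smallest letter, so that all marks can be recovered (`eq_tagBlock`). The lattice
condition (i) becomes a system of inequalities between the sets of contents of consecutive letters
(`boxLattice_iff`).

Switching. Two boxes added in succession can be added in the other order unless their contents are
adjacent. This local rule `cell` is an involution. Filling a rectangle with it moves a strip across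
a tableau, and the process can be reversed. Read along one side of the rectangle, each row preserves
the absence of peaks (`noPeak_slide_iff`), so a strip remains a strip. Read along the other side,
each column is a jeu de taquin slide of the tableau, and it remains to see that a slide preserves
the LRS property (`latticeAt_slideBlocks_iff`). A slide decomposes into moves of a single letter to
an adjacent diagonal (`slide_step`) and one exceptional move at the main diagonal, in which unmarked
letters on the contents `0, 1` become a marked letter on `1` and an unmarked one on `0`
(`slide_corner`). For each move the inequalities before and after are equivalent, because between
two additions on one diagonal there are additions on both adjacent diagonals (`Valid.between`),
which places further letters nearby. -/

namespace ShiftedWord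

/-! ### Shifted shapes as sequences of diagonal lengths, and words of contents -/

/-- A box of content `c` can be added to the shifted shape whose diagonal of content `d`
consists of `N d` boxes. -/
def Addable (N : ℕ → ℕ) (c : ℕ) : Prop :=
  N c = N (c + 1) ∧ ∀ d, d + 1 = c → N d = N c + 1

/-- Lengthen the diagonal of content `c` by one box. -/
def grow (N : ℕ → ℕ) (c : ℕ) : ℕ → ℕ := fun d => if d = c then N d + 1 else N d

/-- Boxes with the contents listed in the word can be added successively. -/
def Valid : (ℕ → ℕ) → List ℕ → Prop
  | _, [] => True
  | N, c :: k => Addable N c ∧ Valid (grow N c) k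

/-- The diagonal lengths after adding boxes with the contents listed in the word. -/
def run (N : ℕ → ℕ) (k : List ℕ) : ℕ → ℕ := fun d => N d + k.count d

@[simp] theorem valid_nil (N : ℕ → ℕ) : Valid N [] := trivial

@[simp] theorem valid_cons (N : ℕ → ℕ) (c : ℕ) (k : List ℕ) :
    Valid N (c :: k) ↔ Addable N c ∧ Valid (grow N c) k := Iff.rfl

@[simp] theorem run_nil (N : ℕ → ℕ) : run N [] = N := by
  funext d; simp [run]

theorem run_cons (N : ℕ → ℕ) (c : ℕ) (k : List ℕ) : run N (c :: k) = run (grow N c) k := by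
  funext d
  by_cases h : d = c
  · subst h; simp [run, grow]; omega
  · have : c ≠ d := fun e => h e.symm
    simp [run, grow, h, this]

theorem run_append (N : ℕ → ℕ) (k l : List ℕ) : run N (k ++ l) = run (run N k) l := by
  funext d; simp [run, List.count_append]; omega

theorem run_perm (N : ℕ → ℕ) {k l : List ℕ} (h : k.Perm l) : run N k = run N l := by
  funext d; simp [run, h.count_eq d]

theorem valid_append (N : ℕ → ℕ) (k l : List ℕ) :
    Valid N (k ++ l) ↔ Valid N k ∧ Valid (run N k) l := by
  induction k generalizing N with
  | nil => simp
  | cons c k ih => simp [ih, run_cons, and_assoc]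

/-- Between two additions on the diagonal `c`, boxes are added on both adjacent diagonals. -/
theorem Valid.between {N : ℕ → ℕ} {A B C : List ℕ} {c : ℕ}
    (h : Valid N (A ++ c :: (B ++ c :: C))) : c + 1 ∈ B ∧ ∀ d, d + 1 = c → d ∈ B := by
  rw [valid_append, valid_cons, valid_append, valid_cons] at h
  obtain ⟨-, ⟨h1, h2⟩, -, ⟨h3, h4⟩, -⟩ := h
  have e : c + 1 ≠ c := by omega
  simp only [run, grow, if_true, e, if_false] at h3 h4
  simp only [run] at h1 h2
  refine ⟨List.count_pos_iff.mp (by omega), fun d hd => List.count_pos_iff.mp ?_⟩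
  have h5 := h2 d hd
  have h6 := h4 d hd
  rw [if_neg (by omega)] at h6
  omega

/-- Boxes on diagonals that are not adjacent can be added in either order. -/
theorem Valid.swap {N : ℕ → ℕ} {a b : ℕ} {k : List ℕ} (h1 : a + 1 ≠ b) (h2 : b + 1 ≠ a)
    (h : Valid N (a :: b :: k)) : Valid N (b :: a :: k) := by
  obtain ⟨⟨h3, h4⟩, ⟨h5, h6⟩, h7⟩ := h
  have hab : a ≠ b := by
    rintro rfl
    simp [grow] at h5
    omega
  have hg : grow (grow N b) a = grow (grow N a) b := by
    funext d; unfold grow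
    split_ifs <;> omega
  refine ⟨⟨?_, ?_⟩, ⟨?_, ?_⟩, by rw [hg]; exact h7⟩
  · simp only [grow] at h5
    rwa [if_neg (by omega), if_neg (by omega)] at h5
  · intro d hd
    have := h6 d hd
    simp only [grow] at this
    rwa [if_neg (by omega), if_neg (by omega)] at this
  · simp only [grow]
    rwa [if_neg (by omega), if_neg (by omega)]
  · intro d hd
    simp only [grow]
    rw [if_neg (by omega), if_neg (by omega)]
    exact h4 d hd

/-! ### The local growth rule and slides of one box past a word -/

/-- The growth rule for two successively added boxes with contents `l` and `t`. -/
def cell (l t : ℕ) : ℕ × ℕ := if l + 1 = t ∨ t + 1 = l then (l, t) else (t, l)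

/-- The adjacency test is symmetric in the two contents, so applying the rule again undoes the
exchange. -/
theorem cell_cell (l t : ℕ) : cell (cell l t).1 (cell l t).2 = (l, t) := by
  unfold cell
  split_ifs <;> simp_all

theorem cell_perm (l t : ℕ) : [l, t].Perm [(cell l t).1, (cell l t).2] := by
  unfold cell
  split_ifs
  · rfl
  · exact List.Perm.swap _ _ _

theorem Valid.cell {N : ℕ → ℕ} {l t : ℕ} {k : List ℕ} (h : Valid N (l :: t :: k)) :
    Valid N ((ShiftedWord.cell l t).1 :: (ShiftedWord.cell l t).2 :: k) := by
  unfold ShiftedWord.cell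
  split_ifs with h1
  · exact h
  · exact h.swap (by omega) (by omega)

/-- Slide a box of content `t`, added after the boxes of a word, to the front of the word. -/
def slide : List ℕ → ℕ → ℕ × List ℕ
  | [], t => (t, [])
  | l :: k, t => ((cell l (slide k t).1).1, (cell l (slide k t).1).2 :: (slide k t).2)

/-- Slide a box of content `t`, added before the boxes of a word, to the end of the word. -/
def slideR : ℕ → List ℕ → List ℕ × ℕ
  | t, [] => ([], t)
  | t, l :: k => ((cell t l).1 :: (slideR (cell t l).2 k).1, (slideR (cell t l).2 k).2)

theorem slideR_slide (k : List ℕ) (t : ℕ) : slideR (slide k t).1 (slide k t).2 = (k, t) := by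
  induction k generalizing t with
  | nil => rfl
  | cons l k ih => simp [slide, slideR, cell_cell, ih]

theorem slide_slideR (t : ℕ) (k : List ℕ) : slide (slideR t k).1 (slideR t k).2 = (t, k) := by
  induction k generalizing t with
  | nil => rfl
  | cons l k ih => simp [slide, slideR, cell_cell, ih]

@[simp] theorem length_slide (k : List ℕ) (t : ℕ) : (slide k t).2.length = k.length := by
  induction k generalizing t with
  | nil => rfl
  | cons l k ih => simp [slide, ih]

theorem slide_append (k l : List ℕ) (t : ℕ) :
    slide (k ++ l) t = ((slide k (slide l t).1).1, (slide k (slide l t).1).2 ++ (slide l t).2) := by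
  induction k with
  | nil => rfl
  | cons c k ih => simp [slide, ih]

theorem slide_perm (k : List ℕ) (t : ℕ) : (k ++ [t]).Perm ((slide k t).1 :: (slide k t).2) := by
  induction k generalizing t with
  | nil => rfl
  | cons l k ih =>
    refine ((ih t).cons l).trans ?_
    exact (cell_perm l (slide k t).1).append_right (slide k t).2

theorem Valid.slide {N : ℕ → ℕ} {k : List ℕ} {t : ℕ} {S : List ℕ} (h : Valid N (k ++ t :: S)) :
    Valid N ((slide k t).1 :: ((slide k t).2 ++ S)) := by
  induction k generalizing N with
  | nil => exact h
  | cons l k ih => exact Valid.cell (k := (ShiftedWord.slide k t).2 ++ S) ⟨h.1, ih h.2⟩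

theorem Valid.slideR {N : ℕ → ℕ} {k : List ℕ} {t : ℕ} {S : List ℕ} (h : Valid N (t :: (k ++ S))) :
    Valid N ((slideR t k).1 ++ (slideR t k).2 :: S) := by
  induction k generalizing N t with
  | nil => exact h
  | cons l k ih =>
    have h1 := Valid.cell (k := k ++ S) h
    exact ⟨h1.1, ih h1.2⟩

/-! ### Invariance of peaks under slides -/

/-- No letter is larger than both its neighbours. -/
def NoPeak : List ℕ → Prop
  | x :: y :: z :: r => ¬ (x < y ∧ z < y) ∧ NoPeak (y :: z :: r)
  | _ => True

/-- The peak at `y` only involves the three cells at `x`, `y`, `z`. In each of the eight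
combinations of exchanging and non-exchanging cells, the restrictions on repeated contents in a
valid word of length four, used before and after the slide, leave only linear arithmetic. -/
theorem peak_slide_iff {N : ℕ → ℕ} {x y z t : ℕ} (h : Valid N [x, y, z, t]) :
    ∀ t' x' y' z', slide [x, y, z] t = (t', [x', y', z']) →
      ((x < y ∧ z < y) ↔ (x' < y' ∧ z' < y')) := by
  intro t' x' y' z' he
  have h2 := Valid.slide (k := [x, y, z]) (S := []) h
  rw [he] at h2
  simp only [slide] at he
  simp only [List.append_nil] at h2
  have cc (l t : ℕ) : (l + 1 = t ∨ t + 1 = l) ∧ cell l t = (l, t) ∨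
      ¬ (l + 1 = t ∨ t + 1 = l) ∧ cell l t = (t, l) := by
    unfold cell
    split_ifs with h <;> simp [h]
  -- Equal contents enclose both adjacent contents. At distance two there is room for only one of
  -- them, so the content `a - 1` must not exist and the pattern is `0, 1, 0` on the main diagonal.
  have f (a b c d : ℕ) (hv : Valid N [a, b, c, d]) :
      a ≠ b ∧ b ≠ c ∧ c ≠ d ∧ (a = c → b = a + 1 ∧ a = 0) ∧ (b = d → c = b + 1 ∧ b = 0) ∧
      (a = d → (b = a + 1 ∨ c = a + 1) ∧ (a = 0 ∨ b + 1 = a ∨ c + 1 = a)) := by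
    refine ⟨?_, ?_, ?_, ?_, ?_, ?_⟩
    · rintro rfl
      simpa using (Valid.between (A := []) (B := []) (C := [c, d]) hv).1
    · rintro rfl
      simpa using (Valid.between (A := [a]) (B := []) (C := [d]) hv).1
    · rintro rfl
      simpa using (Valid.between (A := [a, b]) (B := []) (C := []) hv).1
    · rintro rfl
      have := Valid.between (A := []) (B := [b]) (C := [d]) hv
      simp only [List.mem_singleton] at this
      have h0 := this.2 (a - 1)
      omega
    · rintro rfl
      have := Valid.between (A := [a]) (B := [c]) (C := []) hv
      simp only [List.mem_singleton] at this
      have h0 := this.2 (b - 1)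
      omega
    · rintro rfl
      have := Valid.between (A := []) (B := [b, c]) (C := []) hv
      simp only [List.mem_cons, List.not_mem_nil, or_false] at this
      have h0 := this.2 (a - 1)
      omega
  have f1 := f _ _ _ _ h
  have f2 := f _ _ _ _ h2
  rcases cc z t with ⟨c1, e1⟩ | ⟨c1, e1⟩ <;> rw [e1] at he <;> dsimp only at he <;>
  [rcases cc y z with ⟨c2, e2⟩ | ⟨c2, e2⟩; rcases cc y t with ⟨c2, e2⟩ | ⟨c2, e2⟩] <;>
  rw [e2] at he <;> dsimp only at he <;>
  [rcases cc x y with ⟨c3, e3⟩ | ⟨c3, e3⟩; rcases cc x z with ⟨c3, e3⟩ | ⟨c3, e3⟩;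
    rcases cc x y with ⟨c3, e3⟩ | ⟨c3, e3⟩; rcases cc x t with ⟨c3, e3⟩ | ⟨c3, e3⟩] <;>
  rw [e3] at he <;> simp only [Prod.mk.injEq, List.cons.injEq, and_true] at he <;> omega

theorem noPeak_slide_iff {N : ℕ → ℕ} {k : List ℕ} {t : ℕ} (h : Valid N (k ++ [t])) :
    NoPeak (slide k t).2 ↔ NoPeak k := by
  induction k generalizing N with
  | nil => rfl
  | cons x k ih =>
    match k, @ih, h with
    | [], _, _ => simp [slide, NoPeak]
    | [y], _, _ => simp [slide, NoPeak]
    | y :: z :: r, ih, h =>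
      have h1 := ih h.2
      -- The box meets `z`, `y`, `x` only after it has passed `r`, so there it has the content
      -- `(slide r t).1`.
      have h2 : Valid N [x, y, z, (slide r t).1] := by
        have h3 : Valid N ([x, y, z] ++ (r ++ [t])) := h
        have h4 := (valid_append _ _ _).mp h3
        have h5 := Valid.slide (S := []) h4.2
        exact (valid_append _ [x, y, z] [_]).mpr ⟨h4.1, h5.1, trivial⟩
      have h6 := peak_slide_iff h2 _ _ _ _ rfl
      simp only [slide, NoPeak] at h1 h6 ⊢
      rw [h1, ← h6]

/-! ### Switching two words -/

/-- Switch a word with a word of boxes that are added after it. -/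
def switch : List ℕ → List ℕ → List ℕ × List ℕ
  | [], U => (U, [])
  | l :: k, U =>
    ((slideR l (switch k U).1).1, (slideR l (switch k U).1).2 :: (switch k U).2)

/-- The definition fills the rectangle of cells letter by letter of the first word; here the same
rectangle is filled letter by letter of the second word. The first reading serves the peaks of the
strip, the second one the tableau. -/
theorem switch_cons (k : List ℕ) (u : ℕ) (U : List ℕ) :
    switch k (u :: U) =
      ((slide k u).1 :: (switch (slide k u).2 U).1, (switch (slide k u).2 U).2) := by
  induction k with
  | nil => rfl
  | cons l k ih => simp [switch, ih, slideR, slide]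

theorem switch_nil_right (k : List ℕ) : switch k [] = ([], k) := by
  induction k with
  | nil => rfl
  | cons l k ih => simp [switch, ih, slideR]

theorem slideR_perm (t : ℕ) (k : List ℕ) : (t :: k).Perm ((slideR t k).1 ++ [(slideR t k).2]) := by
  have h := slide_perm (slideR t k).1 (slideR t k).2
  rw [slide_slideR] at h
  exact h.symm

theorem Valid.switch {N : ℕ → ℕ} {k U : List ℕ} (h : Valid N (k ++ U)) :
    Valid N ((switch k U).1 ++ (switch k U).2) := by
  induction k generalizing N with
  | nil => simpa [ShiftedWord.switch] using h
  | cons l k ih => exact Valid.slideR ⟨h.1, ih h.2⟩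

/-- Each letter of `k` slides to the right past the current form of `U`. Read backwards this is a
slide to the left, which does not change peaks. -/
theorem switch_noPeak_iff {N : ℕ → ℕ} {k U : List ℕ} (h : Valid N (k ++ U)) :
    NoPeak (switch k U).1 ↔ NoPeak U := by
  induction k generalizing N with
  | nil => rfl
  | cons l k ih =>
    have h1 := (ih h.2)
    have h2 : Valid N (l :: ((switch k U).1 ++ (switch k U).2)) := ⟨h.1, Valid.switch h.2⟩
    have h3 := Valid.slideR h2
    rw [← List.singleton_append, ← List.append_assoc, valid_append] at h3
    have h4 := noPeak_slide_iff h3.1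
    rw [slide_slideR] at h4
    simp only [switch]
    rw [← h4]
    exact h1

/-! ### Counting functions and the lattice inequalities in terms of contents -/

/-- The number of elements of `E` that are at least `x`. -/
def numGE (E : Finset ℕ) (x : ℕ) : ℕ := (E.filter (x ≤ ·)).card

/-- The number of elements of `D` that are less than `x`. -/
def numLT (D : Finset ℕ) (x : ℕ) : ℕ := (D.filter (· < x)).card

theorem numGE_anti (E : Finset ℕ) {x y : ℕ} (h : x ≤ y) : numGE E y ≤ numGE E x :=
  Finset.card_le_card fun a ha => by
    simp only [Finset.mem_filter] at ha ⊢; exact ⟨ha.1, h.trans ha.2⟩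

theorem numLT_mono (D : Finset ℕ) {x y : ℕ} (h : x ≤ y) : numLT D x ≤ numLT D y :=
  Finset.card_le_card fun a ha => by
    simp only [Finset.mem_filter] at ha ⊢; exact ⟨ha.1, ha.2.trans_le h⟩

theorem numGE_zero (E : Finset ℕ) : numGE E 0 = E.card := by simp [numGE]

theorem numLT_zero (D : Finset ℕ) : numLT D 0 = 0 := by simp [numLT]

theorem numGE_insert {E : Finset ℕ} {c : ℕ} (h : c ∉ E) (x : ℕ) :
    numGE (insert c E) x = numGE E x + if x ≤ c then 1 else 0 := by
  unfold numGE
  rw [Finset.filter_insert]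
  split_ifs
  · rw [Finset.card_insert_of_notMem (by simp [h])]
  · rfl

theorem numLT_insert {D : Finset ℕ} {c : ℕ} (h : c ∉ D) (x : ℕ) :
    numLT (insert c D) x = numLT D x + if c < x then 1 else 0 := by
  unfold numLT
  rw [Finset.filter_insert]
  split_ifs
  · rw [Finset.card_insert_of_notMem (by simp [h])]
  · rfl

theorem numGE_succ_of_mem {E : Finset ℕ} {x : ℕ} (h : x ∈ E) :
    numGE E x = numGE E (x + 1) + 1 := by
  unfold numGE
  rw [← Finset.card_insert_of_notMem (a := x) (by simp)]
  congr 1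
  ext a
  simp only [Finset.mem_filter, Finset.mem_insert]
  grind

theorem numGE_succ_of_notMem {E : Finset ℕ} {x : ℕ} (h : x ∉ E) :
    numGE E x = numGE E (x + 1) := by
  unfold numGE
  congr 1
  ext a
  simp only [Finset.mem_filter]
  grind

theorem numLT_succ_of_mem {D : Finset ℕ} {x : ℕ} (h : x ∈ D) :
    numLT D (x + 1) = numLT D x + 1 := by
  unfold numLT
  rw [← Finset.card_insert_of_notMem (a := x) (by simp)]
  congr 1
  ext a
  simp only [Finset.mem_filter, Finset.mem_insert]
  grind

theorem numLT_succ_of_notMem {D : Finset ℕ} {x : ℕ} (h : x ∉ D) :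
    numLT D (x + 1) = numLT D x := by
  unfold numLT
  congr 1
  ext a
  simp only [Finset.mem_filter]
  grind

theorem exists_least_of_numGE_pos {E : Finset ℕ} {x : ℕ} (h : 0 < numGE E x) :
    ∃ e ∈ E, x ≤ e ∧ numGE E (e + 1) + 1 = numGE E x := by
  have hne : (E.filter (x ≤ ·)).Nonempty := Finset.card_pos.mp h
  have hm := Finset.mem_filter.mp (Finset.min'_mem _ hne)
  refine ⟨_, hm.1, hm.2, ?_⟩
  rw [← numGE_succ_of_mem hm.1]
  unfold numGE
  congr 1
  ext a
  simp only [Finset.mem_filter]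
  constructor
  · exact fun ha => ⟨ha.1, hm.2.trans ha.2⟩
  · exact fun ha => ⟨ha.1, Finset.min'_le _ _ (Finset.mem_filter.mpr ha)⟩

theorem exists_greatest_of_numLT_pos {D : Finset ℕ} {x : ℕ} (h : 0 < numLT D x) :
    ∃ d ∈ D, d < x ∧ numLT D d + 1 = numLT D x := by
  have hne : (D.filter (· < x)).Nonempty := Finset.card_pos.mp h
  have hm := Finset.mem_filter.mp (Finset.max'_mem _ hne)
  refine ⟨_, hm.1, hm.2, ?_⟩
  rw [← numLT_succ_of_mem hm.1]
  unfold numLT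
  congr 1
  ext a
  simp only [Finset.mem_filter, Nat.lt_succ_iff]
  constructor
  · exact fun ha => ⟨ha.1, ha.2.trans_lt hm.2⟩
  · exact fun ha => ⟨ha.1, Finset.le_max' _ _ (Finset.mem_filter.mpr ha)⟩

/-- The lattice condition for two adjacent letters, in terms of the sets of contents of the
boxes with the smaller letter (`D₁` marked, `E₁` unmarked) and the larger letter
(`D₂` marked, `E₂` unmarked). -/
structure Lattice (D₁ E₁ D₂ E₂ : Finset ℕ) : Prop where
  unmarked_gt : ∀ c, c ∈ E₂ ∨ c ∈ D₂ → numGE E₂ (c + 1) < numGE E₁ c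
  of_mem_unmarked : ∀ c ∈ E₁, E₂.card + numLT D₂ (c + 1) < E₁.card + numLT D₁ c
  of_mem_marked : ∀ c ∈ D₂, E₂.card + numLT D₂ c < E₁.card + numLT D₁ c

theorem card_insert_notMem {E : Finset ℕ} {c : ℕ} (h : c ∉ E) : (insert c E).card = E.card + 1 :=
  Finset.card_insert_of_notMem h

section

variable {D₁ E₁ D₂ E₂ : Finset ℕ} {c : ℕ}

/-- If `E₂` were larger than `E₁`, its least element would violate `unmarked_gt`: all but one
element of `E₂` lie above it. -/
theorem Lattice.card_le (h : Lattice D₁ E₁ D₂ E₂) : E₂.card ≤ E₁.card := by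
  by_contra hc
  obtain ⟨e, he, -, h1⟩ := exists_least_of_numGE_pos (E := E₂) (x := 0) (by
    rw [numGE_zero]; omega)
  have h2 := h.unmarked_gt e (Or.inl he)
  have h3 := numGE_anti E₁ (Nat.zero_le e)
  rw [numGE_zero] at h1 h3
  omega

/-- Under a lattice condition, equality of the counts from `c` on does not propagate down. -/
theorem Lattice.not_tight_below (h : Lattice D₁ E₁ D₂ E₂) (c : ℕ)
    (h1 : ∀ d < c, d ∈ E₁ → d ∉ D₂)
    (h2 : ∀ d, d + 1 < c → d + 1 ∈ E₁ → d + 1 ∈ E₂ → d ∈ D₂ ∨ d ∈ E₂)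
    (ht : numGE E₁ c = numGE E₂ c) : ∀ d, d + 1 = c → ¬ (d ∈ D₂ ∨ d ∈ E₂) := by
  induction c with
  | zero => intro d hd; omega
  | succ c ih =>
    intro d hd hm
    obtain rfl : d = c := by omega
    have h3 := h.unmarked_gt d hm.symm
    have h4 : d ∈ E₁ := by
      by_contra hn
      have := numGE_succ_of_notMem hn
      omega
    have h5 : d ∈ E₂ := hm.resolve_left (h1 d (by omega) h4)
    have h6 := numGE_succ_of_mem h4
    have h7 := numGE_succ_of_mem h5
    -- So far `d` lies in both `E₁` and `E₂`, and equality holds from `d` on as well. At `d = 0` it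
    -- says that the two sets have the same size, which `of_mem_unmarked` at `0` excludes; otherwise
    -- the argument repeats one diagonal lower.
    cases d with
    | zero =>
      have h8 := h.of_mem_unmarked 0 h4
      rw [numLT_zero] at h8
      rw [numGE_zero] at h6 h7
      omega
    | succ e =>
      exact ih (fun d hd => h1 d (by omega)) (fun d hd => h2 d (by omega)) (by omega) e rfl
        (h2 e (by omega) h4 h5)

/-- Under the first lattice condition, equality of the counts from `x` on does not propagate up. -/
theorem not_tight_above (n : ℕ) (x : ℕ)
    (h : ∀ c, x ≤ c → c ∈ E₂ ∨ c ∈ D₂ → numGE E₂ (c + 1) < numGE E₁ c)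
    (h1 : ∀ d, x ≤ d → d ∈ E₂ → d ∉ D₂)
    (h2 : ∀ d, x ≤ d → d ∈ E₁ → d ∈ E₂ → d + 1 ∈ E₁ ∨ d + 1 ∈ D₂)
    (hn : numGE E₁ x ≤ n) (ht : numGE E₁ x = numGE E₂ x) : ¬ (x ∈ E₁ ∨ x ∈ D₂) := by
  induction n generalizing x with
  | zero =>
    rintro (hm | hm)
    · have := numGE_succ_of_mem hm
      omega
    · have := h x le_rfl (Or.inr hm)
      omega
  | succ n ih =>
    rintro (hm | hm)
    · have h3 := numGE_succ_of_mem hm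
      obtain ⟨e, he, hxe, h4⟩ := exists_least_of_numGE_pos (E := E₂) (x := x) (by omega)
      have h5 := h e hxe (Or.inl he)
      -- If the least element `e` of `E₂` were beyond `x`, the element `x` of `E₁` would be lost in
      -- the count at `e`, against the inequality there. So `x` lies in both sets and equality moves
      -- up to `x + 1`.
      have h6 : e = x := by
        by_contra hne
        have := numGE_anti E₁ (show x + 1 ≤ e by omega)
        omega
      subst h6
      exact ih (e + 1) (fun c hc => h c (by omega)) (fun d hd => h1 d (by omega))
        (fun d hd => h2 d (by omega)) (by omega) (by omega) (h2 e le_rfl hm he)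
    · have h3 := h x le_rfl (Or.inr hm)
      by_cases hx : x ∈ E₂
      · exact h1 x le_rfl hx hm
      · have := numGE_succ_of_notMem hx
        omega

/-! ### Lattice inequalities under moves of a single letter -/

/-- Moving an unmarked larger letter to the right. -/
theorem lattice_unmarked₂_right (hc : c ∉ E₂) (hc1 : c + 1 ∉ E₂)
    (h1 : c ∈ D₂ → False) (h2 : c ∈ E₁ → c + 1 ∈ E₁ ∨ c + 1 ∈ D₂) :
    Lattice D₁ E₁ D₂ (insert c E₂) ↔ Lattice D₁ E₁ D₂ (insert (c + 1) E₂) := by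
  have hg := numGE_insert hc
  have hg1 := numGE_insert hc1
  have hk := card_insert_notMem hc
  have hk1 := card_insert_notMem hc1
  have hs := numGE_succ_of_notMem hc1
  constructor
  · intro h
    refine ⟨fun x hx => ?_, ?_, ?_⟩
    · rw [hg1]
      rw [Finset.mem_insert] at hx
      by_cases hx1 : x = c + 1
      · subst hx1
        rw [if_neg (by omega)]
        have h3 := h.unmarked_gt c (by simp)
        rw [hg, if_neg (by omega)] at h3
        -- If `c ∈ E₁`, the count of `E₁` from `c + 1` on misses this element. The missing unit
        -- comes from the inequality at `c + 1` if `c + 1 ∈ D₂`, and at the next element of `E₂` if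
        -- `c + 1 ∈ E₁`.
        by_cases hcE : c ∈ E₁
        · have h4 := numGE_succ_of_mem hcE
          rcases h2 hcE with h5 | h5
          · have h6 := numGE_succ_of_mem h5
            rcases Nat.eq_zero_or_pos (numGE E₂ (c + 1 + 1)) with h7 | h7
            · omega
            · obtain ⟨e, he, hle, h8⟩ := exists_least_of_numGE_pos h7
              have h9 := h.unmarked_gt e (by simp [he])
              rw [hg, if_neg (by omega)] at h9
              have := numGE_anti E₁ hle
              omega
          · have h6 := h.unmarked_gt (c + 1) (Or.inr h5)
            rw [hg, if_neg (by omega)] at h6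
            omega
        · have h4 := numGE_succ_of_notMem hcE
          omega
      · have h3 := h.unmarked_gt x (by rw [Finset.mem_insert]; tauto)
        rw [hg] at h3
        have : x ≠ c ∨ x ∉ D₂ := by
          by_cases hxc : x = c
          · right; rw [hxc]; exact h1
          · left; exact hxc
        have hxc : x ≠ c := by
          rintro rfl
          rcases hx with (hx | hx) | hx
          · omega
          · exact hc hx
          · exact h1 hx
        split_ifs at h3 ⊢ <;> omega
    · rw [hk1, ← hk]; exact h.of_mem_unmarked
    · rw [hk1, ← hk]; exact h.of_mem_marked
  · intro h
    refine ⟨fun x hx => ?_, ?_, ?_⟩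
    · rw [hg]
      rw [Finset.mem_insert] at hx
      by_cases hx1 : x = c
      · subst hx1
        rw [if_neg (by omega)]
        have h3 := h.unmarked_gt (x + 1) (by simp)
        rw [hg1, if_neg (by omega)] at h3
        have := numGE_anti E₁ (Nat.le_add_right x 1)
        omega
      · have h3 := h.unmarked_gt x (by rw [Finset.mem_insert]; tauto)
        rw [hg1] at h3
        split_ifs at h3 ⊢ <;> omega
    · rw [hk, ← hk1]; exact h.of_mem_unmarked
    · rw [hk, ← hk1]; exact h.of_mem_marked

/-- Moving an unmarked larger letter down. -/
theorem lattice_unmarked₂_down (hc : c ∉ E₂) (hc1 : c + 1 ∉ E₂)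
    (h0 : 0 ∉ D₂) (h1 : ∀ d ≤ c, d ∈ E₁ → d ∉ D₂)
    (h2 : ∀ d, d + 1 < c → d + 1 ∈ E₁ → d + 1 ∈ E₂ → d ∈ D₂ ∨ d ∈ E₂)
    (h3 : ∀ d, d + 1 = c → c ∈ D₂ ∨ c ∈ E₁ → d ∈ D₂ ∨ d ∈ E₂) :
    Lattice D₁ E₁ D₂ (insert (c + 1) E₂) ↔ Lattice D₁ E₁ D₂ (insert c E₂) := by
  have hg := numGE_insert hc
  have hg1 := numGE_insert hc1
  have hk := card_insert_notMem hc
  have hk1 := card_insert_notMem hc1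
  have hs := numGE_succ_of_notMem hc1
  have hs0 := numGE_succ_of_notMem hc
  constructor
  · intro h
    refine ⟨fun x hx => ?_, ?_, ?_⟩
    · rw [hg]
      rw [Finset.mem_insert] at hx
      by_cases hx1 : x = c
      · subst hx1
        rw [if_neg (by omega)]
        have h3 := h.unmarked_gt (x + 1) (by simp)
        rw [hg1, if_neg (by omega)] at h3
        have := numGE_anti E₁ (Nat.le_add_right x 1)
        omega
      · have h3 := h.unmarked_gt x (by rw [Finset.mem_insert]; tauto)
        rw [hg1] at h3
        split_ifs at h3 ⊢ <;> omega
    · rw [hk, ← hk1]; exact h.of_mem_unmarked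
    · rw [hk, ← hk1]; exact h.of_mem_marked
  · intro h
    -- The move costs one unit at `c` or at `c + 1`; this is harmful only if the counts from `c` on
    -- are equal, and such an equality would propagate down to the main diagonal.
    have htight : c ∈ D₂ ∨ c ∈ E₁ → numGE E₁ c ≠ numGE (insert c E₂) c := by
      intro hm ht
      cases c with
      | zero =>
        rcases hm with hm | hm
        · exact h0 hm
        · have h4 := h.of_mem_unmarked 0 hm
          rw [numGE_zero, numGE_zero] at ht
          rw [numLT_zero] at h4
          omega
      | succ d =>
        refine h.not_tight_below (d + 1) (fun d hd => h1 d hd.le) ?_ ht d rfl ?_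
        · intro e he h5 h6
          rw [Finset.mem_insert] at h6 ⊢
          have := h2 e he h5 (h6.resolve_left (by omega))
          tauto
        · have := h3 d rfl hm
          rw [Finset.mem_insert]
          tauto
    have htop := h.unmarked_gt c (by simp)
    rw [hg, if_neg (by omega)] at htop
    rw [hg, if_pos le_rfl] at htight
    refine ⟨fun x hx => ?_, ?_, ?_⟩
    · rw [hg1]
      rw [Finset.mem_insert] at hx
      by_cases hx1 : x = c + 1
      · subst hx1
        rw [if_neg (by omega)]
        by_cases hcE : c ∈ E₁
        · have h4 := numGE_succ_of_mem hcE
          have := htight (Or.inr hcE)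
          omega
        · have h4 := numGE_succ_of_notMem hcE
          omega
      · by_cases hx2 : x = c
        · subst hx2
          rw [if_pos le_rfl]
          have hm : x ∈ D₂ := by
            rcases hx with (hx | hx) | hx
            · omega
            · exact absurd hx hc
            · exact hx
          have := htight (Or.inl hm)
          omega
        · have h3 := h.unmarked_gt x (by rw [Finset.mem_insert]; tauto)
          rw [hg] at h3
          split_ifs at h3 ⊢ <;> omega
    · rw [hk1, ← hk]; exact h.of_mem_unmarked
    · rw [hk1, ← hk]; exact h.of_mem_marked

/-- Moving a marked larger letter between the diagonals `c` and `c + 1`. -/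
theorem lattice_marked₂ (hc : c ∉ D₂) (hc1 : c + 1 ∉ D₂)
    (h1 : c ∉ E₁) (h2 : c + 1 ∉ E₂)
    (h3 : c ∈ D₁ → ∃ d, d + 1 = c ∧ (d ∈ D₁ ∨ d ∈ E₁)) :
    Lattice D₁ E₁ (insert c D₂) E₂ ↔ Lattice D₁ E₁ (insert (c + 1) D₂) E₂ := by
  have hb := numLT_insert hc
  have hb1 := numLT_insert hc1
  have hg1 := numGE_succ_of_notMem h1
  have hg2 := numGE_succ_of_notMem h2
  have hs := numLT_succ_of_notMem hc
  constructor
  · intro h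
    refine ⟨fun x hx => ?_, fun x hx => ?_, fun x hx => ?_⟩
    · rw [Finset.mem_insert] at hx
      by_cases hx1 : x = c + 1
      · subst hx1
        have := h.unmarked_gt c (by simp)
        omega
      · exact h.unmarked_gt x (by rw [Finset.mem_insert]; tauto)
    · have h4 := h.of_mem_unmarked x hx
      have : x ≠ c := fun e => h1 (e ▸ hx)
      rw [hb] at h4
      rw [hb1]
      split_ifs at h4 ⊢ <;> omega
    · rw [Finset.mem_insert] at hx
      rw [hb1]
      by_cases hx1 : x = c + 1
      · subst hx1
        have h4 := h.of_mem_marked c (by simp)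
        rw [hb, if_neg (by omega)] at h4
        rw [if_neg (by omega)]
        have := numLT_mono D₁ (Nat.le_add_right c 1)
        omega
      · have h4 := h.of_mem_marked x (by rw [Finset.mem_insert]; tauto)
        rw [hb] at h4
        split_ifs at h4 ⊢ <;> omega
  · intro h
    refine ⟨fun x hx => ?_, fun x hx => ?_, fun x hx => ?_⟩
    · rw [Finset.mem_insert] at hx
      by_cases hx1 : x = c
      · subst hx1
        have := h.unmarked_gt (x + 1) (by simp)
        omega
      · exact h.unmarked_gt x (by rw [Finset.mem_insert]; tauto)
    · have h4 := h.of_mem_unmarked x hx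
      have : x ≠ c := fun e => h1 (e ▸ hx)
      rw [hb1] at h4
      rw [hb]
      split_ifs at h4 ⊢ <;> omega
    · rw [Finset.mem_insert] at hx
      rw [hb]
      by_cases hx1 : x = c
      · subst hx1
        have h4 := h.of_mem_marked (x + 1) (by simp)
        rw [hb1, if_neg (by omega)] at h4
        rw [if_neg (by omega)]
        -- The inequality at `c + 1` still counts the marked letter on `c`, which the one at `c`
        -- does not. The lower neighbour `d` from `h3` supplies the unit: by its own inequality if
        -- it is in `E₁`, by the next lower element of `D₂` (or by `card_le`) if it is in `D₁`.
        by_cases hx : x ∈ D₁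
        · have h5 := numLT_succ_of_mem hx
          obtain ⟨d, rfl, hd | hd⟩ := h3 hx
          · have h6 := numLT_succ_of_mem hd
            rcases Nat.eq_zero_or_pos (numLT D₂ (d + 1)) with h7 | h7
            · have := h.card_le
              omega
            · obtain ⟨e, he, hlt, h8⟩ := exists_greatest_of_numLT_pos h7
              have h9 := h.of_mem_marked e (by simp [he])
              rw [hb1, if_neg (by omega)] at h9
              have := numLT_mono D₁ (show e ≤ d by omega)
              omega
          · have h6 := h.of_mem_unmarked d hd
            rw [hb1, if_neg (by omega)] at h6
            have := numLT_mono D₁ (Nat.le_add_right d 1)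
            omega
        · have h5 := numLT_succ_of_notMem hx
          omega
      · have h4 := h.of_mem_marked x (by rw [Finset.mem_insert]; tauto)
        have : x ≠ c + 1 := fun e => hc1 (e ▸ hx.resolve_left hx1)
        rw [hb1] at h4
        split_ifs at h4 ⊢ <;> omega

/-- Moving an unmarked smaller letter to the right. -/
theorem lattice_unmarked₁_right (hc : c ∉ E₁) (hc1 : c + 1 ∉ E₁)
    (h1 : c + 1 ∉ D₂) (h2 : c + 1 ∈ E₂ → c ∈ D₂ ∨ c ∈ E₂) (h3 : c ∉ D₁) :
    Lattice D₁ (insert c E₁) D₂ E₂ ↔ Lattice D₁ (insert (c + 1) E₁) D₂ E₂ := by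
  have hg := numGE_insert hc
  have hg1 := numGE_insert hc1
  have hk := card_insert_notMem hc
  have hk1 := card_insert_notMem hc1
  have hs := numGE_succ_of_notMem hc
  have hs1 := numGE_succ_of_notMem hc1
  have hd := numLT_succ_of_notMem h1
  have hd1 := numLT_succ_of_notMem h3
  constructor
  · intro h
    refine ⟨fun x hx => ?_, fun x hx => ?_, ?_⟩
    · have h4 := h.unmarked_gt x hx
      rw [hg] at h4
      rw [hg1]
      split_ifs at h4 ⊢ <;> omega
    · rw [Finset.mem_insert] at hx
      by_cases hx1 : x = c + 1
      · subst hx1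
        have h4 := h.of_mem_unmarked c (by simp)
        omega
      · have h4 := h.of_mem_unmarked x (by rw [Finset.mem_insert]; tauto)
        omega
    · rw [hk1, ← hk]; exact h.of_mem_marked
  · intro h
    refine ⟨fun x hx => ?_, fun x hx => ?_, ?_⟩
    · have h4 := h.unmarked_gt x hx
      rw [hg1] at h4
      rw [hg]
      by_cases hx1 : x = c + 1
      · subst hx1
        rw [if_pos le_rfl] at h4
        rw [if_neg (by omega)]
        have hm : c + 1 ∈ E₂ := hx.resolve_right h1
        have h5 := h.unmarked_gt c (h2 hm).symm
        have h6 := numGE_succ_of_mem hm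
        rw [hg1, if_pos (by omega)] at h5
        omega
      · split_ifs at h4 ⊢ <;> omega
    · rw [Finset.mem_insert] at hx
      by_cases hx1 : x = c
      · subst hx1
        have h4 := h.of_mem_unmarked (x + 1) (by simp)
        omega
      · have h4 := h.of_mem_unmarked x (by rw [Finset.mem_insert]; tauto)
        omega
    · rw [hk, ← hk1]; exact h.of_mem_marked

/-- Moving an unmarked smaller letter down. -/
theorem lattice_unmarked₁_down (hc : c ∉ E₁) (hc1 : c + 1 ∉ E₁)
    (h0 : 0 ∉ D₁)
    (h1 : c + 1 ∈ E₂ ∨ c + 1 ∈ D₂ → c + 2 ∈ E₁ ∨ c + 2 ∈ D₂)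
    (h2 : ∀ d, c + 1 ≤ d → d ∈ E₂ → d ∉ D₂)
    (h3 : ∀ d, c + 2 ≤ d → d ∈ E₁ → d ∈ E₂ → d + 1 ∈ E₁ ∨ d + 1 ∈ D₂)
    (h4 : ∀ d, d + 1 = c → c ∈ D₁ → d ∈ D₁ ∨ d ∈ E₁) (h5 : c + 1 ∉ D₁)
    (h6 : c ∈ D₂ → c = 0) :
    Lattice D₁ (insert (c + 1) E₁) D₂ E₂ ↔ Lattice D₁ (insert c E₁) D₂ E₂ := by
  have hg := numGE_insert hc
  have hg1 := numGE_insert hc1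
  have hk := card_insert_notMem hc
  have hk1 := card_insert_notMem hc1
  have hs := numGE_succ_of_notMem hc
  have hs1 := numGE_succ_of_notMem hc1
  have hd5 := numLT_succ_of_notMem h5
  constructor
  · intro h
    have key : ∀ x, x ∈ E₂ ∨ x ∈ D₂ → numGE E₂ (x + 1) < numGE (insert c E₁) x := by
      intro x hx
      have h7 := h.unmarked_gt x hx
      rw [hg1] at h7
      rw [hg]
      by_cases hx1 : x = c + 1
      · subst hx1
        rw [if_pos le_rfl] at h7
        rw [if_neg (by omega)]
        -- Moving the letter to `c` lowers the count of `E₁` from `c + 1` on by one. If strictness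
        -- failed, the counts from `c + 2` on would be equal, which `h1` forbids.
        have h8 := not_tight_above (E₁ := E₁) (D₂ := D₂) (E₂ := E₂) (numGE E₁ (c + 2)) (c + 2)
          (fun y hy hm => by
            have := h.unmarked_gt y hm
            rwa [hg1, if_neg (by omega)] at this)
          (fun d hd => h2 d (by omega)) h3 le_rfl
        by_contra hlt
        have h9 : numGE E₂ (c + 2) = numGE E₂ (c + 1 + 1) := rfl
        have h10 : numGE E₁ (c + 2) = numGE E₁ (c + 1 + 1) := rfl
        exact h8 (by omega) (h1 hx)
      · split_ifs at h7 ⊢ <;> omega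
    refine ⟨key, fun x hx => ?_, ?_⟩
    · rw [Finset.mem_insert] at hx
      by_cases hx1 : x = c
      · subst hx1
        have h7 := h.of_mem_unmarked (x + 1) (by simp)
        have hle := h.card_le
        by_cases hxD : x ∈ D₁
        · have h8 := numLT_succ_of_mem hxD
          have h9 := numLT_mono D₂ (Nat.le_add_right (x + 1) 1)
          cases x with
          | zero => exact absurd hxD h0
          | succ d =>
            have hd2 : d + 1 ∉ D₂ := fun hm => by have := h6 hm; omega
            have h10 := numLT_succ_of_notMem hd2
            rcases h4 d rfl hxD with hd | hd
            · have h11 := numLT_succ_of_mem hd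
              rcases Nat.eq_zero_or_pos (numLT D₂ (d + 1)) with h12 | h12
              · omega
              · obtain ⟨e, he, hlt, h13⟩ := exists_greatest_of_numLT_pos h12
                have h14 := h.of_mem_marked e he
                have := numLT_mono D₁ (show e ≤ d by omega)
                omega
            · have h11 := h.of_mem_unmarked d (by simp [hd])
              have := numLT_mono D₁ (Nat.le_add_right d 1)
              omega
        · have h8 := numLT_succ_of_notMem hxD
          have h9 := numLT_mono D₂ (Nat.le_add_right (x + 1) 1)
          omega
      · have h7 := h.of_mem_unmarked x (by rw [Finset.mem_insert]; tauto)
        omega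
    · rw [hk, ← hk1]; exact h.of_mem_marked
  · intro h
    refine ⟨fun x hx => ?_, fun x hx => ?_, ?_⟩
    · have h7 := h.unmarked_gt x hx
      rw [hg] at h7
      rw [hg1]
      split_ifs at h7 ⊢ <;> omega
    · rw [Finset.mem_insert] at hx
      by_cases hx1 : x = c + 1
      · subst hx1
        have h7 := h.of_mem_unmarked c (by simp)
        -- A marked larger letter on `c + 1` would spoil the inequality for the unmarked smaller
        -- letter there. By `h1` the next diagonal carries a letter as well, whose inequality is
        -- strong enough.
        by_cases hd : c + 1 ∈ D₂
        · have h8 := numLT_succ_of_mem hd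
          have h9 := h.of_mem_marked _ hd
          rcases h1 (Or.inr hd) with h10 | h10
          · have h11 := h.of_mem_unmarked (c + 2) (by simp [h10])
            have := numLT_mono D₂ (show c + 1 + 1 ≤ c + 2 + 1 by omega)
            have h12 : numLT D₁ (c + 2) = numLT D₁ (c + 1 + 1) := rfl
            omega
          · have h11 := h.of_mem_marked (c + 2) h10
            have h12 : numLT D₁ (c + 2) = numLT D₁ (c + 1 + 1) := rfl
            have h13 : numLT D₂ (c + 2) = numLT D₂ (c + 1 + 1) := rfl
            omega
        · have h8 := numLT_succ_of_notMem hd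
          have := numLT_mono D₁ (Nat.le_add_right c 1)
          omega
      · have h7 := h.of_mem_unmarked x (by rw [Finset.mem_insert]; tauto)
        omega
    · rw [hk1, ← hk]; exact h.of_mem_marked

/-- Moving a marked smaller letter to the right. -/
theorem lattice_marked₁_right (hc : c ∉ D₁) (hc1 : c + 1 ∉ D₁)
    (h1 : c + 1 ∉ E₁) (h2 : c + 1 ∈ D₂ → c ∈ E₁) :
    Lattice (insert c D₁) E₁ D₂ E₂ ↔ Lattice (insert (c + 1) D₁) E₁ D₂ E₂ := by
  have hb := numLT_insert hc
  have hb1 := numLT_insert hc1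
  have hs := numLT_succ_of_notMem hc
  constructor
  · intro h
    refine ⟨h.unmarked_gt, fun x hx => ?_, fun x hx => ?_⟩
    · have h3 := h.of_mem_unmarked x hx
      have : x ≠ c + 1 := fun e => h1 (e ▸ hx)
      rw [hb] at h3
      rw [hb1]
      split_ifs at h3 ⊢ <;> omega
    · have h3 := h.of_mem_marked x hx
      rw [hb] at h3
      rw [hb1]
      by_cases hx1 : x = c + 1
      · subst hx1
        have h4 := h.of_mem_unmarked c (h2 hx)
        rw [hb, if_neg (by omega)] at h4
        rw [if_neg (by omega)]
        omega
      · split_ifs at h3 ⊢ <;> omega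
  · intro h
    refine ⟨h.unmarked_gt, fun x hx => ?_, fun x hx => ?_⟩
    · have h3 := h.of_mem_unmarked x hx
      rw [hb1] at h3
      rw [hb]
      split_ifs at h3 ⊢ <;> omega
    · have h3 := h.of_mem_marked x hx
      rw [hb1] at h3
      rw [hb]
      split_ifs at h3 ⊢ <;> omega

/-- Moving a marked smaller letter down. -/
theorem lattice_marked₁_down (hc : c ∉ D₁) (hc1 : c + 1 ∉ D₁)
    (h1 : c + 1 ∉ E₁) (h2 : c + 1 ∈ D₂ → c + 2 ∈ E₁ ∨ c + 2 ∈ D₂) :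
    Lattice (insert (c + 1) D₁) E₁ D₂ E₂ ↔ Lattice (insert c D₁) E₁ D₂ E₂ := by
  have hb := numLT_insert hc
  have hb1 := numLT_insert hc1
  have hs := numLT_succ_of_notMem hc
  have hs1 := numLT_succ_of_notMem hc1
  constructor
  · intro h
    refine ⟨h.unmarked_gt, fun x hx => ?_, fun x hx => ?_⟩
    · have h3 := h.of_mem_unmarked x hx
      rw [hb1] at h3
      rw [hb]
      split_ifs at h3 ⊢ <;> omega
    · have h3 := h.of_mem_marked x hx
      rw [hb1] at h3
      rw [hb]
      split_ifs at h3 ⊢ <;> omega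
  · intro h
    refine ⟨h.unmarked_gt, fun x hx => ?_, fun x hx => ?_⟩
    · have h3 := h.of_mem_unmarked x hx
      have : x ≠ c + 1 := fun e => h1 (e ▸ hx)
      rw [hb] at h3
      rw [hb1]
      split_ifs at h3 ⊢ <;> omega
    · have h3 := h.of_mem_marked x hx
      rw [hb] at h3
      rw [hb1]
      by_cases hx1 : x = c + 1
      · subst hx1
        have h8 := numLT_succ_of_mem hx
        rw [if_neg (by omega)]
        have h12 : numLT D₁ (c + 2) = numLT D₁ (c + 1 + 1) := rfl
        have h13 : numLT D₂ (c + 2) = numLT D₂ (c + 1 + 1) := rfl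
        rcases h2 hx with h4 | h4
        · have h5 := h.of_mem_unmarked (c + 2) h4
          have := numLT_mono D₂ (Nat.le_add_right (c + 2) 1)
          rw [hb, if_pos (by omega)] at h5
          omega
        · have h5 := h.of_mem_marked (c + 2) h4
          rw [hb, if_pos (by omega)] at h5
          omega
      · split_ifs at h3 ⊢ <;> omega

/-- The change of marks on the main diagonal, for the larger letter. -/
theorem lattice_corner₂ (h0E : 0 ∉ E₂) (h1E : 1 ∉ E₂) (h0D : 0 ∉ D₂) (h1D : 1 ∉ D₂)
    (h0D₁ : 0 ∉ D₁) (h1 : 0 ∈ E₁ → 1 ∈ E₁) :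
    Lattice D₁ E₁ D₂ (insert 0 (insert 1 E₂)) ↔
      Lattice D₁ E₁ (insert 1 D₂) (insert 0 E₂) := by
  have h0E' : 0 ∉ insert 1 E₂ := by simp [h0E]
  have hg : ∀ x, _ := numGE_insert h0E'
  have hga := numGE_insert h1E
  have hg1 := numGE_insert h0E
  have hb := numLT_insert h1D
  have hk := card_insert_notMem h0E'
  have hka := card_insert_notMem h1E
  have hk1 := card_insert_notMem h0E
  have e1 := numGE_succ_of_notMem h0E
  have e2 := numGE_succ_of_notMem h1E
  have e3 := numLT_succ_of_notMem h0D
  have e4 := numLT_succ_of_notMem h1D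
  have e5 := numLT_succ_of_notMem h0D₁
  have z1 := numLT_zero D₁
  have z2 := numLT_zero D₂
  have z3 := numGE_zero E₂
  have z4 := numGE_zero E₁
  simp only [zero_add] at e1 e2 e3 e4 e5
  constructor
  · intro h
    have a0 := h.unmarked_gt 0 (by simp)
    rw [hg, hga] at a0
    simp at a0
    refine ⟨fun x hx => ?_, fun x hx => ?_, fun x hx => ?_⟩
    · have h3 := h.unmarked_gt x (by simp only [Finset.mem_insert] at hx ⊢; tauto)
      rw [hg, hga] at h3
      rw [hg1]
      split_ifs at h3 ⊢ <;> omega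
    · have h3 := h.of_mem_unmarked x hx
      rw [hk, hka] at h3
      rw [hk1, hb]
      split_ifs at h3 ⊢ <;> omega
    · rw [hk1, hb]
      rw [Finset.mem_insert] at hx
      rcases hx with rfl | hx
      · rw [if_neg (by omega)]
        omega
      · have h3 := h.of_mem_marked x hx
        rw [hk, hka] at h3
        have : x ≠ 0 := fun e => h0D (e ▸ hx)
        have : x ≠ 1 := fun e => h1D (e ▸ hx)
        rw [if_pos (by omega)]
        omega
  · intro h
    have a1 := h.of_mem_marked 1 (by simp)
    rw [hk1, hb, if_neg (by omega)] at a1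
    refine ⟨fun x hx => ?_, fun x hx => ?_, fun x hx => ?_⟩
    · have h3 := h.unmarked_gt x (by simp only [Finset.mem_insert] at hx ⊢; tauto)
      rw [hg1] at h3
      rw [hg, hga]
      rcases Nat.eq_zero_or_pos x with rfl | hx0
      · simp only [zero_add] at h3 ⊢
        simp
        omega
      · split_ifs at h3 ⊢ <;> omega
    · have h3 := h.of_mem_unmarked x hx
      rw [hk1, hb] at h3
      rw [hk, hka]
      rcases Nat.eq_zero_or_pos x with rfl | hx0
      -- At content `0` the inequality before the move is too weak by one, since the removed
      -- unmarked letter reappears among the marked ones only beyond `0`. The one at content `1`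
      -- makes up for it.
      · have h4 := h.of_mem_unmarked 1 (h1 hx)
        rw [hk1, hb, if_pos (by omega)] at h4
        simp only [zero_add]
        simp only [Nat.reduceAdd] at h4 e4
        omega
      · rw [if_pos (by omega)] at h3
        omega
    · have h3 := h.of_mem_marked x (by simp [hx])
      rw [hk1, hb] at h3
      rw [hk, hka]
      have : x ≠ 0 := fun e => h0D (e ▸ hx)
      have : x ≠ 1 := fun e => h1D (e ▸ hx)
      rw [if_pos (by omega)] at h3
      omega

/-- The change of marks on the main diagonal, for the smaller letter. -/
theorem lattice_corner₁ (h0E : 0 ∉ E₁) (h1E : 1 ∉ E₁) (h0D : 0 ∉ D₁) (h1D : 1 ∉ D₁)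
    (h0D₂ : 0 ∉ D₂)
    (h1 : 1 ∈ E₂ ∨ 1 ∈ D₂ → 2 ∈ E₁ ∨ 2 ∈ D₂)
    (h2 : ∀ d, d ∈ E₂ → d ∉ D₂)
    (h3 : ∀ d, 2 ≤ d → d ∈ E₁ → d ∈ E₂ → d + 1 ∈ E₁ ∨ d + 1 ∈ D₂)
    (h4 : 0 ∈ E₂ → 1 ∈ D₂) :
    Lattice D₁ (insert 0 (insert 1 E₁)) D₂ E₂ ↔
      Lattice (insert 1 D₁) (insert 0 E₁) D₂ E₂ := by
  have h0E' : 0 ∉ insert 1 E₁ := by simp [h0E]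
  have hg : ∀ x, _ := numGE_insert h0E'
  have hga := numGE_insert h1E
  have hg1 := numGE_insert h0E
  have hb := numLT_insert h1D
  have hk := card_insert_notMem h0E'
  have hka := card_insert_notMem h1E
  have hk1 := card_insert_notMem h0E
  have e1 := numGE_succ_of_notMem h0E
  have e2 := numGE_succ_of_notMem h1E
  have e3 := numLT_succ_of_notMem h0D
  have e4 := numLT_succ_of_notMem h1D
  have e5 := numLT_succ_of_notMem h0D₂
  have z1 := numLT_zero D₁
  have z2 := numLT_zero D₂
  have z3 := numGE_zero E₂
  have z4 := numGE_zero E₁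
  simp only [zero_add, Nat.reduceAdd] at e1 e2 e3 e4 e5
  constructor
  · intro h
    -- The count of `E₁` from `1` on loses the letter on `1`. As for a single move, failure would
    -- mean equality from `2` on.
    have key1 : 1 ∈ E₂ ∨ 1 ∈ D₂ → numGE E₂ 2 < numGE E₁ 1 := by
      intro hm
      have a1 := h.unmarked_gt 1 hm
      rw [hg, hga] at a1
      simp at a1
      have h8 := not_tight_above (E₁ := E₁) (D₂ := D₂) (E₂ := E₂) (numGE E₁ 2) 2
        (fun y hy hm => by
          have := h.unmarked_gt y hm
          rwa [hg, hga, if_neg (by omega), if_neg (by omega)] at this)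
        (fun d _ => h2 d) h3 le_rfl
      by_contra hlt
      exact h8 (by omega) (h1 hm)
    have key0 : 0 ∈ E₂ → numGE E₂ 1 < numGE E₁ 0 + 1 := by
      intro hm
      have a1 := key1 (Or.inr (h4 hm))
      have := numGE_succ_of_notMem (fun h' => h2 1 h' (h4 hm))
      simp only [Nat.reduceAdd] at this
      omega
    -- At content `0` there are no marked letters to count, so the inequality of `of_mem_unmarked`
    -- reduces to this one.
    have card_lt : E₂.card < E₁.card + 1 := by
      have a1 := h.of_mem_unmarked 1 (by simp)
      rw [hk, hka] at a1
      by_cases hD : 1 ∈ D₂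
      · have := numLT_succ_of_mem hD
        simp only [Nat.reduceAdd] at this a1
        omega
      · have hE : 0 ∉ E₂ := fun h' => hD (h4 h')
        have b1 := numGE_succ_of_notMem hE
        simp only [zero_add] at b1
        by_cases hE1 : 1 ∈ E₂
        · have b2 := numGE_succ_of_mem hE1
          have b3 := key1 (Or.inl hE1)
          simp only [Nat.reduceAdd] at b2
          omega
        · have b2 := numGE_succ_of_notMem hE1
          simp only [Nat.reduceAdd] at b2
          rcases Nat.eq_zero_or_pos (numGE E₂ 2) with h5 | h5
          · omega
          · obtain ⟨e, he, hle, h6⟩ := exists_least_of_numGE_pos h5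
            have h7 := h.unmarked_gt e (Or.inl he)
            rw [hg, hga, if_neg (by omega), if_neg (by omega)] at h7
            have := numGE_anti E₁ hle
            omega
    refine ⟨fun x hx => ?_, fun x hx => ?_, fun x hx => ?_⟩
    · rw [hg1]
      by_cases hx0 : x = 0
      · subst hx0
        rw [if_pos le_rfl]
        exact key0 (hx.resolve_right h0D₂)
      · rw [if_neg (by omega)]
        by_cases hx1 : x = 1
        · subst hx1
          exact key1 hx
        · have := h.unmarked_gt x hx
          rwa [hg, hga, if_neg (by omega), if_neg (by omega)] at this
    · rw [hk1, hb]
      rw [Finset.mem_insert] at hx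
      rcases hx with rfl | hx
      · rw [if_neg (by omega), zero_add]
        omega
      · have : x ≠ 0 := fun e => h0E (e ▸ hx)
        have : x ≠ 1 := fun e => h1E (e ▸ hx)
        have h5 := h.of_mem_unmarked x (by simp [hx])
        rw [hk, hka] at h5
        rw [if_pos (by omega)]
        omega
    · rw [hk1, hb]
      have : x ≠ 0 := fun e => h0D₂ (e ▸ hx)
      have h5 := h.of_mem_marked x hx
      rw [hk, hka] at h5
      by_cases hx1 : x = 1
      · subst hx1
        rw [if_neg (by omega)]
        omega
      · rw [if_pos (by omega)]
        omega
  · intro h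
    refine ⟨fun x hx => ?_, fun x hx => ?_, fun x hx => ?_⟩
    · have h5 := h.unmarked_gt x hx
      rw [hg1] at h5
      rw [hg, hga]
      split_ifs at h5 ⊢ <;> omega
    · rw [hk, hka]
      have a0 := h.of_mem_unmarked 0 (by simp)
      rw [hk1, hb, if_neg (by omega), zero_add] at a0
      simp only [Finset.mem_insert] at hx
      rcases hx with rfl | rfl | hx
      · rw [zero_add]
        omega
      · have : numLT D₂ 2 ≤ numLT D₂ 1 + 1 := by
          by_cases hD : 1 ∈ D₂
          · exact (numLT_succ_of_mem hD).le
          · have := (numLT_succ_of_notMem hD).le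
            simp only [Nat.reduceAdd] at this
            omega
        simp only [Nat.reduceAdd]
        omega
      · have : x ≠ 0 := fun e => h0E (e ▸ hx)
        have : x ≠ 1 := fun e => h1E (e ▸ hx)
        have h5 := h.of_mem_unmarked x (by simp [hx])
        rw [hk1, hb, if_pos (by omega)] at h5
        omega
    · have h5 := h.of_mem_marked x hx
      rw [hk1, hb] at h5
      rw [hk, hka]
      split_ifs at h5 <;> omega

end

/-! ### Words of contents tagged with letters -/

/-- The standard order of boxes, given as pairs of a letter and a content. The letter `2 * i`
stands for a marked symbol and `2 * i + 1` for the corresponding unmarked one; boxes with the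
same marked (unmarked) letter are ordered by decreasing (increasing) content. -/
def Before (a b : ℕ × ℕ) : Prop :=
  a.1 < b.1 ∨ a.1 = b.1 ∧ (a.1 % 2 = 0 ∧ b.2 < a.2 ∨ a.1 % 2 = 1 ∧ a.2 < b.2)

/-- Each marked letter has an unmarked partner of smaller content. -/
def Normal (L : List (ℕ × ℕ)) : Prop :=
  ∀ i c, (2 * i, c) ∈ L → ∃ c' < c, (2 * i + 1, c') ∈ L

/-- The contents of the boxes with a given letter. -/
def contents (τ : ℕ) (L : List (ℕ × ℕ)) : Finset ℕ :=
  ((L.filter fun e => e.1 = τ).map Prod.snd).toFinset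

@[simp] theorem mem_contents {τ c : ℕ} {L : List (ℕ × ℕ)} : c ∈ contents τ L ↔ (τ, c) ∈ L := by
  simp [contents]

/-- The lattice condition for the `i`-th letter and its successor. -/
def LatticeAt (i : ℕ) (L : List (ℕ × ℕ)) : Prop :=
  Lattice (contents (2 * i) L) (contents (2 * i + 1) L) (contents (2 * i + 2) L)
    (contents (2 * i + 3) L)

theorem contents_insert_self (τ l : ℕ) (P S : List (ℕ × ℕ)) :
    contents τ (P ++ (τ, l) :: S) = insert l (contents τ (P ++ S)) := by
  ext c
  simp
  tauto

theorem contents_insert_of_ne {σ τ : ℕ} (h : σ ≠ τ) (l : ℕ) (P S : List (ℕ × ℕ)) :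
    contents σ (P ++ (τ, l) :: S) = contents σ (P ++ S) := by
  ext c
  simp [h]

/-- `Valid.between` with letters attached. The standard order leaves few possible letters for the
box found in this way; this is the source of the membership hypotheses of the lattice lemmas. -/
theorem exists_after {N : ℕ → ℕ} {P : List (ℕ × ℕ)} {B W : List ℕ} {σ t : ℕ}
    (h : Valid N (P.map Prod.snd ++ (B ++ t :: W))) (hP : P.Pairwise Before)
    (hx : (σ, t) ∈ P) (m : ℕ) (hm : m = t + 1 ∨ m + 1 = t) :
    m ∈ B ∨ ∃ σ', (σ', m) ∈ P ∧ Before (σ, t) (σ', m) := by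
  obtain ⟨A, C, rfl⟩ := List.append_of_mem hx
  have h1 := Valid.between (A := A.map Prod.snd) (B := C.map Prod.snd ++ B) (C := W) (by simpa using h)
  have h2 : m ∈ C.map Prod.snd ++ B := by
    rcases hm with rfl | hm
    · exact h1.1
    · exact h1.2 m hm
  rcases List.mem_append.mp h2 with h3 | h3
  · right
    obtain ⟨⟨σ', m'⟩, h4, rfl⟩ := List.mem_map.mp h3
    refine ⟨σ', by simp [h4], ?_⟩
    rw [List.pairwise_append, List.pairwise_cons] at hP
    exact hP.2.1.1 _ h4
  · exact Or.inl h3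

theorem exists_before {N : ℕ → ℕ} {S : List (ℕ × ℕ)} {B W : List ℕ} {σ t : ℕ}
    (h : Valid N (W ++ t :: (B ++ S.map Prod.snd))) (hS : S.Pairwise Before)
    (hx : (σ, t) ∈ S) (m : ℕ) (hm : m = t + 1 ∨ m + 1 = t) :
    m ∈ B ∨ ∃ σ', (σ', m) ∈ S ∧ Before (σ', m) (σ, t) := by
  obtain ⟨A, C, rfl⟩ := List.append_of_mem hx
  have h1 := Valid.between (A := W) (B := B ++ A.map Prod.snd) (C := C.map Prod.snd)
    (by simpa using h)
  have h2 : m ∈ B ++ A.map Prod.snd := by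
    rcases hm with rfl | hm
    · exact h1.1
    · exact h1.2 m hm
  rcases List.mem_append.mp h2 with h3 | h3
  · exact Or.inl h3
  · right
    obtain ⟨⟨σ', m'⟩, h4, rfl⟩ := List.mem_map.mp h3
    refine ⟨σ', by simp [h4], ?_⟩
    rw [List.pairwise_append] at hS
    exact hS.2.2 _ h4 _ (by simp)

theorem Before.asymm {a b : ℕ × ℕ} (h : Before a b) : ¬ Before b a := by
  unfold Before at *
  omega

theorem Before.trans {a b c : ℕ × ℕ} (h : Before a b) (h' : Before b c) : Before a c := by
  unfold Before at *
  omega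

/-- The case in which both additions on the diagonal belong to the tagged word, so that the letter
of the box found is bounded on both sides. -/
theorem exists_between {N : ℕ → ℕ} {Q : List (ℕ × ℕ)} {W W' : List ℕ} {σ τ c : ℕ}
    (h : Valid N (W ++ (Q.map Prod.snd ++ W'))) (hQ : Q.Pairwise Before)
    (hx : (σ, c) ∈ Q) (hy : (τ, c) ∈ Q) (hlt : σ < τ) (m : ℕ) (hm : m = c + 1 ∨ m + 1 = c) :
    ∃ σ', (σ', m) ∈ Q ∧ Before (σ, c) (σ', m) ∧ Before (σ', m) (τ, c) := by
  obtain ⟨A, C, rfl⟩ := List.append_of_mem hy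
  have hP := hQ
  rw [List.pairwise_append, List.pairwise_cons] at hP
  have hb : Before (σ, c) (τ, c) := Or.inl hlt
  have hxA : (σ, c) ∈ A := by
    rcases List.mem_append.mp hx with h1 | h1
    · exact h1
    · rcases List.mem_cons.mp h1 with h1 | h1
      · simp only [Prod.mk.injEq] at h1; omega
      · exact absurd (hP.2.1.1 _ h1) hb.asymm
  rw [valid_append] at h
  have h1 := exists_after (B := []) (W := C.map Prod.snd ++ W') (by simpa using h.2) hP.1 hxA m hm
  obtain ⟨σ', h2, h3⟩ := h1.resolve_left (by simp)
  exact ⟨σ', by simp [h2], h3, hP.2.2 _ h2 _ (by simp)⟩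

/-! ### One letter changes its diagonal -/

set_option maxHeartbeats 1600000 in
/-- One step of the slide of a box of content `t` past a box of adjacent content `l`. -/
theorem slide_step {N : ℕ → ℕ} {P S : List (ℕ × ℕ)} {τ l t : ℕ}
    (hv : Valid N (P.map Prod.snd ++ l :: t :: S.map Prod.snd))
    (hadj : l + 1 = t ∨ t + 1 = l)
    (hs : (P ++ (τ, l) :: S).Pairwise Before) (hn : Normal (P ++ (τ, l) :: S))
    (hc : ¬ (τ % 2 = 1 ∧ l = 1 ∧ t = 0 ∧ (τ, 0) ∈ P)) :
    (P ++ (τ, t) :: S).Pairwise Before ∧ Normal (P ++ (τ, t) :: S) ∧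
      ∀ i, LatticeAt i (P ++ (τ, l) :: S) ↔ LatticeAt i (P ++ (τ, t) :: S) := by
  have hs' := hs
  rw [List.pairwise_append, List.pairwise_cons] at hs'
  obtain ⟨hP, ⟨hXS, hS⟩, hPXS⟩ := hs'
  have hPX : ∀ p ∈ P, Before p (τ, l) := fun p hp => hPXS p hp _ (by simp)
  have hPS : ∀ p ∈ P, ∀ s ∈ S, Before p s := fun p hp s hs => hPXS p hp s (by simp [hs])
  -- the diagonals hit between two additions
  have fPX : ∀ {σ}, (σ, l) ∈ P → ∀ m, m = l + 1 ∨ m + 1 = l →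
      ∃ σ', (σ', m) ∈ P ∧ Before (σ, l) (σ', m) := fun hx m hm =>
    (exists_after (B := []) hv hP hx m hm).resolve_left (by simp)
  have fPh : ∀ {σ}, (σ, t) ∈ P → ∀ m, m = t + 1 ∨ m + 1 = t →
      m = l ∨ ∃ σ', (σ', m) ∈ P ∧ Before (σ, t) (σ', m) := fun hx m hm => by
    simpa using exists_after (B := [l]) hv hP hx m hm
  have fhS : ∀ {σ}, (σ, t) ∈ S → ∀ m, m = t + 1 ∨ m + 1 = t →
      ∃ σ', (σ', m) ∈ S ∧ Before (σ', m) (σ, t) := fun hx m hm =>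
    (exists_before (B := []) (W := P.map Prod.snd ++ [l]) (by simpa using hv) hS hx m
      hm).resolve_left (by simp)
  have fXS : ∀ {σ}, (σ, l) ∈ S → ∀ m, m = l + 1 ∨ m + 1 = l →
      m = t ∨ ∃ σ', (σ', m) ∈ S ∧ Before (σ', m) (σ, l) := fun hx m hm => by
    simpa using exists_before (B := [t]) (W := P.map Prod.snd) hv hS hx m hm
  have fPP : ∀ {σ τ' c}, (σ, c) ∈ P → (τ', c) ∈ P → σ < τ' → ∀ m, m = c + 1 ∨ m + 1 = c →
      ∃ σ', (σ', m) ∈ P ∧ Before (σ, c) (σ', m) ∧ Before (σ', m) (τ', c) := fun h1 h2 h3 =>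
    exists_between (W := []) hv hP h1 h2 h3
  have fSS : ∀ {σ τ' c}, (σ, c) ∈ S → (τ', c) ∈ S → σ < τ' → ∀ m, m = c + 1 ∨ m + 1 = c →
      ∃ σ', (σ', m) ∈ S ∧ Before (σ, c) (σ', m) ∧ Before (σ', m) (τ', c) := fun h1 h2 h3 =>
    exists_between (W := P.map Prod.snd ++ [l, t]) (W' := []) (by simpa using hv) hS h1 h2 h3
  simp only [Before] at fPX fPh fhS fXS fPP fSS hPX hXS
  -- the new list is in standard order
  have hPX' : ∀ p ∈ P, Before p (τ, t) := by
    rintro ⟨σ, c⟩ hp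
    have h1 := hPX _ hp
    simp only [Before] at h1 ⊢
    rcases h1 with h1 | ⟨rfl, h1⟩
    · exact Or.inl h1
    · refine Or.inr ⟨rfl, ?_⟩
      -- Suppose the letter `τ` is already on `t`. Between this box and the sliding one there is a
      -- box on the diagonal next to `t` away from `l`; it would have to carry `τ` too, in the wrong
      -- order. This diagonal is missing only for `t = 0`, which is the corner case excluded by
      -- `hc`.
      have h2 : c ≠ t := by
        rintro rfl
        rcases h1 with h1 | h1
        · rcases fPh hp (c + 1) (by omega) with h3 | ⟨σ', h3, h4⟩
          · omega
          · have := hPX _ h3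
            simp only at this
            omega
        · rcases Nat.eq_zero_or_pos c with h0 | h0
          · subst h0
            exact hc ⟨h1.1, by omega, rfl, hp⟩
          · rcases fPh hp (c - 1) (by omega) with h3 | ⟨σ', h3, h4⟩
            · omega
            · have := hPX _ h3
              simp only at this
              omega
      omega
  have hXS' : ∀ s ∈ S, Before (τ, t) s := by
    rintro ⟨σ, c⟩ hp
    have h1 := hXS _ hp
    simp only [Before] at h1 ⊢
    rcases h1 with h1 | ⟨rfl, h1⟩
    · exact Or.inl h1
    · refine Or.inr ⟨rfl, ?_⟩
      have h2 : c ≠ t := by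
        rintro rfl
        obtain ⟨σ', h3, h4⟩ := fhS hp (c + 1) (by omega)
        have := hXS _ h3
        simp only at this
        omega
      omega
  have hnew : (P ++ (τ, t) :: S).Pairwise Before := by
    rw [List.pairwise_append, List.pairwise_cons]
    refine ⟨hP, ⟨hXS', hS⟩, fun p hp s hs => ?_⟩
    rcases List.mem_cons.mp hs with rfl | hs
    · exact hPX' p hp
    · exact hPS p hp s hs
  simp only [Before] at hPX' hXS'
  have hnnew : Normal (P ++ (τ, t) :: S) := by
    intro i c hm
    simp only [List.mem_append, List.mem_cons, Prod.mk.injEq] at hm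
    by_cases hX : 2 * i = τ ∧ c = t
    · obtain ⟨rfl, rfl⟩ := hX
      obtain ⟨c', h1, h2⟩ := hn i l (by simp)
      refine ⟨c', ?_, ?_⟩
      · simp only [List.mem_append, List.mem_cons, Prod.mk.injEq] at h2
        have h3 : (2 * i + 1, c') ∈ S := by
          rcases h2 with h2 | h2 | h2
          · have := hPX _ h2
            simp only at this
            omega
          · omega
          · exact h2
        have h4 : c' ≠ c := by
          rintro rfl
          obtain ⟨σ', h5, h6⟩ := fhS h3 (c' + 1) (by omega)
          have := hXS _ h5
          simp only at this
          omega
        omega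
      · simp only [List.mem_append, List.mem_cons, Prod.mk.injEq] at h2 ⊢
        rcases h2 with h2 | h2 | h2
        · exact Or.inl h2
        · omega
        · exact Or.inr (Or.inr h2)
    · have hm' : (2 * i, c) ∈ P ∨ (2 * i, c) ∈ S := by tauto
      obtain ⟨c', h1, h2⟩ := hn i c (by
        simp only [List.mem_append, List.mem_cons]
        tauto)
      simp only [List.mem_append, List.mem_cons, Prod.mk.injEq] at h2
      by_cases hX' : 2 * i + 1 = τ ∧ c' = l
      · obtain ⟨rfl, rfl⟩ := hX'
        refine ⟨t, ?_, by simp⟩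
        have h3 : (2 * i, c) ∈ P := by
          refine hm'.resolve_right fun h => ?_
          have := hXS _ h
          simp only at this
          omega
        have h4 : c ≠ t := by
          rintro rfl
          rcases fPh h3 (c + 1) (by omega) with h5 | ⟨σ', h5, h6⟩
          · omega
          · have := hPX _ h5
            simp only at this
            omega
        omega
      · exact ⟨c', h1, by simp only [List.mem_append, List.mem_cons]; tauto⟩
  refine ⟨hnew, hnnew, fun i => ?_⟩
  -- A marked letter on the main diagonal would need an unmarked partner of negative content.
  have hP0 : ∀ j, (2 * j, 0) ∉ P ++ S := fun j hm => by
    obtain ⟨c', h, -⟩ := hn j 0 (by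
      simp only [List.mem_append, List.mem_cons] at hm ⊢; tauto)
    omega
  have hX0 : τ % 2 = 0 → l ≠ 0 ∧ t ≠ 0 := fun h => by
    constructor
    · rintro rfl
      obtain ⟨c', h, -⟩ := hn (τ / 2) 0 (by
        rw [show 2 * (τ / 2) = τ by omega]; simp)
      omega
    · rintro rfl
      obtain ⟨c', h, -⟩ := hnnew (τ / 2) 0 (by
        rw [show 2 * (τ / 2) = τ by omega]; simp)
      omega
  simp only [Prod.forall] at hPX hPX' hXS hXS'
  have nl : l ∉ contents τ (P ++ S) := by
    rw [mem_contents, List.mem_append]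
    rintro (h | h)
    · have := hPX _ _ h; omega
    · have := hXS _ _ h; omega
  have nt : t ∉ contents τ (P ++ S) := by
    rw [mem_contents, List.mem_append]
    rintro (h | h)
    · have := hPX' _ _ h; omega
    · have := hXS' _ _ h; omega
  have inP : ∀ {σ c}, σ < τ → (σ, c) ∈ P ++ S → (σ, c) ∈ P := fun h1 h2 =>
    (List.mem_append.mp h2).resolve_right fun h3 => by have := hXS _ _ h3; omega
  have inS : ∀ {σ c}, τ < σ → (σ, c) ∈ P ++ S → (σ, c) ∈ S := fun h1 h2 =>
    (List.mem_append.mp h2).resolve_left fun h3 => by have := hPX _ _ h3; omega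
  have mP : ∀ {e}, e ∈ P → e ∈ P ++ S := fun h => List.mem_append_left _ h
  have mS : ∀ {e}, e ∈ S → e ∈ P ++ S := fun h => List.mem_append_right _ h
  unfold LatticeAt
  -- The lattice condition at `i` sees four letters: `2 * i` to `2 * i + 3`. If `τ` is one of them,
  -- the lemma for this letter and the direction of the move applies; otherwise nothing changes.
  by_cases c0 : τ = 2 * i
  · subst c0
    rw [contents_insert_self, contents_insert_self]
    rw [contents_insert_of_ne (by omega), contents_insert_of_ne (by omega),
      contents_insert_of_ne (by omega), contents_insert_of_ne (by omega),
      contents_insert_of_ne (by omega), contents_insert_of_ne (by omega)]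
    rcases hadj with rfl | rfl
    · refine lattice_marked₁_right nl nt ?_ ?_ <;> rw [mem_contents]
      · intro h
        obtain ⟨σ', h1, h2⟩ := fhS (inS (by omega) h) (l + 2) (by omega)
        have := hXS _ _ h1
        have := hXS' _ _ h1
        omega
      · intro h
        obtain ⟨σ', h1, h2⟩ := fhS (inS (by omega) h) l (by omega)
        have := hXS _ _ h1
        have := hXS' _ _ h1
        rw [mem_contents]
        obtain rfl : σ' = 2 * i + 1 := by omega
        exact mS h1
    · refine lattice_marked₁_down nt nl ?_ ?_ <;> rw [mem_contents]
      · intro h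
        rcases fXS (inS (by omega) h) (t + 2) (by omega) with h1 | ⟨σ', h1, h2⟩
        · omega
        · have := hXS _ _ h1
          omega
      · intro h
        rcases fXS (inS (by omega) h) (t + 2) (by omega) with h1 | ⟨σ', h1, h2⟩
        · omega
        · have := hXS _ _ h1
          rw [mem_contents, mem_contents]
          obtain rfl | rfl : σ' = 2 * i + 1 ∨ σ' = 2 * i + 2 := by omega
          · exact Or.inl (mS h1)
          · exact Or.inr (mS h1)
  by_cases c1 : τ = 2 * i + 1
  · subst c1
    rw [contents_insert_self, contents_insert_self]
    rw [contents_insert_of_ne (by omega), contents_insert_of_ne (by omega),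
      contents_insert_of_ne (by omega), contents_insert_of_ne (by omega),
      contents_insert_of_ne (by omega), contents_insert_of_ne (by omega)]
    rcases hadj with rfl | rfl
    · refine lattice_unmarked₁_right nl nt ?_ ?_ ?_ <;> simp only [mem_contents]
      · intro h
        obtain ⟨σ', h1, h2⟩ := fhS (inS (by omega) h) l (by omega)
        have := hXS _ _ h1
        omega
      · intro h
        obtain ⟨σ', h1, h2⟩ := fhS (inS (by omega) h) l (by omega)
        have := hXS _ _ h1
        obtain rfl | rfl : σ' = 2 * i + 2 ∨ σ' = 2 * i + 3 := by omega
        · exact Or.inl (mS h1)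
        · exact Or.inr (mS h1)
      · intro h
        obtain ⟨σ', h1, h2⟩ := fPX (inP (by omega) h) (l + 1) (by omega)
        have := hPX _ _ h1
        omega
    · refine lattice_unmarked₁_down nt nl (by rw [mem_contents]; exact hP0 i) ?_ ?_ ?_ ?_ ?_ ?_ <;>
        simp only [mem_contents]
      · intro h
        have h' : ∃ σ, (σ = 2 * i + 2 ∨ σ = 2 * i + 3) ∧ (σ, t + 1) ∈ S := by
          rcases h with h | h
          · exact ⟨_, Or.inr rfl, inS (by omega) h⟩
          · exact ⟨_, Or.inl rfl, inS (by omega) h⟩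
        obtain ⟨σ, hσ, h⟩ := h'
        rcases fXS h (t + 2) (by omega) with h1 | ⟨σ', h1, h2⟩
        · omega
        · have := hXS _ _ h1
          obtain rfl | rfl : σ' = 2 * i + 1 ∨ σ' = 2 * i + 2 := by omega
          · exact Or.inl (mS h1)
          · exact Or.inr (mS h1)
      · intro d hd h h'
        obtain ⟨σ', h1, h2⟩ := fSS (inS (by omega) h') (inS (by omega) h) (by omega) (d + 1)
          (by omega)
        omega
      · intro d hd h h'
        have h3 : (2 * i + 1, d) ∈ S := (List.mem_append.mp h).resolve_left fun h3 => by
          have := hPX _ _ h3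
          omega
        obtain ⟨σ', h1, h2⟩ := fSS h3 (inS (by omega) h') (by omega) (d + 1) (by omega)
        obtain rfl | rfl : σ' = 2 * i + 1 ∨ σ' = 2 * i + 2 := by omega
        · exact Or.inl (mS h1)
        · exact Or.inr (mS h1)
      · intro d hd h
        rcases fPh (inP (by omega) h) d (by omega) with h1 | ⟨σ', h1, h2⟩
        · omega
        · have := hPX _ _ h1
          obtain rfl | rfl : σ' = 2 * i ∨ σ' = 2 * i + 1 := by omega
          · exact Or.inl (mP h1)
          · exact Or.inr (mP h1)
      · intro h
        obtain ⟨σ', h1, h2⟩ := fPX (inP (by omega) h) (t + 2) (by omega)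
        have := hPX _ _ h1
        omega
      · intro h
        by_contra h0
        obtain ⟨σ', h1, h2⟩ := fhS (inS (by omega) h) (t - 1) (by omega)
        have := hXS _ _ h1
        omega
  by_cases c2 : τ = 2 * i + 2
  · subst c2
    rw [contents_insert_self, contents_insert_self]
    rw [contents_insert_of_ne (by omega), contents_insert_of_ne (by omega),
      contents_insert_of_ne (by omega), contents_insert_of_ne (by omega),
      contents_insert_of_ne (by omega), contents_insert_of_ne (by omega)]
    have h0 := hX0 (by omega)
    rcases hadj with rfl | rfl
    · refine lattice_marked₂ nl nt ?_ ?_ ?_ <;> simp only [mem_contents]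
      · intro h
        obtain ⟨σ', h1, h2⟩ := fPX (inP (by omega) h) (l - 1) (by omega)
        have := hPX _ _ h1
        omega
      · intro h
        obtain ⟨σ', h1, h2⟩ := fhS (inS (by omega) h) (l + 2) (by omega)
        have := hXS _ _ h1
        have := hXS' _ _ h1
        omega
      · intro h
        refine ⟨l - 1, by omega, ?_⟩
        obtain ⟨σ', h1, h2⟩ := fPX (inP (by omega) h) (l - 1) (by omega)
        have := hPX _ _ h1
        obtain rfl | rfl : σ' = 2 * i ∨ σ' = 2 * i + 1 := by omega
        · exact Or.inl (mP h1)
        · exact Or.inr (mP h1)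
    · refine (lattice_marked₂ nt nl ?_ ?_ ?_).symm <;> simp only [mem_contents]
      · intro h
        rcases fPh (inP (by omega) h) (t - 1) (by omega) with h1 | ⟨σ', h1, h2⟩
        · omega
        · have := hPX _ _ h1
          omega
      · intro h
        rcases fXS (inS (by omega) h) (t + 2) (by omega) with h1 | ⟨σ', h1, h2⟩
        · omega
        · have := hXS _ _ h1
          omega
      · intro h
        refine ⟨t - 1, by omega, ?_⟩
        rcases fPh (inP (by omega) h) (t - 1) (by omega) with h1 | ⟨σ', h1, h2⟩
        · omega
        · have := hPX _ _ h1
          obtain rfl | rfl : σ' = 2 * i ∨ σ' = 2 * i + 1 := by omega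
          · exact Or.inl (mP h1)
          · exact Or.inr (mP h1)
  by_cases c3 : τ = 2 * i + 3
  · subst c3
    rw [contents_insert_self, contents_insert_self]
    rw [contents_insert_of_ne (by omega), contents_insert_of_ne (by omega),
      contents_insert_of_ne (by omega), contents_insert_of_ne (by omega),
      contents_insert_of_ne (by omega), contents_insert_of_ne (by omega)]
    rcases hadj with rfl | rfl
    · refine lattice_unmarked₂_right nl nt ?_ ?_ <;> simp only [mem_contents]
      · intro h
        obtain ⟨σ', h1, h2⟩ := fPX (inP (by omega) h) (l + 1) (by omega)
        have := hPX _ _ h1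
        omega
      · intro h
        obtain ⟨σ', h1, h2⟩ := fPX (inP (by omega) h) (l + 1) (by omega)
        have := hPX _ _ h1
        obtain rfl | rfl : σ' = 2 * i + 1 ∨ σ' = 2 * i + 2 := by omega
        · exact Or.inl (mP h1)
        · exact Or.inr (mP h1)
    · refine lattice_unmarked₂_down nt nl (by rw [mem_contents]; exact hP0 (i + 1)) ?_ ?_ ?_ <;>
        simp only [mem_contents]
      · intro d hd h h'
        obtain ⟨σ', h1, h2⟩ := fPP (inP (by omega) h) (inP (by omega) h') (by omega) (d - 1)
          (by have : d ≠ 0 := by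
                rintro rfl; exact hP0 (i + 1) h'
              omega)
        omega
      · intro d hd h h'
        have h3 : (2 * i + 3, d + 1) ∈ P := (List.mem_append.mp h').resolve_right fun h3 => by
          have := hXS _ _ h3
          omega
        obtain ⟨σ', h1, h2⟩ := fPP (inP (by omega) h) h3 (by omega) d (by omega)
        obtain rfl | rfl : σ' = 2 * i + 2 ∨ σ' = 2 * i + 3 := by omega
        · exact Or.inl (mP h1)
        · exact Or.inr (mP h1)
      · intro d hd h
        have h' : ∃ σ, (σ = 2 * i + 1 ∨ σ = 2 * i + 2) ∧ (σ, t) ∈ P := by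
          rcases h with h | h
          · exact ⟨_, Or.inr rfl, inP (by omega) h⟩
          · exact ⟨_, Or.inl rfl, inP (by omega) h⟩
        obtain ⟨σ, hσ, h⟩ := h'
        rcases fPh h d (by omega) with h1 | ⟨σ', h1, h2⟩
        · omega
        · have := hPX _ _ h1
          obtain rfl | rfl : σ' = 2 * i + 2 ∨ σ' = 2 * i + 3 := by omega
          · exact Or.inl (mP h1)
          · exact Or.inr (mP h1)
  · have e (σ : ℕ) (h : σ ≠ τ) : contents σ (P ++ (τ, l) :: S) = contents σ (P ++ (τ, t) :: S) := by
      rw [contents_insert_of_ne h, contents_insert_of_ne h]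
    rw [e _ (by omega), e _ (by omega), e _ (by omega), e _ (by omega)]

set_option maxHeartbeats 1600000 in
/-- The slide of a box of content `0` past two boxes with contents `0` and `1` and the same
unmarked letter. -/
theorem slide_corner {N : ℕ → ℕ} {P S : List (ℕ × ℕ)} {j : ℕ}
    (hv : Valid N (P.map Prod.snd ++ 0 :: 1 :: 0 :: S.map Prod.snd))
    (hs : (P ++ (2 * j + 1, 0) :: (2 * j + 1, 1) :: S).Pairwise Before)
    (hn : Normal (P ++ (2 * j + 1, 0) :: (2 * j + 1, 1) :: S)) :
    (P ++ (2 * j, 1) :: (2 * j + 1, 0) :: S).Pairwise Before ∧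
      Normal (P ++ (2 * j, 1) :: (2 * j + 1, 0) :: S) ∧
      ∀ i, LatticeAt i (P ++ (2 * j + 1, 0) :: (2 * j + 1, 1) :: S) ↔
        LatticeAt i (P ++ (2 * j, 1) :: (2 * j + 1, 0) :: S) := by
  have hs' := hs
  rw [List.pairwise_append, List.pairwise_cons, List.pairwise_cons] at hs'
  obtain ⟨hP, ⟨-, hXS, hS⟩, hPXS⟩ := hs'
  have hPX : ∀ p ∈ P, Before p (2 * j + 1, 0) := fun p hp => hPXS p hp _ (by simp)
  have hPS : ∀ p ∈ P, ∀ s ∈ S, Before p s := fun p hp s hs => hPXS p hp s (by simp [hs])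
  have fPX : ∀ {σ}, (σ, 0) ∈ P → ∃ σ', (σ', 1) ∈ P ∧ Before (σ, 0) (σ', 1) := fun hx =>
    (exists_after (B := []) hv hP hx 1 (by omega)).resolve_left (by simp)
  have fPY : ∀ {σ}, (σ, 1) ∈ P → ∃ σ', (σ', 2) ∈ P ∧ Before (σ, 1) (σ', 2) := fun hx =>
    (exists_after (B := [0]) hv hP hx 2 (by omega)).resolve_left (by simp)
  have fhS : ∀ {σ}, (σ, 0) ∈ S → ∃ σ', (σ', 1) ∈ S ∧ Before (σ', 1) (σ, 0) := fun hx =>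
    (exists_before (B := []) (W := P.map Prod.snd ++ [0, 1]) (by simpa using hv) hS hx 1
      (by omega)).resolve_left (by simp)
  have fYS : ∀ {σ}, (σ, 1) ∈ S → ∃ σ', (σ', 2) ∈ S ∧ Before (σ', 2) (σ, 1) := fun hx =>
    (exists_before (B := [0]) (W := P.map Prod.snd ++ [0]) (by simpa using hv) hS hx 2
      (by omega)).resolve_left (by simp)
  have fSS : ∀ {σ τ' c}, (σ, c) ∈ S → (τ', c) ∈ S → σ < τ' →
      ∃ σ', (σ', c + 1) ∈ S ∧ Before (σ, c) (σ', c + 1) ∧ Before (σ', c + 1) (τ', c) :=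
    fun h1 h2 h3 => exists_between (W := P.map Prod.snd ++ [0, 1, 0]) (W' := [])
      (by simpa using hv) hS h1 h2 h3 _ (Or.inl rfl)
  simp only [Before, Prod.forall] at fPX fPY fhS fYS fSS hPX hXS
  have hn0 : ∀ i, (2 * i, 0) ∉ P ++ S := fun i hm => by
    obtain ⟨c', h, -⟩ := hn i 0 (by
      simp only [List.mem_append, List.mem_cons] at hm ⊢; tauto)
    omega
  -- After a letter `2 * j` on content `1` in `P` there is a box on content `2`, still before the
  -- letter `2 * j + 1` on content `0`. Neither `2 * j` nor `2 * j + 1` can stand there in standard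
  -- order.
  have hn1 : (2 * j, 1) ∉ P ++ S := fun hm => by
    rcases List.mem_append.mp hm with h | h
    · obtain ⟨σ', h1, h2⟩ := fPY h
      have := hPX _ _ h1
      omega
    · have := hXS _ _ h
      omega
  have no : ∀ c < 2, (2 * j + 1, c) ∉ P ++ S := fun c hc hm => by
    rcases List.mem_append.mp hm with h | h
    · have := hPX _ _ h
      omega
    · have := hXS _ _ h
      omega
  have inP : ∀ {σ c}, σ < 2 * j + 1 → (σ, c) ∈ P ++ S → (σ, c) ∈ P := fun h1 h2 =>
    (List.mem_append.mp h2).resolve_right fun h3 => by have := hXS _ _ h3; omega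
  have inS : ∀ {σ c}, 2 * j + 1 ≤ σ → (σ, c) ∈ P ++ S → (σ, c) ∈ S := fun h1 h2 =>
    (List.mem_append.mp h2).resolve_left fun h3 => by have := hPX _ _ h3; omega
  have mP : ∀ {e}, e ∈ P → e ∈ P ++ S := fun h => List.mem_append_left _ h
  have mS : ∀ {e}, e ∈ S → e ∈ P ++ S := fun h => List.mem_append_right _ h
  refine ⟨?_, ?_, fun i => ?_⟩
  · rw [List.pairwise_append, List.pairwise_cons, List.pairwise_cons]
    refine ⟨hP, ⟨?_, ?_, hS⟩, ?_⟩
    · rintro ⟨σ, c⟩ hm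
      rcases List.mem_cons.mp hm with h | h
      · simp only [Prod.mk.injEq] at h
        exact Or.inl (by simp only; omega)
      · have := hXS _ _ h
        exact Or.inl (by simp only; omega)
    · rintro ⟨σ, c⟩ h
      have := hXS _ _ h
      simp only [Before]
      omega
    · rintro ⟨σ, c⟩ hp ⟨σ', c'⟩ hm
      have h1 := hPX _ _ hp
      simp only [List.mem_cons, Prod.mk.injEq] at hm
      rcases hm with ⟨rfl, rfl⟩ | ⟨rfl, rfl⟩ | hm
      · simp only [Before]
        by_cases hσ : σ = 2 * j
        · subst hσ
          have h2 : c ≠ 0 := by rintro rfl; exact hn0 _ (mP hp)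
          have h3 : c ≠ 1 := by rintro rfl; exact hn1 (mP hp)
          omega
        · omega
      · exact h1
      · exact hPS _ hp _ hm
  · intro i c hm
    simp only [List.mem_append, List.mem_cons, Prod.mk.injEq] at hm
    by_cases hX : i = j ∧ c = 1
    · exact ⟨0, by omega, by simp [hX.1]⟩
    · obtain ⟨c', h1, h2⟩ := hn i c (by
        simp only [List.mem_append, List.mem_cons, Prod.mk.injEq]
        rcases hm with h | h | h | h
        · exact Or.inl h
        · omega
        · omega
        · exact Or.inr (Or.inr (Or.inr h)))
      simp only [List.mem_append, List.mem_cons, Prod.mk.injEq] at h2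
      by_cases hi : i = j ∧ c' ≤ 1
      · exact ⟨0, by omega, by simp [hi.1]⟩
      · refine ⟨c', h1, ?_⟩
        simp only [List.mem_append, List.mem_cons, Prod.mk.injEq]
        rcases h2 with h | h | h | h
        · exact Or.inl h
        · omega
        · omega
        · exact Or.inr (Or.inr (Or.inr h))
  · have e1 (σ : ℕ) (h : σ ≠ 2 * j) (h' : σ ≠ 2 * j + 1) :
        contents σ (P ++ (2 * j + 1, 0) :: (2 * j + 1, 1) :: S) = contents σ (P ++ S) := by
      ext c
      simp [h']
    have e2 (σ : ℕ) (h : σ ≠ 2 * j) (h' : σ ≠ 2 * j + 1) :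
        contents σ (P ++ (2 * j, 1) :: (2 * j + 1, 0) :: S) = contents σ (P ++ S) := by
      ext c
      simp [h', h]
    have e3 : contents (2 * j) (P ++ (2 * j + 1, 0) :: (2 * j + 1, 1) :: S) =
        contents (2 * j) (P ++ S) := by
      ext c
      simp
    have e4 : contents (2 * j + 1) (P ++ (2 * j + 1, 0) :: (2 * j + 1, 1) :: S) =
        insert 0 (insert 1 (contents (2 * j + 1) (P ++ S))) := by
      ext c
      simp
      tauto
    have e5 : contents (2 * j) (P ++ (2 * j, 1) :: (2 * j + 1, 0) :: S) =
        insert 1 (contents (2 * j) (P ++ S)) := by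
      ext c
      simp
      tauto
    have e6 : contents (2 * j + 1) (P ++ (2 * j, 1) :: (2 * j + 1, 0) :: S) =
        insert 0 (contents (2 * j + 1) (P ++ S)) := by
      ext c
      simp
      tauto
    unfold LatticeAt
    by_cases hi : i = j
    · subst hi
      rw [e3, e4, e5, e6, e1 _ (by omega) (by omega), e1 _ (by omega) (by omega),
        e2 _ (by omega) (by omega), e2 _ (by omega) (by omega)]
      refine lattice_corner₁ ?_ ?_ ?_ ?_ ?_ ?_ ?_ ?_ ?_ <;> simp only [mem_contents]
      · exact no 0 (by omega)
      · exact no 1 (by omega)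
      · exact hn0 _
      · exact hn1
      · exact hn0 (i + 1)
      · intro h
        have h' : ∃ σ, (σ = 2 * i + 2 ∨ σ = 2 * i + 3) ∧ (σ, 1) ∈ S := by
          rcases h with h | h
          · exact ⟨_, Or.inr rfl, inS (by omega) h⟩
          · exact ⟨_, Or.inl rfl, inS (by omega) h⟩
        obtain ⟨σ, hσ, h⟩ := h'
        obtain ⟨σ', h1, h2⟩ := fYS h
        have := hXS _ _ h1
        obtain rfl | rfl : σ' = 2 * i + 1 ∨ σ' = 2 * i + 2 := by omega
        · exact Or.inl (mS h1)
        · exact Or.inr (mS h1)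
      · intro d h h'
        obtain ⟨σ', h1, h2⟩ := fSS (inS (by omega) h') (inS (by omega) h) (by omega)
        omega
      · intro d hd h h'
        obtain ⟨σ', h1, h2⟩ := fSS (inS (by omega) h) (inS (by omega) h') (by omega)
        obtain rfl | rfl : σ' = 2 * i + 1 ∨ σ' = 2 * i + 2 := by omega
        · exact Or.inl (mS h1)
        · exact Or.inr (mS h1)
      · intro h
        obtain ⟨σ', h1, h2⟩ := fhS (inS (by omega) h)
        have := hXS _ _ h1
        obtain rfl : σ' = 2 * i + 2 := by omega
        exact mS h1
    by_cases hi' : i + 1 = j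
    · subst hi'
      rw [show 2 * i + 2 = 2 * (i + 1) by ring, show 2 * i + 3 = 2 * (i + 1) + 1 by ring,
        e3, e4, e5, e6, e1 _ (by omega) (by omega), e1 _ (by omega) (by omega),
        e2 _ (by omega) (by omega), e2 _ (by omega) (by omega)]
      refine lattice_corner₂ ?_ ?_ ?_ ?_ ?_ ?_ <;> simp only [mem_contents]
      · exact no 0 (by omega)
      · exact no 1 (by omega)
      · exact hn0 _
      · exact hn1
      · exact hn0 i
      · intro h
        obtain ⟨σ', h1, h2⟩ := fPX (inP (by omega) h)
        have := hPX _ _ h1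
        obtain rfl | rfl : σ' = 2 * i + 1 ∨ σ' = 2 * (i + 1) := by omega
        · exact mP h1
        · exact absurd (mP h1) hn1
    · rw [e1 _ (by omega) (by omega), e1 _ (by omega) (by omega), e1 _ (by omega) (by omega),
        e1 _ (by omega) (by omega), e2 _ (by omega) (by omega), e2 _ (by omega) (by omega),
        e2 _ (by omega) (by omega), e2 _ (by omega) (by omega)]

/-! ### Slides through one tagged block -/

/-- A list of boxes that is in standard order and normal. -/
def Standard (L : List (ℕ × ℕ)) : Prop := L.Pairwise Before ∧ Normal L

/-- Attach letters to the contents in the `i`-th block of a word. -/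
def tagBlock (i : ℕ) : List ℕ → List (ℕ × ℕ)
  | [] => []
  | [x] => [(2 * i + 1, x)]
  | x :: y :: r => (if y < x then 2 * i else 2 * i + 1, x) :: tagBlock i (y :: r)

/-- Attach letters to the contents in consecutive blocks, the first one being the `i`-th. -/
def tagAll : ℕ → List (List ℕ) → List (ℕ × ℕ)
  | _, [] => []
  | i, v :: T => tagBlock i v ++ tagAll (i + 1) T

theorem tagBlock_snd (i : ℕ) (v : List ℕ) : (tagBlock i v).map Prod.snd = v := by
  fun_induction tagBlock i v <;> simp_all

theorem tagAll_snd (i : ℕ) (T : List (List ℕ)) : (tagAll i T).map Prod.snd = T.flatten := by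
  induction T generalizing i with
  | nil => rfl
  | cons v T ih => simp [tagAll, tagBlock_snd, ih]

theorem fst_of_mem_tagBlock {i : ℕ} {v : List ℕ} {e : ℕ × ℕ} (h : e ∈ tagBlock i v) :
    e.1 = 2 * i ∨ e.1 = 2 * i + 1 := by
  fun_induction tagBlock i v with
  | case1 => simp at h
  | case2 x => simp_all
  | case3 x y r ih =>
    rcases List.mem_cons.mp h with rfl | h
    · dsimp only
      split_ifs <;> simp
    · exact ih h

theorem fst_of_mem_tagAll {i : ℕ} {T : List (List ℕ)} {e : ℕ × ℕ} (h : e ∈ tagAll i T) :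
    2 * i ≤ e.1 := by
  induction T generalizing i with
  | nil => simp [tagAll] at h
  | cons v T ih =>
    rcases List.mem_append.mp h with h | h
    · have := fst_of_mem_tagBlock h; omega
    · have := ih h; omega

theorem Valid.slide_mid {N : ℕ → ℕ} {k : List ℕ} {t : ℕ} {W S : List ℕ}
    (h : Valid N (W ++ (k ++ t :: S))) :
    Valid N (W ++ (ShiftedWord.slide k t).1 :: ((ShiftedWord.slide k t).2 ++ S)) := by
  rw [valid_append] at h ⊢
  exact ⟨h.1, h.2.slide⟩

/-- The sliding box passes the block from its end to its beginning, and each cell either changes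
nothing or is an instance of `slide_step`. The unmarked letters on `0` and `1` met by a box of
content `0` must be treated together by `slide_corner`; `hc` says that the block has not been cut
between these two letters. -/
theorem exists_tagged_slide {N : ℕ → ℕ} {i : ℕ} (n : ℕ) {P K S : List (ℕ × ℕ)} {t : ℕ}
    (hn : K.length ≤ n)
    (hv : Valid N (P.map Prod.snd ++ (K.map Prod.snd ++ t :: S.map Prod.snd)))
    (hK : ∀ e ∈ K, e.1 = 2 * i ∨ e.1 = 2 * i + 1)
    (hs : Standard (P ++ (K ++ S)))
    (hc : ∀ K₁, K = (2 * i + 1, 1) :: K₁ → (slide (K₁.map Prod.snd) t).1 = 0 →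
      (2 * i + 1, 0) ∉ P) :
    ∃ K', K'.map Prod.snd = (slide (K.map Prod.snd) t).2 ∧
      (∀ e ∈ K', e.1 = 2 * i ∨ e.1 = 2 * i + 1) ∧ Standard (P ++ (K' ++ S)) ∧
      ∀ j, LatticeAt j (P ++ (K ++ S)) ↔ LatticeAt j (P ++ (K' ++ S)) := by
  induction n generalizing P K with
  | zero =>
    obtain rfl : K = [] := List.length_eq_zero_iff.mp (by omega)
    exact ⟨[], rfl, by simp, hs, fun j => Iff.rfl⟩
  | succ n ih =>
    match K, hn, hv, hK, hs, hc with
    | [], _, _, _, hs, _ => exact ⟨[], rfl, by simp, hs, fun j => Iff.rfl⟩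
    | (τ, l) :: K₁, hn, hv, hK, hs, hc =>
      -- The corner case consumes two letters at once, so the induction hypothesis is applied to the
      -- word beyond both of them.
      by_cases hsp : ∃ K₂, (τ, l) = (2 * i + 1, 0) ∧ K₁ = (2 * i + 1, 1) :: K₂ ∧
          (slide (K₂.map Prod.snd) t).1 = 0
      · obtain ⟨K₂, h1, rfl, h0⟩ := hsp
        rw [h1] at *
        have hs1 := hs.1
        rw [List.pairwise_append] at hs1
        obtain ⟨K', e1, e2, e3, e4⟩ := ih (P := P ++ [(2 * i + 1, 0), (2 * i + 1, 1)]) (K := K₂)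
          (by simp at hn; omega) (by simpa using hv)
          (fun e he => hK e (by simp [he])) (by simpa using hs) (by
            rintro K₃ rfl
            have h2 := hs1.2.1
            simp [Before] at h2)
        have hv' := Valid.slide_mid (W := P.map Prod.snd ++ [0, 1]) (by simpa using hv)
        rw [h0, ← e1] at hv'
        have hk := slide_corner (N := N) (P := P) (S := K' ++ S) (j := i) (by simpa using hv')
          (by simpa using e3.1) (by simpa using e3.2)
        refine ⟨(2 * i, 1) :: (2 * i + 1, 0) :: K', ?_, ?_, ⟨by simpa using hk.1,
          by simpa using hk.2.1⟩, fun j => ?_⟩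
        · simp [slide, h0, e1, cell]
        · intro e he
          simp only [List.mem_cons] at he
          rcases he with rfl | rfl | he
          · simp
          · simp
          · exact e2 e he
        · have h3 := e4 j
          have h4 := hk.2.2 j
          simp only [List.append_assoc, List.cons_append, List.nil_append] at h3 h4 ⊢
          exact h3.trans h4
      · have hs1 := hs.1
        rw [List.pairwise_append] at hs1
        obtain ⟨K', e1, e2, e3, e4⟩ := ih (P := P ++ [(τ, l)]) (K := K₁)
          (by simp at hn; omega) (by simpa using hv)
          (fun e he => hK e (by simp [he])) (by simpa using hs) (by
            rintro K₂ rfl h0 hm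
            rcases List.mem_append.mp hm with hm | hm
            · have h2 := hs1.2.2 _ hm (τ, l) (by simp)
              have h3 := hs1.2.1
              simp only [List.cons_append, List.pairwise_cons, List.mem_cons] at h3
              have h4 := h3.1 _ (Or.inl rfl)
              simp only [Before] at h2 h4
              omega
            · refine hsp ⟨K₂, ?_, rfl, h0⟩
              exact (List.mem_singleton.mp hm).symm)
        have hv' := Valid.slide_mid (W := P.map Prod.snd ++ [l]) (by simpa using hv)
        rw [← e1] at hv'
        have e4' : ∀ j, LatticeAt j (P ++ ((τ, l) :: K₁ ++ S)) ↔
            LatticeAt j (P ++ (τ, l) :: (K' ++ S)) := fun j => by simpa using e4 j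
        have e3' : Standard (P ++ (τ, l) :: (K' ++ S)) := by simpa using e3
        -- If the contents are adjacent, the letter takes over the content of the sliding box;
        -- otherwise the two boxes are exchanged and the letter stays on its diagonal.
        by_cases hadj : l + 1 = (slide (K₁.map Prod.snd) t).1 ∨
            (slide (K₁.map Prod.snd) t).1 + 1 = l
        · have hk := slide_step (N := N) (P := P) (S := K' ++ S) (τ := τ) (by simpa using hv') hadj
            e3'.1 e3'.2 (by
              rintro ⟨h1, rfl, h3, h4⟩
              have h5 := hK (τ, 1) (by simp)
              obtain rfl : τ = 2 * i + 1 := by simp only at h5; omega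
              exact hc K₁ rfl h3 h4)
          refine ⟨(τ, (slide (K₁.map Prod.snd) t).1) :: K', ?_, ?_, ⟨hk.1, hk.2.1⟩, fun j => ?_⟩
          · simp [slide, cell, hadj, e1]
          · intro e he
            rcases List.mem_cons.mp he with rfl | he
            · exact hK (τ, l) (by simp)
            · exact e2 e he
          · exact (e4' j).trans (hk.2.2 j)
        · refine ⟨(τ, l) :: K', ?_, ?_, e3', e4'⟩
          · simp [slide, cell, hadj, e1]
          · intro e he
            rcases List.mem_cons.mp he with rfl | he
            · exact hK (τ, l) (by simp)
            · exact e2 e he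

theorem Normal.of_append_cons {i : ℕ} {P K S : List (ℕ × ℕ)} (h : Normal (P ++ (K ++ S)))
    (hP : ∀ e ∈ P, e.1 < 2 * i) (hS : ∀ e ∈ S, 2 * i + 1 < e.1)
    (hK : ∀ e ∈ K, e.1 = 2 * i ∨ e.1 = 2 * i + 1) : Normal K := by
  intro j c hm
  obtain rfl : j = i := by
    have := hK _ hm
    simp only at this
    omega
  obtain ⟨c', h1, h2⟩ := h j c (by simp [hm])
  refine ⟨c', h1, ?_⟩
  simp only [List.mem_append] at h2
  rcases h2 with h2 | h2 | h2
  · have := hP _ h2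
    simp only at this
    omega
  · exact h2
  · have := hS _ h2
    simp only at this
    omega

/-- A letter is marked exactly if the next content is smaller: a marked letter followed by an
unmarked one has a partner of smaller content, and the unmarked contents increase from the next one
on. The last letter of a block is unmarked because no partner could follow it. -/
theorem eq_tagBlock {i : ℕ} {K : List (ℕ × ℕ)} (hs : Standard K)
    (hK : ∀ e ∈ K, e.1 = 2 * i ∨ e.1 = 2 * i + 1) : K = tagBlock i (K.map Prod.snd) := by
  induction K with
  | nil => rfl
  | cons x K ih =>
    obtain ⟨τ, l⟩ := x
    have hs1 := List.pairwise_cons.mp hs.1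
    have hn : Normal K := by
      intro j c hm
      obtain ⟨c', h1, h2⟩ := hs.2 j c (by simp [hm])
      refine ⟨c', h1, (List.mem_cons.mp h2).resolve_left fun h => ?_⟩
      have h3 := hs1.1 _ hm
      rw [← h] at h3
      simp only [Before] at h3
      omega
    have h1 := ih ⟨hs1.2, hn⟩ fun e he => hK e (by simp [he])
    have h2 := hK (τ, l) (by simp)
    match K, h1, hs, hs1, hK, hn with
    | [], h1, hs, _, _, _ =>
      rcases h2 with rfl | rfl
      · obtain ⟨c', -, h4⟩ := hs.2 i l (by simp)
        simp at h4
      · rfl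
    | (σ, m) :: K, h1, hs, hs1, hK, hn =>
      simp only [List.map_cons, tagBlock]
      simp only [List.map_cons] at h1
      rw [← h1]
      congr 2
      have h3 := hs1.1 (σ, m) (by simp)
      have h4 := hK (σ, m) (by simp)
      rcases h2 with h2 | h2
      · simp only at h2
        subst h2
        rw [if_pos]
        rcases h4 with h4 | h4
        · simp only [Before] at h3 h4
          omega
        · obtain ⟨c', h5, h6⟩ := hs.2 i l (by simp)
          simp only at h4
          subst h4
          simp only [List.mem_cons, Prod.mk.injEq] at h6
          rcases h6 with h6 | h6 | h6
          · omega
          · omega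
          · have h7 := (List.pairwise_cons.mp hs1.2).1 _ h6
            simp only [Before] at h7
            omega
      · simp only at h2
        subst h2
        rw [if_neg]
        simp only [Before] at h3 h4
        omega

/-! ### Slides through all blocks -/

/-- Slide a box, added after the boxes of a word given in blocks, to the front of the word. -/
def slideBlocks : List (List ℕ) → ℕ → ℕ × List (List ℕ)
  | [], t => (t, [])
  | v :: T, t =>
    ((slide v (slideBlocks T t).1).1, (slide v (slideBlocks T t).1).2 :: (slideBlocks T t).2)

/-- Slide a box, added before the boxes of a word given in blocks, to the end of the word. -/
def slideBlocksR : ℕ → List (List ℕ) → List (List ℕ) × ℕ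
  | t, [] => ([], t)
  | t, v :: T =>
    ((slideR t v).1 :: (slideBlocksR (slideR t v).2 T).1, (slideBlocksR (slideR t v).2 T).2)

theorem slideBlocksR_slideBlocks (T : List (List ℕ)) (t : ℕ) :
    slideBlocksR (slideBlocks T t).1 (slideBlocks T t).2 = (T, t) := by
  induction T with
  | nil => rfl
  | cons v T ih => simp [slideBlocks, slideBlocksR, slideR_slide, ih]

theorem slideBlocks_slideBlocksR (t : ℕ) (T : List (List ℕ)) :
    slideBlocks (slideBlocksR t T).1 (slideBlocksR t T).2 = (t, T) := by
  induction T generalizing t with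
  | nil => rfl
  | cons v T ih => simp [slideBlocks, slideBlocksR, slide_slideR, ih]

theorem slide_flatten (T : List (List ℕ)) (t : ℕ) :
    slide T.flatten t = ((slideBlocks T t).1, (slideBlocks T t).2.flatten) := by
  induction T with
  | nil => rfl
  | cons v T ih => simp [slideBlocks, slide_append, ih]

theorem map_length_slideBlocks (T : List (List ℕ)) (t : ℕ) :
    (slideBlocks T t).2.map List.length = T.map List.length := by
  induction T with
  | nil => rfl
  | cons v T ih => simp [slideBlocks, ih]

theorem Valid.slideBlocks {N : ℕ → ℕ} {T : List (List ℕ)} {t : ℕ} {S : List ℕ}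
    (h : Valid N (T.flatten ++ t :: S)) :
    Valid N ((slideBlocks T t).1 :: ((slideBlocks T t).2.flatten ++ S)) := by
  have := Valid.slide h
  rwa [slide_flatten] at this

theorem noPeak_slideBlocks_iff {N : ℕ → ℕ} {T : List (List ℕ)} {t : ℕ}
    (h : Valid N (T.flatten ++ [t])) :
    (∀ v ∈ (slideBlocks T t).2, NoPeak v) ↔ ∀ v ∈ T, NoPeak v := by
  induction T generalizing N with
  | nil => rfl
  | cons v T ih =>
    simp only [slideBlocks, List.forall_mem_cons]
    rw [List.flatten_cons, List.append_assoc, valid_append] at h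
    have h1 := ih h.2
    have h2 := Valid.slideBlocks h.2
    rw [h1, noPeak_slide_iff (N := N) ((valid_append _ _ _).mpr ⟨h.1, h2.1, trivial⟩)]

/-- The later blocks are crossed first, with the current block moved into the prefix `P`; then the
current block is crossed, with the changed later blocks as suffix. -/
theorem latticeAt_slideBlocks_iff {N : ℕ → ℕ} {i : ℕ} {P : List (ℕ × ℕ)} {T : List (List ℕ)} {t : ℕ}
    (hP : ∀ e ∈ P, e.1 < 2 * i)
    (h : Valid N (P.map Prod.snd ++ (T.flatten ++ [t]))) (hs : Standard (P ++ tagAll i T)) :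
    Standard (P ++ tagAll i (slideBlocks T t).2) ∧
      ∀ j, LatticeAt j (P ++ tagAll i T) ↔ LatticeAt j (P ++ tagAll i (slideBlocks T t).2) := by
  induction T generalizing i P with
  | nil => exact ⟨hs, fun j => Iff.rfl⟩
  | cons v T ih =>
    simp only [tagAll, slideBlocks] at hs ⊢
    rw [List.flatten_cons] at h
    have hP' : ∀ e ∈ P ++ tagBlock i v, e.1 < 2 * (i + 1) := by
      intro e he
      rcases List.mem_append.mp he with he | he
      · have := hP e he; omega
      · have := fst_of_mem_tagBlock he; omega
    obtain ⟨h1, h2⟩ := ih hP' (by simpa [tagBlock_snd] using h) (by simpa using hs)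
    have h3 : Valid N (P.map Prod.snd ++ ((tagBlock i v).map Prod.snd ++ (slideBlocks T t).1 ::
        (tagAll (i + 1) (slideBlocks T t).2).map Prod.snd)) := by
      rw [tagBlock_snd, tagAll_snd, ← List.append_assoc, valid_append]
      rw [List.append_assoc v, ← List.append_assoc, valid_append] at h
      have := Valid.slideBlocks h.2
      simp only [List.append_nil] at this
      exact ⟨h.1, this⟩
    rw [List.append_assoc] at h1
    obtain ⟨K', e1, e2, e3, e4⟩ := exists_tagged_slide (i := i) _ le_rfl h3
      (fun e he => fst_of_mem_tagBlock he) h1 (fun _ _ _ hm => by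
        have := hP _ hm
        simp only at this
        omega)
    -- The letters carried along by the slide agree with those read off from the new contents, since
    -- a standard block has only one tagging.
    have e5 : K' = tagBlock i (slide v (slideBlocks T t).1).2 := by
      have h5 : K'.Pairwise Before := by
        have := e3.1
        rw [List.pairwise_append, List.pairwise_append] at this
        exact this.2.1.1
      rw [tagBlock_snd] at e1
      rw [← e1]
      refine eq_tagBlock ⟨h5, Normal.of_append_cons e3.2 hP (fun e he => ?_) e2⟩ e2
      have := fst_of_mem_tagAll he
      omega
    rw [e5] at e3 e4
    refine ⟨e3, fun j => ?_⟩
    have h6 := h2 j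
    rw [List.append_assoc, List.append_assoc] at h6
    exact h6.trans (e4 j)

/-! ### Words without peaks are standard -/

theorem Valid.isChain_ne {N : ℕ → ℕ} {v : List ℕ} (h : Valid N v) : v.IsChain (· ≠ ·) := by
  induction v generalizing N with
  | nil => simp
  | cons x v ih =>
    match v, @ih, h with
    | [], _, _ => simp
    | y :: r, ih, h =>
      refine List.isChain_cons_cons.mpr ⟨?_, ih h.2⟩
      rintro rfl
      simpa using (Valid.between (A := []) (B := []) (C := r) h).1

theorem NoPeak.tail {x : ℕ} {v : List ℕ} (h : NoPeak (x :: v)) : NoPeak v := by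
  match v, h with
  | [], _ => trivial
  | [_], _ => trivial
  | _ :: _ :: _, h => exact h.2

/-- A descent after an ascent would be a peak, and neighbouring letters differ. -/
theorem NoPeak.ascending {x y : ℕ} {r : List ℕ} (h : NoPeak (x :: y :: r))
    (hc : (x :: y :: r).IsChain (· ≠ ·)) (hxy : x < y) : (x :: y :: r).Pairwise (· < ·) := by
  induction r generalizing x y with
  | nil => simpa using hxy
  | cons z r ih =>
    rw [List.isChain_cons_cons] at hc
    have h1 : y ≠ z := (List.isChain_cons_cons.mp hc.2).1
    have h2 := ih h.tail hc.2 (by have := h.1; omega)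
    rw [List.pairwise_cons]
    refine ⟨fun a ha => ?_, h2⟩
    rcases List.mem_cons.mp ha with rfl | ha
    · exact hxy
    · exact hxy.trans ((List.pairwise_cons.mp h2).1 a ha)

theorem tagBlock_of_ascending (i : ℕ) {v : List ℕ} (h : v.Pairwise (· < ·)) :
    tagBlock i v = v.map fun x => (2 * i + 1, x) := by
  fun_induction tagBlock i v with
  | case1 => rfl
  | case2 => rfl
  | case3 x y r ih =>
    rw [List.pairwise_cons] at h
    have := h.1 y (by simp)
    rw [ih h.2, if_neg (by omega)]
    rfl

theorem standard_of_ascending (i : ℕ) {v : List ℕ} (h : v.Pairwise (· < ·)) :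
    Standard (tagBlock i v) := by
  rw [tagBlock_of_ascending i h]
  constructor
  · rw [List.pairwise_map]
    exact h.imp fun {a b} hab => Or.inr ⟨rfl, Or.inr ⟨by simp only; omega, hab⟩⟩
  · intro j c hm
    simp only [List.mem_map, Prod.mk.injEq] at hm
    obtain ⟨_, _, h, -⟩ := hm
    omega

/-- The last two claims feed the induction: when a larger letter is put in front and becomes marked,
they give the order of the marked letters and its unmarked partner. -/
theorem standard_tagBlock_aux {i x : ℕ} {v : List ℕ} (h : NoPeak (x :: v))
    (hc : (x :: v).IsChain (· ≠ ·)) :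
    Standard (tagBlock i (x :: v)) ∧ (∀ c, (2 * i, c) ∈ tagBlock i (x :: v) → c ≤ x) ∧
      ∃ c ≤ x, (2 * i + 1, c) ∈ tagBlock i (x :: v) := by
  induction v generalizing x with
  | nil => exact ⟨standard_of_ascending i (by simp), by simp [tagBlock], x, le_rfl, by simp [tagBlock]⟩
  | cons y r ih =>
    have hc' := List.isChain_cons_cons.mp hc
    rcases lt_or_gt_of_ne hc'.1 with hlt | hgt
    · have ha := h.ascending hc hlt
      refine ⟨standard_of_ascending i ha, ?_, x, le_rfl, ?_⟩ <;> rw [tagBlock_of_ascending i ha]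
      · intro c hm
        simp only [List.mem_map, Prod.mk.injEq] at hm
        obtain ⟨_, _, h, -⟩ := hm
        omega
      · simp
    · obtain ⟨h1, h2, c, h3, h4⟩ := ih h.tail hc'.2
      simp only [tagBlock, if_pos hgt]
      refine ⟨⟨?_, ?_⟩, ?_, c, by omega, by simp [h4]⟩
      · rw [List.pairwise_cons]
        refine ⟨?_, h1.1⟩
        rintro ⟨σ, d⟩ hm
        rcases fst_of_mem_tagBlock hm with h5 | h5
        · simp only at h5
          subst h5
          have := h2 d hm
          exact Or.inr ⟨rfl, Or.inl ⟨by simp, by simp only; omega⟩⟩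
        · exact Or.inl (by simp only at h5 ⊢; omega)
      · intro j d hm
        rcases List.mem_cons.mp hm with h5 | h5
        · simp only [Prod.mk.injEq] at h5
          obtain rfl : j = i := by omega
          exact ⟨c, by omega, by simp [h4]⟩
        · obtain ⟨c', h6, h7⟩ := h1.2 j d h5
          exact ⟨c', h6, by simp [h7]⟩
      · intro d hm
        rcases List.mem_cons.mp hm with h5 | h5
        · simp only [Prod.mk.injEq] at h5
          omega
        · have := h2 d h5
          omega

theorem standard_tagBlock {N : ℕ → ℕ} {v : List ℕ} (i : ℕ) (h : NoPeak v) (hv : Valid N v) :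
    Standard (tagBlock i v) := by
  cases v with
  | nil => exact ⟨by simp [tagBlock], by simp [tagBlock, Normal]⟩
  | cons x v => exact (standard_tagBlock_aux h hv.isChain_ne).1

theorem standard_tagAll {N : ℕ → ℕ} {T : List (List ℕ)} (i : ℕ) (h : ∀ v ∈ T, NoPeak v)
    (hv : Valid N T.flatten) : Standard (tagAll i T) := by
  induction T generalizing i N with
  | nil => exact ⟨by simp [tagAll], by simp [tagAll, Normal]⟩
  | cons v T ih =>
    rw [List.flatten_cons, valid_append] at hv
    have h1 := standard_tagBlock i (h v (by simp)) hv.1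
    have h2 := ih (i + 1) (fun v hv => h v (by simp [hv])) hv.2
    constructor
    · simp only [tagAll]
      rw [List.pairwise_append]
      refine ⟨h1.1, h2.1, fun a ha b hb => Or.inl ?_⟩
      have := fst_of_mem_tagBlock ha
      have := fst_of_mem_tagAll hb
      omega
    · intro j c hm
      simp only [tagAll, List.mem_append] at hm ⊢
      rcases hm with hm | hm
      · obtain ⟨c', h3, h4⟩ := h1.2 j c hm
        exact ⟨c', h3, Or.inl h4⟩
      · obtain ⟨c', h3, h4⟩ := h2.2 j c hm
        exact ⟨c', h3, Or.inr h4⟩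

/-! ### The switching bijection -/

/-- The words, given in blocks of prescribed lengths, that correspond to the
Littlewood-Richardson-Stembridge tableaux on shapes with inner shape `N`. -/
structure IsTableau (N : ℕ → ℕ) (κ : List ℕ) (T : List (List ℕ)) : Prop where
  map_length : T.map List.length = κ
  noPeak : ∀ v ∈ T, NoPeak v
  valid : Valid N T.flatten
  lattice : ∀ i, LatticeAt i (tagAll 0 T)

/-- Equivalence is needed rather than one implication, since the inverse of switching has to
preserve the conditions too. The tagged words are standard as soon as the blocks have no peaks, and
this property is itself invariant. -/
theorem isTableau_slideBlocks_iff {N : ℕ → ℕ} {κ : List ℕ} {T : List (List ℕ)} {t : ℕ}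
    (h : Valid N (T.flatten ++ [t])) :
    IsTableau (grow N (slideBlocks T t).1) κ (slideBlocks T t).2 ↔ IsTableau N κ T := by
  have hv := (valid_append _ _ _).mp h
  have hv' := Valid.slideBlocks h
  rw [List.append_nil] at hv'
  have hl (hp : ∀ v ∈ T, NoPeak v) := (latticeAt_slideBlocks_iff (i := 0) (P := []) (by simp)
    (by simpa using h) (standard_tagAll 0 hp hv.1)).2
  constructor
  · rintro ⟨h1, h2, h3, h4⟩
    have hp := (noPeak_slideBlocks_iff h).mp h2
    exact ⟨map_length_slideBlocks T t ▸ h1, hp, hv.1, fun i => (hl hp i).mpr (h4 i)⟩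
  · rintro ⟨h1, hp, h3, h4⟩
    exact ⟨(map_length_slideBlocks T t).trans h1, (noPeak_slideBlocks_iff h).mpr hp, hv'.2,
      fun i => (hl hp i).mp (h4 i)⟩

/-- Switch a word given in blocks with a word of boxes that are added after it. -/
def switchBlocks : List (List ℕ) → List ℕ → List ℕ × List (List ℕ)
  | T, [] => ([], T)
  | T, u :: U =>
    ((slideBlocks T u).1 :: (switchBlocks (slideBlocks T u).2 U).1,
      (switchBlocks (slideBlocks T u).2 U).2)

/-- The inverse of `switchBlocks`. -/
def unswitchBlocks : List ℕ → List (List ℕ) → List (List ℕ) × List ℕ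
  | [], T => (T, [])
  | v :: V, T =>
    ((slideBlocksR v (unswitchBlocks V T).1).1,
      (slideBlocksR v (unswitchBlocks V T).1).2 :: (unswitchBlocks V T).2)

theorem unswitchBlocks_switchBlocks (T : List (List ℕ)) (U : List ℕ) :
    unswitchBlocks (switchBlocks T U).1 (switchBlocks T U).2 = (T, U) := by
  induction U generalizing T with
  | nil => rfl
  | cons u U ih => simp [switchBlocks, unswitchBlocks, ih, slideBlocksR_slideBlocks]

theorem switchBlocks_unswitchBlocks (V : List ℕ) (T : List (List ℕ)) :
    switchBlocks (unswitchBlocks V T).1 (unswitchBlocks V T).2 = (V, T) := by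
  induction V with
  | nil => rfl
  | cons v V ih => simp [switchBlocks, unswitchBlocks, ih, slideBlocks_slideBlocksR]

theorem switch_flatten (T : List (List ℕ)) (U : List ℕ) :
    switch T.flatten U = ((switchBlocks T U).1, (switchBlocks T U).2.flatten) := by
  induction U generalizing T with
  | nil => simp [switch_nil_right, switchBlocks]
  | cons u U ih => simp [switch_cons, switchBlocks, slide_flatten, ih]

theorem isTableau_switchBlocks_iff {N : ℕ → ℕ} {κ : List ℕ} {T : List (List ℕ)} {U : List ℕ}
    (h : Valid N (T.flatten ++ U)) :
    IsTableau (run N (switchBlocks T U).1) κ (switchBlocks T U).2 ↔ IsTableau N κ T := by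
  induction U generalizing N T with
  | nil => simp [switchBlocks]
  | cons u U ih =>
    have h1 : Valid N (T.flatten ++ [u]) := by
      rw [show T.flatten ++ u :: U = (T.flatten ++ [u]) ++ U by simp, valid_append] at h
      exact h.1
    have h2 := Valid.slideBlocks h
    simp only [switchBlocks, run_cons]
    rw [ih h2.2, isTableau_slideBlocks_iff h1]

theorem Valid.slideBlocksR {N : ℕ → ℕ} {T : List (List ℕ)} {t : ℕ} {S : List ℕ}
    (h : Valid N (t :: (T.flatten ++ S))) :
    Valid N ((slideBlocksR t T).1.flatten ++ (slideBlocksR t T).2 :: S) := by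
  induction T generalizing N t with
  | nil => exact h
  | cons v T ih =>
    simp only [List.flatten_cons, List.append_assoc] at h
    have h1 := Valid.slideR h
    simp only [ShiftedWord.slideBlocksR, List.flatten_cons, List.append_assoc]
    rw [valid_append] at h1 ⊢
    exact ⟨h1.1, ih h1.2⟩

theorem Valid.unswitchBlocks {N : ℕ → ℕ} {V : List ℕ} {T : List (List ℕ)}
    (h : Valid N (V ++ T.flatten)) :
    Valid N ((unswitchBlocks V T).1.flatten ++ (unswitchBlocks V T).2) := by
  induction V generalizing N with
  | nil => simpa [ShiftedWord.unswitchBlocks] using h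
  | cons v V ih => exact Valid.slideBlocksR ⟨h.1, ih h.2⟩

theorem switch_perm (k U : List ℕ) : (k ++ U).Perm ((switch k U).1 ++ (switch k U).2) := by
  induction k with
  | nil => simp [switch]
  | cons l k ih =>
    refine (ih.cons l).trans ?_
    have := slideR_perm l (switch k U).1
    simp only [switch]
    refine (this.append_right (switch k U).2).trans ?_
    simp

theorem length_switchBlocks_fst (T : List (List ℕ)) (U : List ℕ) :
    (switchBlocks T U).1.length = U.length := by
  induction U generalizing T with
  | nil => rfl
  | cons u U ih => simp [switchBlocks, ih]

/-- A horizontal strip with `p` boxes that can be added to the shape `N`, with a choice of marks. -/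
structure IsStrip (N : ℕ → ℕ) (p : ℕ) (U : List ℕ) : Prop where
  length : U.length = p
  noPeak : NoPeak U
  valid : Valid N U

/-- Switching tableaux with horizontal strips is bijective. -/
theorem switchBlocks_bijOn (N M : ℕ → ℕ) (κ : List ℕ) (p : ℕ) :
    Set.BijOn (fun x : List (List ℕ) × List ℕ => switchBlocks x.1 x.2)
      {x | IsTableau N κ x.1 ∧ IsStrip (run N x.1.flatten) p x.2 ∧
        run N (x.1.flatten ++ x.2) = M}
      {y | IsStrip N p y.1 ∧ IsTableau (run N y.1) κ y.2 ∧ run N (y.1 ++ y.2.flatten) = M} := by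
  have hrun (T : List (List ℕ)) (U : List ℕ) : run N (T.flatten ++ U) =
      run N ((switchBlocks T U).1 ++ (switchBlocks T U).2.flatten) := by
    have := switch_perm T.flatten U
    rw [switch_flatten] at this
    exact run_perm N this
  have hval {T : List (List ℕ)} {U : List ℕ} (h : Valid N (T.flatten ++ U)) :
      Valid N ((switchBlocks T U).1 ++ (switchBlocks T U).2.flatten) := by
    have := Valid.switch h
    rwa [switch_flatten] at this
  have hpk {T : List (List ℕ)} {U : List ℕ} (h : Valid N (T.flatten ++ U)) :
      NoPeak (switchBlocks T U).1 ↔ NoPeak U := by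
    have := switch_noPeak_iff h
    rwa [switch_flatten] at this
  -- The two maps are inverse to each other on all words. Only the conditions have to be
  -- transported, and each of them is an equivalence along `switchBlocks`.
  refine Set.InvOn.bijOn (f' := fun y => unswitchBlocks y.1 y.2)
    ⟨fun x _ => unswitchBlocks_switchBlocks x.1 x.2,
      fun y _ => switchBlocks_unswitchBlocks y.1 y.2⟩ ?_ ?_
  · rintro ⟨T, U⟩ ⟨hT, ⟨hU1, hU2, hU3⟩, hM⟩
    have h : Valid N (T.flatten ++ U) := (valid_append _ _ _).mpr ⟨hT.valid, hU3⟩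
    exact ⟨⟨(length_switchBlocks_fst T U).trans hU1, (hpk h).mpr hU2,
      ((valid_append _ _ _).mp (hval h)).1⟩, (isTableau_switchBlocks_iff h).mpr hT,
      (hrun T U).symm.trans hM⟩
  · rintro ⟨V, T'⟩ ⟨⟨h1, h2, h3⟩, hT, hM⟩
    have hv : Valid N (V ++ T'.flatten) := (valid_append _ _ _).mpr ⟨h3, hT.valid⟩
    have h := Valid.unswitchBlocks hv
    have e := switchBlocks_unswitchBlocks V T'
    have i1 := hpk h
    have i2 := isTableau_switchBlocks_iff (κ := κ) h
    have i3 := hrun (unswitchBlocks V T').1 (unswitchBlocks V T').2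
    have i4 := length_switchBlocks_fst (unswitchBlocks V T').1 (unswitchBlocks V T').2
    rw [e] at i1 i2 i3 i4
    exact ⟨i2.mp hT, ⟨i4.symm.trans h1, i1.mp h2, ((valid_append _ _ _).mp h).2⟩, i3.trans hM⟩

end ShiftedWord

namespace StrictPartition

open ShiftedWord

/-! ### Strict partitions through their diagonal lengths -/

/-- The number of parts of `lam` that are greater than `c`, which is the number of boxes of content
`c` in the shifted diagram of `lam`. -/
def diag (lam : StrictPartition) (c : ℕ) : ℕ := (lam.parts.filter (c < ·)).card

theorem lt_getD_iff_of_pairwise (l : List ℕ) (hl : l.Pairwise (· ≥ ·)) (c i : ℕ) :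
    c < l.getD i 0 ↔ i < l.countP (c < ·) := by
  induction l generalizing i with
  | nil => simp
  | cons x l ih =>
    rw [List.pairwise_cons] at hl
    have h0 : ¬ c < x → l.countP (c < ·) = 0 := fun hx => by
      rw [List.countP_eq_zero]
      intro a ha
      have := hl.1 a ha
      simp only [decide_eq_true_eq]
      omega
    rw [List.countP_cons]
    cases i with
    | zero =>
      by_cases hx : c < x
      · simp [hx]
      · simp [hx, h0 hx]
    | succ i =>
      have := ih hl.2 i
      by_cases hx : c < x
      · simp [hx] at this ⊢
        exact this
      · have h1 := h0 hx
        simp only [List.getD_cons_succ, this, h1, decide_eq_true_eq, hx, if_false]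
        omega

/-- Conjugation of partitions: `lam.diag c` is also the length of column `c` of the unshifted
diagram. This is what links horizontal strips to the diagonals of shifted diagrams. -/
theorem lt_part_iff (lam : StrictPartition) (c i : ℕ) : c < lam.part i ↔ i < lam.diag c := by
  unfold part diag
  rw [lt_getD_iff_of_pairwise _ (Finset.pairwise_sort _ _)]
  have : (lam.parts.sort (fun a b => a ≥ b)).countP (c < ·) =
      (lam.parts.filter (c < ·)).card := by
    rw [← Multiset.coe_countP, Finset.sort_eq, Multiset.countP_eq_card_filter]
    rfl
  rw [this]

theorem le_iff_diag {lam mu : StrictPartition} : lam ≤ mu ↔ ∀ c, lam.diag c ≤ mu.diag c := by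
  constructor
  · intro h c
    by_contra hlt
    have h1 := (lt_part_iff lam c (mu.diag c)).mpr (by omega)
    have h2 := (lt_part_iff mu c (mu.diag c)).mp (h1.trans_le (h _))
    omega
  · intro h i
    by_contra hlt
    have h1 := (lt_part_iff lam (mu.part i) i).mp (by omega)
    have h2 := (lt_part_iff mu (mu.part i) i).mpr (h1.trans_le (h _))
    omega

theorem diag_succ (lam : StrictPartition) (c : ℕ) :
    lam.diag c = lam.diag (c + 1) + if c + 1 ∈ lam.parts then 1 else 0 := by
  unfold diag
  split_ifs with h
  · rw [← Finset.card_insert_of_notMem (a := c + 1) (by simp)]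
    congr 1
    ext a
    simp only [Finset.mem_filter, Finset.mem_insert]
    grind
  · congr 1
    ext a
    simp only [Finset.mem_filter]
    grind

/-- The sequences of diagonal lengths of shifted diagrams. -/
def IsProfile (N : ℕ → ℕ) : Prop := ∀ c, N c = N (c + 1) ∨ N c = N (c + 1) + 1

theorem isProfile_diag (lam : StrictPartition) : IsProfile lam.diag := by
  intro c
  have := lam.diag_succ c
  split_ifs at this <;> omega

theorem diag_injective : Function.Injective diag := by
  intro lam mu h
  ext k
  cases k with
  | zero => exact ⟨fun h => absurd (lam.pos 0 h) (by simp), fun h => absurd (mu.pos 0 h) (by simp)⟩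
  | succ k =>
    have h1 := lam.diag_succ k
    have h2 := mu.diag_succ k
    rw [h] at h1
    split_ifs at h1 h2 with h3 h4 h4
    · simp [h3, h4]
    · omega
    · omega
    · simp [h3, h4]

theorem exists_diag_eq {N : ℕ → ℕ} (h : IsProfile N) {n : ℕ} (hn : ∀ c, n ≤ c → N c = 0) :
    ∃ lam : StrictPartition, lam.diag = N := by
  let lam : StrictPartition :=
    { parts := ((Finset.range n).filter fun c => N c ≠ N (c + 1)).image (· + 1)
      pos := by
        simp only [Finset.mem_image]
        rintro k ⟨c, -, rfl⟩
        omega }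
  have hmem (c : ℕ) : c + 1 ∈ lam.parts ↔ c < n ∧ N c ≠ N (c + 1) := by
    simp [lam]
  refine ⟨lam, ?_⟩
  -- Descending induction from `n` on, where both sequences vanish; `j` bounds the distance to `n`.
  have key (j : ℕ) : ∀ c, n ≤ c + j → lam.diag c = N c := by
    induction j with
    | zero =>
      intro c hc
      rw [hn c hc]
      unfold diag
      rw [Finset.card_eq_zero, Finset.filter_eq_empty_iff]
      intro a ha
      cases a with
      | zero => omega
      | succ a => have := (hmem a).mp ha; omega
    | succ j ih =>
      intro c hc
      have h1 := ih (c + 1) (by omega)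
      have h2 := lam.diag_succ c
      have h3 := h c
      by_cases hcn : n ≤ c
      · have := ih c (by omega)
        exact this
      · rw [h2, h1]
        by_cases h4 : N c = N (c + 1)
        · rw [if_neg (by rw [hmem]; tauto)]
          omega
        · rw [if_pos (by rw [hmem]; exact ⟨by omega, h4⟩)]
          omega
  funext c
  exact key n c (by omega)

theorem mem_shifted {lam : StrictPartition} {r j : ℕ} :
    (r, j) ∈ lam.shifted ↔ r ≤ j ∧ r < lam.diag (j - r) := by
  simp only [shifted, Finset.mem_biUnion, Finset.mem_range, Finset.mem_image, Prod.mk.injEq]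
  constructor
  · rintro ⟨i, -, k, hk, rfl, rfl⟩
    rw [lt_part_iff] at hk
    exact ⟨by omega, by simpa using hk⟩
  · rintro ⟨h1, h2⟩
    refine ⟨r, h2.trans_le (Finset.card_filter_le _ _), j - r, (lt_part_iff _ _ _).mpr h2, rfl,
      by omega⟩

theorem mem_young {lam : StrictPartition} {i j : ℕ} :
    (i, j) ∈ lam.young ↔ i < lam.diag j := by
  simp only [young, Finset.mem_biUnion, Finset.mem_range, Finset.mem_image, Prod.mk.injEq]
  constructor
  · rintro ⟨i, -, k, hk, rfl, rfl⟩
    rwa [lt_part_iff] at hk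
  · intro h
    exact ⟨i, h.trans_le (Finset.card_filter_le _ _), j, (lt_part_iff _ _ _).mpr h, rfl, rfl⟩

theorem diag_rho (n c : ℕ) : (rho n).diag c = n - c := by
  unfold diag rho
  rw [show (Finset.Icc 1 n).filter (c < ·) = Finset.Ioc c n by ext a; simp; omega]
  simp

theorem diag_eq_zero_of_le_rho {n : ℕ} {lam : StrictPartition} (h : lam ≤ rho n) {c : ℕ}
    (hc : n ≤ c) : lam.diag c = 0 := by
  have := le_iff_diag.mp h c
  rw [diag_rho] at this
  omega

/-- The parts of a partition and of its dual together are `1, …, n`, of which `n - c` are greater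
than `c`. -/
theorem diag_dual {n : ℕ} {lam : StrictPartition} (h : lam ≤ rho n) (c : ℕ) :
    (dual n lam).diag c + lam.diag c = n - c := by
  have h1 := parts_subset_of_le_rho h
  rw [← diag_rho]
  unfold diag dual rho
  rw [← Finset.card_union_of_disjoint]
  · congr 1
    ext a
    have := @h1 a
    simp only [Finset.mem_union, Finset.mem_filter, Finset.mem_sdiff]
    tauto
  · rw [Finset.disjoint_left]
    intro a
    simp only [Finset.mem_filter, Finset.mem_sdiff]
    tauto

theorem dual_le_rho (n : ℕ) (lam : StrictPartition) : dual n lam ≤ rho n := by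
  rw [le_iff_diag]
  intro c
  exact Finset.card_le_card (Finset.filter_subset_filter _ Finset.sdiff_subset)

theorem dual_dual {n : ℕ} {lam : StrictPartition} (h : lam ≤ rho n) : dual n (dual n lam) = lam := by
  ext k
  have h1 := parts_subset_of_le_rho h
  have := @h1 k
  simp only [dual, Finset.mem_sdiff]
  tauto

/-! ### Horizontal strips and their components -/

/-- The diagonals in which two shapes differ. -/
def stripSet (n : ℕ) (N M : ℕ → ℕ) : Finset ℕ := (Finset.range n).filter fun c => N c < M c

/-- `M` is obtained from `N` by adding at most one box to each diagonal, and none from the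
diagonal `n` on. -/
structure StripPair (n : ℕ) (N M : ℕ → ℕ) : Prop where
  isProfile : IsProfile N
  isProfile' : IsProfile M
  le : ∀ c, N c ≤ M c
  le_succ : ∀ c, M c ≤ N c + 1
  eq_zero : ∀ c, n ≤ c → M c = 0

theorem StripPair.mem {n : ℕ} {N M : ℕ → ℕ} (h : StripPair n N M) {c : ℕ} :
    c ∈ stripSet n N M ↔ M c = N c + 1 := by
  have h1 := h.le c
  have h2 := h.le_succ c
  have h3 := h.eq_zero c
  simp only [stripSet, Finset.mem_filter, Finset.mem_range]
  constructor
  · omega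
  · intro h4
    by_contra h5
    have := h3 (by omega)
    omega

theorem StripPair.notMem {n : ℕ} {N M : ℕ → ℕ} (h : StripPair n N M) {c : ℕ} :
    c ∉ stripSet n N M ↔ M c = N c := by
  rw [h.mem]
  have h1 := h.le c
  have h2 := h.le_succ c
  omega

/-- Columns of the Young diagram have the same lengths as diagonals of the shifted diagram, so "no
two boxes in the same column" says that each diagonal grows by at most one. -/
theorem mem_pieri {n : ℕ} {p : ℤ} {lam lamt : StrictPartition} :
    lamt ∈ pieri n p lam ↔ StripPair n lam.diag lamt.diag ∧
      ((stripSet n lam.diag lamt.diag).card : ℤ) = p := by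
  have hmem : lamt ∈ pieri n p lam ↔ lamt ≤ rho n ∧ AddsHorizontalStrip p lam lamt := by
    simp [pieri]
  rw [hmem]
  have hdiff {i j : ℕ} : (i, j) ∈ lamt.young \ lam.young ↔ lam.diag j ≤ i ∧ i < lamt.diag j := by
    rw [Finset.mem_sdiff, mem_young, mem_young]
    omega
  have hcard (h : StripPair n lam.diag lamt.diag) :
      (lamt.young \ lam.young).card = (stripSet n lam.diag lamt.diag).card := by
    symm
    refine Finset.card_bij (fun c _ => (lam.diag c, c)) ?_ ?_ ?_
    · intro c hc
      rw [h.mem] at hc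
      rw [hdiff]
      omega
    · intro a _ b _ hab
      exact (Prod.mk.inj hab).2
    · rintro ⟨i, j⟩ hb
      rw [hdiff] at hb
      have := h.le_succ j
      exact ⟨j, by rw [h.mem]; omega, by simp only [Prod.mk.injEq, and_true]; omega⟩
  constructor
  · rintro ⟨h1, h2, h3, h4⟩
    have h : StripPair n lam.diag lamt.diag := by
      refine ⟨isProfile_diag _, isProfile_diag _, le_iff_diag.mp h2, fun c => ?_,
        fun c hc => diag_eq_zero_of_le_rho h1 hc⟩
      by_contra hlt
      have := h4 (lam.diag c, c) (hdiff.mpr (by omega)) (lam.diag c + 1, c) (hdiff.mpr (by omega)) rfl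
      simp at this
    exact ⟨h, by rw [← h3, hcard h]⟩
  · rintro ⟨h, h1⟩
    refine ⟨?_, le_iff_diag.mpr h.le, by rw [hcard h, h1], ?_⟩
    · rw [le_iff_diag]
      -- Containment in the staircase is automatic: the lengths vanish from `n` on and drop by at
      -- most one at each step.
      have key (j : ℕ) : ∀ c, n ≤ c + j → lamt.diag c ≤ n - c := by
        induction j with
        | zero =>
          intro c hc
          rw [h.eq_zero c hc]
          omega
        | succ j ih =>
          intro c hc
          have h2 := ih (c + 1) (by omega)
          have h3 := lamt.isProfile_diag c
          by_cases hcn : n ≤ c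
          · rw [h.eq_zero c hcn]
            omega
          · omega
      intro c
      rw [diag_rho]
      exact key n c (by omega)
    · rintro ⟨i, j⟩ ha ⟨i', j'⟩ hb hj
      obtain rfl : j = j' := hj
      rw [hdiff] at ha hb
      have := h.le_succ j
      simp only [Prod.mk.injEq, and_true]
      omega

/-- The diagonals in which connected components of a strip start. -/
def starts (C : Finset ℕ) : Finset ℕ := C.filter fun c => c = 0 ∨ c - 1 ∉ C

/-- The start of the run of consecutive elements of `C` that leads to a number. -/
def runStart (C : Finset ℕ) : ℕ → ℕ
  | 0 => 0
  | c + 1 => if c ∈ C then runStart C c else c + 1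

theorem starts_subset (C : Finset ℕ) : starts C ⊆ C := Finset.filter_subset _ _

theorem runStart_mem {C : Finset ℕ} {c : ℕ} (h : c ∈ C) : runStart C c ∈ starts C := by
  induction c with
  | zero => simp [runStart, starts, h]
  | succ c ih =>
    simp only [runStart]
    split_ifs with h1
    · exact ih h1
    · simp [starts, h, h1]

theorem runStart_of_mem_starts {C : Finset ℕ} {c : ℕ} (h : c ∈ starts C) : runStart C c = c := by
  cases c with
  | zero => rfl
  | succ c =>
    simp only [starts, Finset.mem_filter, Nat.succ_ne_zero, false_or, Nat.add_sub_cancel] at h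
    simp [runStart, h.2]

/-- The strip has one box on each diagonal of `C`. Boxes on consecutive diagonals share an edge,
because the diagonal lengths of `lam` differ by at most one there, and adjacent boxes always lie on
consecutive diagonals. So components correspond to maximal runs in `C`, each recorded by its first
element. -/
theorem borderN_add_one {n : ℕ} {lam lamt : StrictPartition}
    (h : StripPair n lam.diag lamt.diag) :
    borderN lamt lam + 1 = (starts (stripSet n lam.diag lamt.diag)).card := by
  set C := stripSet n lam.diag lamt.diag with hC
  set G := (SimpleGraph.hasse (ℕ × ℕ)).induce (shiftedSkew lamt lam : Set (ℕ × ℕ)) with hG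
  have hmem {r j : ℕ} : (r, j) ∈ shiftedSkew lamt lam ↔
      j = r + (j - r) ∧ j - r ∈ C ∧ r = lam.diag (j - r) := by
    rw [shiftedSkew, Finset.mem_sdiff, mem_shifted, mem_shifted, h.mem]
    have := h.le (j - r)
    have := h.le_succ (j - r)
    omega
  have hbox {c : ℕ} (hc : c ∈ C) : (lam.diag c, lam.diag c + c) ∈ shiftedSkew lamt lam := by
    rw [hmem]
    simpa using hc
  let box (c : ℕ) (hc : c ∈ C) : (shiftedSkew lamt lam : Set (ℕ × ℕ)) := ⟨_, hbox hc⟩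
  have hadj (a b : (shiftedSkew lamt lam : Set (ℕ × ℕ))) : G.Adj a b ↔
      (a.1.1 + 1 = b.1.1 ∧ a.1.2 = b.1.2 ∨ a.1.2 + 1 = b.1.2 ∧ a.1.1 = b.1.1) ∨
      (b.1.1 + 1 = a.1.1 ∧ b.1.2 = a.1.2 ∨ b.1.2 + 1 = a.1.2 ∧ b.1.1 = a.1.1) := by
    rw [hG, SimpleGraph.comap_adj, SimpleGraph.hasse_adj]
    simp only [Function.Embedding.subtype_apply, Prod.covBy_iff, Nat.covBy_iff_add_one_eq]
  let f (a : (shiftedSkew lamt lam : Set (ℕ × ℕ))) : starts C :=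
    ⟨runStart C (a.1.2 - a.1.1), runStart_mem (hmem.mp a.2).2.1⟩
  have hf (a b : (shiftedSkew lamt lam : Set (ℕ × ℕ))) (hab : G.Adj a b) : f a = f b := by
    have ha : a.1.2 = a.1.1 + (a.1.2 - a.1.1) ∧ _ := hmem.mp a.2
    have hb : b.1.2 = b.1.1 + (b.1.2 - b.1.1) ∧ _ := hmem.mp b.2
    rw [hadj] at hab
    have h1 : b.1.2 - b.1.1 = a.1.2 - a.1.1 + 1 ∨ a.1.2 - a.1.1 = b.1.2 - b.1.1 + 1 := by omega
    simp only [f, Subtype.mk.injEq]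
    rcases h1 with h1 | h1
    · rw [h1, runStart, if_pos ha.2.1]
    · rw [h1, runStart, if_pos hb.2.1]
  have hf' (a b : (shiftedSkew lamt lam : Set (ℕ × ℕ))) (w : G.Walk a b) : f a = f b := by
    induction w with
    | nil => rfl
    | cons hab _ ih => exact (hf _ _ hab).trans ih
  have hreach (c : ℕ) (hc : c ∈ C) :
      G.Reachable (box c hc) (box (runStart C c)
        (starts_subset C (runStart_mem hc))) := by
    induction c with
    | zero => exact SimpleGraph.Reachable.refl _
    | succ c ih =>
      by_cases h1 : c ∈ C
      · have h2 : runStart C (c + 1) = runStart C c := by rw [runStart, if_pos h1]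
        have h3 : G.Adj (box (c + 1) hc) (box c h1) := by
          rw [hadj]
          simp only [box]
          have := lam.isProfile_diag c
          omega
        simp only [h2]
        exact h3.reachable.trans (ih h1)
      · have h2 : runStart C (c + 1) = c + 1 := by rw [runStart, if_neg h1]
        simp only [h2]
        exact SimpleGraph.Reachable.refl _
  have e : G.ConnectedComponent ≃ starts C :=
    { toFun := fun K => K.lift f fun a b w _ => hf' a b w
      invFun := fun s => G.connectedComponentMk (box s.1 (starts_subset C s.2))
      left_inv := by
        intro K
        induction K using SimpleGraph.ConnectedComponent.ind with
        | h a =>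
          have ha : a.1.2 = a.1.1 + (a.1.2 - a.1.1) ∧ _ := hmem.mp a.2
          have h1 : a = box (a.1.2 - a.1.1) ha.2.1 := by
            apply Subtype.ext
            apply Prod.ext
            · exact ha.2.2
            · simp only [box]
              omega
          simp only [SimpleGraph.ConnectedComponent.lift_mk]
          rw [SimpleGraph.ConnectedComponent.eq]
          have h2 := (hreach _ ha.2.1).symm
          rwa [← h1] at h2
      right_inv := by
        intro s
        simp only [SimpleGraph.ConnectedComponent.lift_mk, f, box]
        apply Subtype.ext
        simp only [Nat.add_sub_cancel_left]
        exact runStart_of_mem_starts s.2 }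
  have h1 : Nat.card G.ConnectedComponent = (starts C).card := by
    rw [Nat.card_congr e]
    simp
  unfold borderN
  rw [← hG, h1]
  ring

/-! ### Counting the markings of a strip -/

theorem IsProfile.grow {N : ℕ → ℕ} (h : IsProfile N) {c : ℕ} (hc : Addable N c) :
    IsProfile (grow N c) := by
  intro d
  have h1 := h d
  have h2 := hc.1
  have h3 := hc.2 d
  unfold ShiftedWord.grow
  by_cases hd : d = c
  · subst hd
    rw [if_pos rfl, if_neg (by omega)]
    omega
  · rw [if_neg hd]
    split_ifs with h4
    · subst h4
      omega
    · omega

theorem IsProfile.run {N : ℕ → ℕ} (h : IsProfile N) {k : List ℕ} (hk : Valid N k) :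
    IsProfile (run N k) := by
  induction k generalizing N with
  | nil => simpa using h
  | cons c k ih =>
    rw [run_cons]
    exact ih (h.grow hk.1) hk.2

theorem valid_iff_forall_split {N : ℕ → ℕ} {U : List ℕ} :
    Valid N U ↔ ∀ A c B, U = A ++ c :: B → Addable (run N A) c := by
  constructor
  · rintro h A c B rfl
    exact ((valid_append _ _ _).mp h).2.1
  · intro h
    induction U generalizing N with
    | nil => trivial
    | cons u U ih =>
      refine ⟨by simpa using h [] u U rfl, ih fun A c B hU => ?_⟩
      rw [← run_cons]
      exact h (u :: A) c B (by simp [hU])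

theorem noPeak_of_pairwise {i : ℕ} {K : List (ℕ × ℕ)} (h : K.Pairwise Before)
    (hK : ∀ e ∈ K, e.1 = 2 * i ∨ e.1 = 2 * i + 1) : NoPeak (K.map Prod.snd) := by
  induction K with
  | nil => trivial
  | cons x K ih =>
    match K, ih, h, hK with
    | [], _, _, _ => trivial
    | [_], _, _, _ => trivial
    | y :: z :: K, ih, h, hK =>
      refine ⟨?_, ih (List.pairwise_cons.mp h).2 fun e he => hK e (by simp [he])⟩
      have hx := hK x (by simp)
      have hy := hK y (by simp)
      have hz := hK z (by simp)
      simp only [List.pairwise_cons, List.mem_cons] at h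
      have h1 := h.1 y (Or.inl rfl)
      have h2 := h.2.1 z (Or.inl rfl)
      simp only [Before] at h1 h2
      omega

/-- Two boxes on diagonal `c` in one block would be marked and unmarked. Between them there is a box
on `c + 1`, but marked contents decrease after the first box and unmarked ones increase up to the
second. -/
theorem nodup_of_noPeak {N : ℕ → ℕ} {U : List ℕ} (h : NoPeak U) (hv : Valid N U) : U.Nodup := by
  have hs := standard_tagBlock 0 h hv
  rw [← tagBlock_snd 0 U, List.Nodup, List.pairwise_map]
  refine List.Pairwise.imp_of_mem ?_ hs.1
  rintro ⟨σ, c⟩ ⟨τ, d⟩ ha hb hab hcd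
  simp only at hcd
  subst hcd
  have h1 := fst_of_mem_tagBlock ha
  have h2 := fst_of_mem_tagBlock hb
  simp only [Before] at hab h1 h2
  obtain ⟨σ', h3, h4, h5⟩ := exists_between (N := N) (W := []) (W' := [])
    (by simpa [tagBlock_snd] using hv) hs.1 ha hb (by omega) (c + 1) (Or.inl rfl)
  have h6 := fst_of_mem_tagBlock h3
  simp only [Before] at h4 h5 h6
  omega

theorem run_of_nodup (N : ℕ → ℕ) {U : List ℕ} (h : U.Nodup) (c : ℕ) :
    run N U c = N c + if c ∈ U then 1 else 0 := by
  unfold run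
  split_ifs with hc
  · rw [List.count_eq_one_of_mem h hc]
  · rw [List.count_eq_zero_of_not_mem hc]

theorem StripPair.of_isStrip {n p : ℕ} {N : ℕ → ℕ} {U : List ℕ} (hN : IsProfile N)
    (h : IsStrip N p U) (h0 : ∀ c, n ≤ c → run N U c = 0) :
    StripPair n N (run N U) ∧ (stripSet n N (run N U)).card = p := by
  have hd := nodup_of_noPeak h.noPeak h.valid
  have hr := run_of_nodup N hd
  have hsp : StripPair n N (run N U) := by
    refine ⟨hN, hN.run h.valid, fun c => ?_, fun c => ?_, h0⟩ <;> rw [hr] <;> split_ifs <;> omega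
  refine ⟨hsp, ?_⟩
  have : stripSet n N (run N U) = U.toFinset := by
    ext c
    rw [hsp.mem, hr, List.mem_toFinset]
    split_ifs with hc <;> simp [hc]
  rw [this, List.toFinset_card_of_nodup hd, h.length]

theorem StripPair.mem_iff {n : ℕ} {N : ℕ → ℕ} {U : List ℕ} (h : StripPair n N (run N U))
    (hd : U.Nodup) {c : ℕ} : c ∈ stripSet n N (run N U) ↔ c ∈ U := by
  rw [h.mem, run_of_nodup N hd]
  split_ifs with hc <;> simp [hc]

/-- The contents of the marked boxes of a strip. -/
def markedSet (U : List ℕ) : Finset ℕ := contents 0 (tagBlock 0 U)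

/-- Away from the starts of the components, the marks in a strip are determined by its shape. -/
theorem mem_markedSet_succ_iff {p : ℕ} {N : ℕ → ℕ} {U : List ℕ} (h : IsStrip N p U)
    {c : ℕ} (hc : c ∈ U) (hc1 : c + 1 ∈ U) : c + 1 ∈ markedSet U ↔ N c ≠ N (c + 1) := by
  have hd := nodup_of_noPeak h.noPeak h.valid
  have hs := standard_tagBlock 0 h.noPeak h.valid
  have hsnd := tagBlock_snd 0 U
  rw [← hsnd, List.mem_map] at hc hc1
  obtain ⟨⟨τ, d⟩, h1, rfl⟩ := hc
  obtain ⟨⟨σ, e⟩, h2, he⟩ := hc1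
  simp only at he
  subst he
  obtain ⟨A, B, hAB⟩ := List.append_of_mem h1
  have hU : U = A.map Prod.snd ++ d :: B.map Prod.snd := by
    rw [← hsnd, hAB]
    simp
  have hadd := (valid_iff_forall_split.mp h.valid _ _ _ hU).1
  have hdA : (A.map Prod.snd).Nodup := by
    rw [hU] at hd
    exact hd.of_append_left
  have hnd : d ∉ A.map Prod.snd := by
    rw [hU, List.nodup_append] at hd
    exact fun hm => hd.2.2 d hm d (by simp) rfl
  rw [run_of_nodup N hdA, run_of_nodup N hdA, if_neg hnd] at hadd
  have hp := hs.1
  rw [hAB, List.pairwise_append, List.pairwise_cons] at hp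
  have hτ := fst_of_mem_tagBlock h1
  have hσ := fst_of_mem_tagBlock h2
  simp only at hτ hσ
  have hmem : (σ, d + 1) ∈ A ∨ (σ, d + 1) ∈ B := by
    rw [hAB] at h2
    simpa using h2
  have huniq {e : ℕ × ℕ} (he : e ∈ tagBlock 0 U) (he' : e.2 = d + 1) : e = (σ, d + 1) := by
    rw [← hsnd] at hd
    exact List.inj_on_of_nodup_map hd he h2 he'
  have hmark : d + 1 ∈ markedSet U ↔ σ = 0 := by
    rw [markedSet, mem_contents]
    refine ⟨fun h3 => (Prod.mk.inj (huniq h3 rfl)).1.symm, ?_⟩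
    rintro rfl
    exact h2
  have hA : d + 1 ∈ A.map Prod.snd ↔ σ = 0 := by
    rw [List.mem_map]
    constructor
    · rintro ⟨e, h3, h4⟩
      have h5 := huniq (by rw [hAB]; simp [h3]) h4
      subst h5
      have := hp.2.2 _ h3 (τ, d) (by simp)
      simp only [Before] at this
      omega
    · intro h3
      refine ⟨_, hmem.resolve_right fun h4 => ?_, rfl⟩
      have := hp.2.1.1 _ h4
      simp only [Before] at this
      omega
  rw [hmark]
  by_cases h0 : σ = 0
  · rw [if_pos (hA.mpr h0)] at hadd
    simp only [h0, true_iff]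
    omega
  · rw [if_neg (fun h3 => h0 (hA.mp h3))] at hadd
    simp only [h0, false_iff]
    omega

/-- The tagged word of a strip with prescribed sets of marked and unmarked contents. -/
def stripWord (D E : Finset ℕ) : List (ℕ × ℕ) :=
  (D.sort (· ≥ ·)).map (fun c => (0, c)) ++ (E.sort (· ≤ ·)).map fun c => (1, c)

theorem mem_stripWord {D E : Finset ℕ} {σ c : ℕ} :
    (σ, c) ∈ stripWord D E ↔ σ = 0 ∧ c ∈ D ∨ σ = 1 ∧ c ∈ E := by
  simp only [stripWord, List.mem_append, List.mem_map, Finset.mem_sort, Prod.mk.injEq]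
  constructor
  · rintro (⟨a, h1, rfl, rfl⟩ | ⟨a, h1, rfl, rfl⟩)
    · exact Or.inl ⟨rfl, h1⟩
    · exact Or.inr ⟨rfl, h1⟩
  · rintro (⟨rfl, h⟩ | ⟨rfl, h⟩)
    · exact Or.inl ⟨c, h, rfl, rfl⟩
    · exact Or.inr ⟨c, h, rfl, rfl⟩

theorem pairwise_stripWord (D E : Finset ℕ) : (stripWord D E).Pairwise Before := by
  unfold stripWord
  rw [List.pairwise_append, List.pairwise_map, List.pairwise_map]
  refine ⟨?_, ?_, ?_⟩
  · refine List.Pairwise.imp ?_ (Finset.sortedGT_sort D).pairwise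
    exact fun {a b} h => Or.inr ⟨rfl, Or.inl ⟨rfl, h⟩⟩
  · refine List.Pairwise.imp ?_ (Finset.sortedLT_sort E).pairwise
    exact fun {a b} h => Or.inr ⟨rfl, Or.inr ⟨rfl, h⟩⟩
  · intro a ha b hb
    obtain ⟨x, -, rfl⟩ := List.mem_map.mp ha
    obtain ⟨y, -, rfl⟩ := List.mem_map.mp hb
    exact Or.inl Nat.zero_lt_one

theorem pairwise_before_unique {L L' : List (ℕ × ℕ)} (h : L.Pairwise Before)
    (h' : L'.Pairwise Before) (hm : ∀ e, e ∈ L ↔ e ∈ L') : L = L' := by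
  have hnd {L : List (ℕ × ℕ)} (h : L.Pairwise Before) : L.Nodup :=
    h.imp fun {a b} hab heq => by subst heq; exact hab.asymm hab
  exact ((List.perm_ext_iff_of_nodup (hnd h) (hnd h')).mpr hm).eq_of_pairwise
    (fun a b _ _ h1 h2 => absurd h2 h1.asymm) h h'

/-- Inside a run the order in which consecutive diagonals receive their boxes, and with it the mark,
is forced by the shape. At the start of a run the mark is free, except that the least content of all
has to be unmarked. -/
theorem bijOn_markedSet {n : ℕ} {N M : ℕ → ℕ} (h : StripPair n N M)
    (hne : (stripSet n N M).Nonempty) :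
    Set.BijOn (fun U => markedSet U ∩ starts (stripSet n N M))
      {U | IsStrip N (stripSet n N M).card U ∧ run N U = M}
      ((starts (stripSet n N M)).erase ((stripSet n N M).min' hne)).powerset := by
  set C := stripSet n N M with hC
  set m := C.min' hne with hm
  have hmC : m ∈ C := Finset.min'_mem _ _
  have hmin : ∀ c ∈ C, m ≤ c := fun c hc => Finset.min'_le _ _ hc
  have hmemU {U : List ℕ} (hU : IsStrip N C.card U) (hr : run N U = M) (c : ℕ) :
      c ∈ U ↔ c ∈ C := by
    subst hr
    exact (h.mem_iff (nodup_of_noPeak hU.noPeak hU.valid)).symm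
  have hsub {U : List ℕ} (hU : IsStrip N C.card U) (hr : run N U = M) :
      ∀ σ c, (σ, c) ∈ tagBlock 0 U → c ∈ C := by
    intro σ c hc
    rw [← hmemU hU hr, ← tagBlock_snd 0 U]
    exact List.mem_map.mpr ⟨_, hc, rfl⟩
  refine ⟨?_, ?_, ?_⟩
  · rintro U ⟨hU, hr⟩
    simp only [Finset.coe_powerset, Set.mem_preimage, Set.mem_powerset_iff, Finset.coe_subset]
    intro c hc
    rw [Finset.mem_inter] at hc
    rw [Finset.mem_erase]
    refine ⟨?_, hc.2⟩
    rintro rfl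
    obtain ⟨c', h1, h2⟩ := (standard_tagBlock 0 hU.noPeak hU.valid).2 0 _
      (mem_contents.mp hc.1)
    have := hmin c' (hsub hU hr _ _ h2)
    omega
  · rintro U ⟨hU, hr⟩ U' ⟨hU', hr'⟩ heq
    simp only at heq
    have key : markedSet U = markedSet U' := by
      have aux : ∀ c, c ∈ C → (c ∈ markedSet U ↔ c ∈ markedSet U') := by
        intro c hc
        by_cases hs : c ∈ starts C
        · have := Finset.ext_iff.mp heq c
          simp only [Finset.mem_inter, and_congr_left_iff] at this
          exact this hs
        · simp only [starts, Finset.mem_filter, not_and, not_or, not_not] at hs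
          obtain ⟨h1, h2⟩ := hs hc
          obtain ⟨d, rfl⟩ := Nat.exists_eq_succ_of_ne_zero h1
          simp only [Nat.succ_eq_add_one, Nat.add_sub_cancel] at h2 hc ⊢
          rw [mem_markedSet_succ_iff hU ((hmemU hU hr _).mpr h2) ((hmemU hU hr _).mpr hc),
            mem_markedSet_succ_iff hU' ((hmemU hU' hr' _).mpr h2)
              ((hmemU hU' hr' _).mpr hc)]
      ext c
      by_cases hc : c ∈ C
      · exact aux c hc
      · constructor <;> intro h1
        · exact absurd (hsub hU hr _ _ (mem_contents.mp h1)) hc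
        · exact absurd (hsub hU' hr' _ _ (mem_contents.mp h1)) hc
    have hone {U : List ℕ} (hU : IsStrip N C.card U) (hr : run N U = M) (c : ℕ) :
        (1, c) ∈ tagBlock 0 U ↔ c ∈ C ∧ c ∉ markedSet U := by
      have hd := nodup_of_noPeak hU.noPeak hU.valid
      rw [← tagBlock_snd 0 U] at hd
      constructor
      · intro h1
        refine ⟨hsub hU hr _ _ h1, fun h2 => ?_⟩
        have := List.inj_on_of_nodup_map hd h1 (mem_contents.mp h2) rfl
        simp at this
      · rintro ⟨h1, h2⟩
        rw [← hmemU hU hr, ← tagBlock_snd 0 U, List.mem_map] at h1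
        obtain ⟨⟨σ, d⟩, h3, rfl⟩ := h1
        rcases fst_of_mem_tagBlock h3 with h4 | h4
        · simp only [mul_zero] at h4
          subst h4
          exact absurd (mem_contents.mpr h3) h2
        · simp only [mul_zero, zero_add] at h4
          subst h4
          exact h3
    rw [← tagBlock_snd 0 U, ← tagBlock_snd 0 U']
    congr 1
    refine pairwise_before_unique (standard_tagBlock 0 hU.noPeak hU.valid).1
      (standard_tagBlock 0 hU'.noPeak hU'.valid).1 ?_
    rintro ⟨σ, c⟩
    by_cases h0 : σ = 0
    · subst h0
      have := Finset.ext_iff.mp key c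
      simpa [markedSet] using this
    by_cases h1 : σ = 1
    · subst h1
      rw [hone hU hr, hone hU' hr', key]
    · constructor <;> intro h2 <;> have := fst_of_mem_tagBlock h2 <;> simp only at this <;> omega
  · intro A hA
    simp only [Finset.coe_powerset, Set.mem_preimage, Set.mem_powerset_iff, Finset.coe_subset] at hA
    -- The marks chosen by `A` at the starts, and the forced ones elsewhere.
    set D := C.filter fun c => c ∈ A ∨ c ∉ starts C ∧ N (c - 1) ≠ N c with hD
    have hmS : m ∈ starts C := by
      simp only [starts, Finset.mem_filter]
      refine ⟨hmC, ?_⟩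
      by_contra hcon
      simp only [not_or, not_not] at hcon
      have := hmin _ hcon.2
      omega
    have hmD : m ∉ D := by
      simp only [hD, Finset.mem_filter, not_and, not_or]
      refine fun _ => ⟨fun h1 => ?_, fun h1 => absurd hmS h1⟩
      exact (Finset.mem_erase.mp (hA h1)).1 rfl
    have hDC : D ⊆ C := Finset.filter_subset _ _
    have hDsucc {c : ℕ} (hc : c ∈ C) (hc1 : c + 1 ∈ C) : c + 1 ∈ D ↔ N c ≠ N (c + 1) := by
      have hns : c + 1 ∉ starts C := by simp [starts, hc]
      simp only [hD, Finset.mem_filter, hc1, hns, true_and, not_false_eq_true,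
        Nat.add_sub_cancel]
      refine ⟨fun h1 => h1.resolve_left fun h2 => hns (Finset.mem_of_mem_erase (hA h2)), Or.inr⟩
    set L := stripWord D (C \ D) with hL
    have hLp : L.Pairwise Before := pairwise_stripWord _ _
    have hLm {σ c : ℕ} : (σ, c) ∈ L ↔ σ = 0 ∧ c ∈ D ∨ σ = 1 ∧ c ∈ C ∧ c ∉ D := by
      rw [hL, mem_stripWord, Finset.mem_sdiff]
    have hLt : ∀ e ∈ L, e.1 = 2 * 0 ∨ e.1 = 2 * 0 + 1 := by
      rintro ⟨σ, c⟩ he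
      rw [hLm] at he
      simp only
      omega
    have hLn : Normal L := by
      intro j c hc
      rw [hLm] at hc
      obtain ⟨hj, hcD⟩ : j = 0 ∧ c ∈ D := by
        rcases hc with hc | hc
        · exact ⟨by omega, hc.2⟩
        · omega
      subst hj
      refine ⟨m, lt_of_le_of_ne (hmin c (hDC hcD)) ?_, hLm.mpr (Or.inr ⟨by simp, hmC, hmD⟩)⟩
      rintro rfl
      exact hmD hcD
    have htag : L = tagBlock 0 (L.map Prod.snd) := eq_tagBlock ⟨hLp, hLn⟩ hLt
    have hmemL (c : ℕ) : c ∈ L.map Prod.snd ↔ c ∈ C := by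
      simp only [List.mem_map, Prod.exists, exists_eq_right, hLm]
      constructor
      · rintro ⟨σ, ⟨-, h1⟩ | ⟨-, h1, -⟩⟩
        · exact hDC h1
        · exact h1
      · intro h1
        by_cases h2 : c ∈ D
        · exact ⟨0, Or.inl ⟨rfl, h2⟩⟩
        · exact ⟨1, Or.inr ⟨rfl, h1, h2⟩⟩
    have hnd : (L.map Prod.snd).Nodup := by
      rw [List.Nodup, List.pairwise_map]
      refine List.Pairwise.imp_of_mem ?_ hLp
      rintro ⟨σ, c⟩ ⟨τ, d⟩ h1 h2 h3 rfl
      rw [hLm] at h1 h2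
      simp only [Before] at h3
      rcases h1 with h1 | h1 <;> rcases h2 with h2 | h2
      · omega
      · exact h2.2.2 h1.2
      · exact h1.2.2 h2.2
      · omega
    have hrun : run N (L.map Prod.snd) = M := by
      funext c
      rw [run_of_nodup N hnd]
      by_cases hc : c ∈ C
      · rw [if_pos ((hmemL c).mpr hc), h.mem.mp hc]
      · rw [if_neg (fun h1 => hc ((hmemL c).mp h1)), h.notMem.mp hc]
        rfl
    have hval : Valid N (L.map Prod.snd) := by
      rw [valid_iff_forall_split]
      intro A' c B' hsplit
      have hcC : c ∈ C := by
        rw [← hmemL, hsplit]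
        simp
      obtain ⟨LA, LB', hL1, hA', hL2⟩ := List.map_eq_append_iff.mp hsplit
      obtain ⟨⟨τ, c'⟩, LB, rfl, hc', hB'⟩ := List.map_eq_cons_iff.mp hL2
      simp only at hc'
      subst hc'
      have hndA : A'.Nodup := by
        rw [hsplit] at hnd
        exact hnd.of_append_left
      have hcA : c' ∉ A' := by
        rw [hsplit, List.nodup_append] at hnd
        exact fun h1 => hnd.2.2 _ h1 _ (by simp) rfl
      have hτ : (τ, c') ∈ L := by rw [hL1]; simp
      have hp := hLp
      rw [hL1, List.pairwise_append, List.pairwise_cons] at hp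
      have hmA {σ d : ℕ} (h1 : (σ, d) ∈ L) (hdc : d ≠ c') :
          (d ∈ A' ↔ Before (σ, d) (τ, c')) := by
        constructor
        · intro h2
          rw [← hA', List.mem_map] at h2
          obtain ⟨⟨σ', d'⟩, h3, rfl⟩ := h2
          have h4 : (σ', d') = (σ, d') :=
            List.inj_on_of_nodup_map hnd (by rw [hL1]; simp [h3]) h1 rfl
          rw [← h4]
          exact hp.2.2 _ h3 _ (by simp)
        · intro h2
          rw [hL1] at h1
          rcases List.mem_append.mp h1 with h3 | h3
          · rw [← hA']
            exact List.mem_map.mpr ⟨_, h3, rfl⟩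
          · rcases List.mem_cons.mp h3 with h4 | h4
            · simp only [Prod.mk.injEq] at h4
              exact absurd h4.2 hdc
            · exact absurd (hp.2.1.1 _ h4) h2.asymm
      have hprofM := h.isProfile'
      have hprof := h.isProfile
      have hle := h.le
      -- A box on `d + 1` comes before the one on `d` exactly if it is marked, whatever the mark on
      -- `d`. With the forced marks this is the order in which the boxes can be added.
      have hbefore {d : ℕ} (hd : d ∈ C) (hd1 : d + 1 ∈ C) {σ σ' : ℕ} (h1 : (σ, d) ∈ L)
          (h2 : (σ', d + 1) ∈ L) : Before (σ, d) (σ', d + 1) ↔ N d = N (d + 1) := by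
        have h3 := hDsucc hd hd1
        rw [hLm] at h1 h2
        by_cases h4 : d + 1 ∈ D
        · have h5 := h3.mp h4
          have : σ' = 0 := by tauto
          simp only [Before]
          omega
        · have h5 : N d = N (d + 1) := by tauto
          have : σ' = 1 := by tauto
          simp only [Before]
          omega
      have hex {d : ℕ} (hd : d ∈ C) : ∃ σ, (σ, d) ∈ L := by
        rw [← hmemL, List.mem_map] at hd
        obtain ⟨⟨σ, d'⟩, h1, rfl⟩ := hd
        exact ⟨σ, h1⟩
      refine ⟨?_, fun d hd => ?_⟩
      · rw [run_of_nodup N hndA, run_of_nodup N hndA, if_neg hcA]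
        have h1 := hprof c'
        by_cases hc1 : c' + 1 ∈ C
        · obtain ⟨σ, hσ⟩ := hex hc1
          have h2 := hmA hσ (by omega)
          have h3 := hbefore hcC hc1 hτ hσ
          have h4 : Before (σ, c' + 1) (τ, c') ↔ ¬ Before (τ, c') (σ, c' + 1) := by
            rw [hLm] at hτ hσ
            simp only [Before]
            omega
          split_ifs with h5
          · have := h4.mp (h2.mp h5)
            rw [h3] at this
            omega
          · have : N c' = N (c' + 1) := by
              rw [← h3]
              by_contra h6
              exact h5 (h2.mpr (h4.mpr h6))
            omega
        · rw [if_neg]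
          · have h2 := h.mem.mp hcC
            have h3 := h.notMem.mp hc1
            have h4 := hprofM c'
            omega
          · intro h2
            refine hc1 ((hmemL _).mp ?_)
            rw [hsplit]
            simp [h2]
      · subst hd
        rw [run_of_nodup N hndA, run_of_nodup N hndA, if_neg hcA]
        have h1 := hprof d
        by_cases hc1 : d ∈ C
        · obtain ⟨σ, hσ⟩ := hex hc1
          have h2 := hmA hσ (by omega)
          have h3 := hbefore hc1 hcC hσ hτ
          split_ifs with h5
          · have := h3.mp (h2.mp h5)
            omega
          · have : ¬ N d = N (d + 1) := fun h6 => h5 (h2.mpr (h3.mpr h6))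
            omega
        · rw [if_neg]
          · have h2 := h.mem.mp hcC
            have h3 := h.notMem.mp hc1
            have h4 := hprofM d
            omega
          · intro h2
            refine hc1 ((hmemL _).mp ?_)
            rw [hsplit]
            simp [h2]
    have hlen : (L.map Prod.snd).length = C.card := by
      rw [← List.toFinset_card_of_nodup hnd]
      congr 1
      ext c
      rw [List.mem_toFinset, hmemL]
    refine ⟨L.map Prod.snd, ⟨⟨hlen, noPeak_of_pairwise hLp hLt, hval⟩, hrun⟩, ?_⟩
    ext c
    simp only [markedSet, ← htag, Finset.mem_inter, mem_contents, hLm]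
    constructor
    · rintro ⟨h1 | h1, h2⟩
      · simp only [hD, Finset.mem_filter] at h1
        tauto
      · omega
    · intro h1
      have h2 := Finset.mem_of_mem_erase (hA h1)
      refine ⟨Or.inl ⟨trivial, ?_⟩, h2⟩
      simp only [hD, Finset.mem_filter]
      exact ⟨starts_subset C h2, Or.inl h1⟩

/-- The set of strips with a choice of marks between two shapes. -/
def strips (N M : ℕ → ℕ) (p : ℕ) : Set (List ℕ) := {U | IsStrip N p U ∧ run N U = M}

/-- For `p = 0` the empty word is the only one, and there is no least content to be excluded from
the free choices. -/
theorem ncard_strips {n p : ℕ} {N M : ℕ → ℕ} (h : StripPair n N M)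
    (hp : (stripSet n N M).card = p) :
    (strips N M p).ncard = if p = 0 then 1 else 2 ^ ((starts (stripSet n N M)).card - 1) := by
  subst hp
  split_ifs with h0
  · have hM : M = N := by
      rw [Finset.card_eq_zero] at h0
      funext c
      exact h.notMem.mp (by simp [h0])
    have : strips N M (stripSet n N M).card = {[]} := by
      ext U
      simp only [strips, Set.mem_ofPred_eq, Set.mem_singleton_iff]
      constructor
      · rintro ⟨hU, -⟩
        exact List.length_eq_zero_iff.mp (hU.length.trans h0)
      · rintro rfl
        exact ⟨⟨h0.symm, trivial, trivial⟩, by rw [run_nil, hM]⟩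
    rw [this, Set.ncard_singleton]
  · have hne : (stripSet n N M).Nonempty := Finset.card_pos.mp (by omega)
    have hb := bijOn_markedSet h hne
    have h1 := hb.injOn.ncard_image
    rw [hb.image_eq, Set.ncard_coe_finset, Finset.card_powerset, Finset.card_erase_of_mem] at h1
    · exact h1.symm
    · have hmC := Finset.min'_mem _ hne
      simp only [starts, Finset.mem_filter]
      refine ⟨hmC, ?_⟩
      by_contra hcon
      simp only [not_or, not_not] at hcon
      have := Finset.min'_le _ _ hcon.2
      omega

/-- The strips are counted between `N` and `M`, which may be another pair of shapes with the same
set of diagonals. This allows the strip to be replaced by its dual. The factor `1 / 2` accounts for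
`N(λ/λ) = -1`. -/
theorem two_zpow_borderN {n p : ℕ} {lam lamt : StrictPartition} {N M : ℕ → ℕ}
    (h : StripPair n lam.diag lamt.diag) (hNM : StripPair n N M)
    (hs : stripSet n N M = stripSet n lam.diag lamt.diag)
    (hp : (stripSet n lam.diag lamt.diag).card = p) :
    (2 : ℚ) ^ borderN lamt lam = (if p = 0 then 1 / 2 else 1) * (strips N M p).ncard := by
  have hb := borderN_add_one h
  rw [ncard_strips hNM (by rw [hs, hp]), hs]
  set C := stripSet n lam.diag lamt.diag
  split_ifs with h0
  · have hC : C = ∅ := Finset.card_eq_zero.mp (by omega)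
    have : borderN lamt lam = -1 := by
      rw [hC] at hb
      simp [starts] at hb
      omega
    rw [this]
    norm_num
  · have hne : C.Nonempty := Finset.card_pos.mp (by omega)
    have hpos : 0 < (starts C).card :=
      Finset.card_pos.mpr ⟨_, runStart_mem (Finset.min'_mem C hne)⟩
    have : borderN lamt lam = (((starts C).card - 1 : ℕ) : ℤ) := by
      push_cast [Nat.cast_sub (show 1 ≤ (starts C).card from hpos)]
      omega
    rw [this, zpow_natCast]
    push_cast
    ring

theorem IsProfile.antitone {N : ℕ → ℕ} (h : IsProfile N) : Antitone N :=
  antitone_nat_of_succ_le fun c => by have := h c; omega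

/-! ### Skew tableaux and their standard words -/

/-- A tableau on the skew shape between two profiles. The box in row `r` of content `c` has the
letter `t r c`, which is even if it is marked. -/
structure SkewTableau (N M : ℕ → ℕ) (t : ℕ → ℕ → ℕ) : Prop where
  row : ∀ r c, N c ≤ r → r < M (c + 1) → Before (t r c, c) (t r (c + 1), c + 1)
  col : ∀ r c, N (c + 1) ≤ r → r + 1 < M c → Before (t r (c + 1), c + 1) (t (r + 1) c, c)

/-- The list consists of the letters with contents of the boxes of a skew shape. -/
def Lists (N M : ℕ → ℕ) (t : ℕ → ℕ → ℕ) (L : List (ℕ × ℕ)) : Prop :=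
  ∀ σ c, (σ, c) ∈ L ↔ ∃ r, N c ≤ r ∧ r < M c ∧ t r c = σ

theorem SkewTableau.before {N M : ℕ → ℕ} {t : ℕ → ℕ → ℕ} (h : SkewTableau N M t)
    (hN : IsProfile N) (hM : IsProfile M) {r c c' : ℕ} (hr : N c ≤ r) (hr' : r < M c') (hc : c < c') :
    Before (t r c, c) (t r c', c') := by
  induction c', hc using Nat.le_induction with
  | base => exact h.row r c hr hr'
  | succ c' hc ih =>
    have h1 := hM.antitone (Nat.le_succ c')
    have h2 := hN.antitone (show c ≤ c' by omega)
    exact (ih (by simp only [Nat.succ_eq_add_one] at h1; omega)).trans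
      (h.row r c' (by omega) hr')

theorem SkewTableau.before_col {N M : ℕ → ℕ} {t : ℕ → ℕ → ℕ} (h : SkewTableau N M t)
    (hN : IsProfile N) (hM : IsProfile M) {r c k : ℕ} (hk : 0 < k) (hr : N (c + k) ≤ r)
    (hr' : r + k < M c) : Before (t r (c + k), c + k) (t (r + k) c, c) := by
  induction k, hk using Nat.le_induction generalizing r with
  | base => exact h.col r c hr hr'
  | succ k hk ih =>
    have h1 := hN (c + k)
    have h2 : M c ≤ M (c + k) + k := by
      clear ih hr hr' h1 hk
      induction k with
      | zero => simp
      | succ k ih =>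
        have := hM (c + k)
        rw [add_assoc] at this
        omega
    refine (h.col r (c + k) hr (by omega)).trans ?_
    rw [← add_assoc, add_right_comm r k 1]
    exact ih (by rw [← add_assoc] at hr; omega) (by omega)

theorem SkewTableau.le_row {N M : ℕ → ℕ} {t : ℕ → ℕ → ℕ} (h : SkewTableau N M t)
    (hN : IsProfile N) (hM : IsProfile M) {r c c' : ℕ} (hr : N c ≤ r) (hr' : r < M c') (hc : c ≤ c') :
    t r c ≤ t r c' := by
  rcases hc.eq_or_lt with rfl | hc
  · exact le_rfl
  · have := h.before hN hM hr hr' hc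
    simp only [Before] at this
    omega

/-- One passes from the first box to its right neighbour and then down. If all three letters agreed
up to marks, the row step would make the middle one unmarked and the column step would make it
marked. -/
theorem SkewTableau.diag_step {N M : ℕ → ℕ} {t : ℕ → ℕ → ℕ} (h : SkewTableau N M t)
    (hN : IsProfile N) (hM : IsProfile M) {r c : ℕ} (hr : N c ≤ r) (hr' : r + 1 < M c) :
    t r c / 2 < t (r + 1) c / 2 := by
  have h1 := hN c
  have h2 := hM c
  have h3 := h.row r c hr (by omega)
  have h4 := h.col r c (by omega) hr'
  simp only [Before] at h3 h4
  omega

theorem SkewTableau.diag {N M : ℕ → ℕ} {t : ℕ → ℕ → ℕ} (h : SkewTableau N M t)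
    (hN : IsProfile N) (hM : IsProfile M) {r r' c : ℕ} (hr : N c ≤ r) (hr' : r' < M c) (hrr : r ≤ r') :
    t r c / 2 + (r' - r) ≤ t r' c / 2 := by
  induction r', hrr using Nat.le_induction with
  | base => simp
  | succ r' hrr ih =>
    have h1 := ih (by omega)
    have h2 := h.diag_step hN hM (r := r') (c := c) (by omega) hr'
    omega

theorem SkewTableau.half_le {N M : ℕ → ℕ} {t : ℕ → ℕ → ℕ} (h : SkewTableau N M t)
    (hN : IsProfile N) (hM : IsProfile M) {r r' c c' : ℕ} (hr : N c ≤ r) (hr' : r' < M c') (hrr : r ≤ r')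
    (hc : c ≤ c') : t r c / 2 + (r' - r) ≤ t r' c' / 2 := by
  have h1 := hM.antitone hc
  have h2 := h.diag hN hM hr (show r' < M c by omega) hrr
  have h3 := h.le_row hN hM (show N c ≤ r' by omega) hr' hc
  omega

theorem SkewTableau.diag_injective {N M : ℕ → ℕ} {t : ℕ → ℕ → ℕ} (h : SkewTableau N M t)
    (hN : IsProfile N) (hM : IsProfile M) {r r' c : ℕ} (hr : N c ≤ r) (hrM : r < M c) (hr' : N c ≤ r')
    (hrM' : r' < M c) (heq : t r c = t r' c) : r = r' := by
  rcases lt_trichotomy r r' with h1 | h1 | h1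
  · have := h.diag hN hM hr hrM' h1.le
    omega
  · exact h1
  · have := h.diag hN hM hr' hrM h1.le
    omega

/-- Each diagonal step raises the letter up to marks, so there is room for only one such step. The
box above the second one is then squeezed: it has the first letter up to marks, and it lies to the
right of a box with this letter, hence is unmarked. -/
theorem SkewTableau.eq_unmarked {N M : ℕ → ℕ} {t : ℕ → ℕ → ℕ} (h : SkewTableau N M t)
    (hN : IsProfile N) (hM : IsProfile M) {r r' c c' : ℕ} (hr : N c ≤ r)
    (hrM' : r' < M c') (hc : c < c') (hrr : r < r') (hs : t r' c' / 2 = t r c / 2 + 1) :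
    r' = r + 1 ∧ t r c' = 2 * (t r c / 2) + 1 := by
  have h1 := h.half_le hN hM hr hrM' hrr.le hc.le
  obtain rfl : r' = r + 1 := by omega
  have h2 := h.before hN hM hr (show r < M c' by omega) hc
  have h3 := hN.antitone hc.le
  have h4 := h.diag_step hN hM (show N c' ≤ r by omega) hrM'
  simp only [Before] at h2
  omega

/-- Otherwise the box above the second one is unmarked with the smaller letter by `eq_unmarked`. The
left neighbour of the second box lies below that box, so its letter is larger, but it also has to be
smaller than the marked letter to its right; nothing lies in between. -/
theorem SkewTableau.row_le {N M : ℕ → ℕ} {t : ℕ → ℕ → ℕ} (h : SkewTableau N M t)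
    (hN : IsProfile N) (hM : IsProfile M) {r r' c c' : ℕ} (hr : N c ≤ r)
    (hrM' : r' < M c') (hc : c < c') (hs : t r' c' = 2 * (t r c / 2) + 2) : r' ≤ r := by
  by_contra hcon
  obtain ⟨rfl, h1⟩ := h.eq_unmarked hN hM hr hrM' hc (by omega) (by omega)
  obtain ⟨e, rfl⟩ : ∃ e, c' = e + 1 := ⟨c' - 1, by omega⟩
  have h2 := hN.antitone (show c ≤ e by omega)
  have h2' := hN e
  have h2'' := hM e
  have h3 := h.col r e (by omega) (by omega)
  have h4 := h.row (r + 1) e (by omega) hrM'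
  simp only [Before] at h3 h4
  omega

theorem exists_pairwise_before (S : Finset (ℕ × ℕ)) :
    ∃ L : List (ℕ × ℕ), L.Pairwise Before ∧ ∀ e, e ∈ L ↔ e ∈ S := by
  let R : ℕ × ℕ → ℕ × ℕ → Prop := fun a b => a = b ∨ Before a b
  have : DecidableRel R := fun _ _ => Classical.dec _
  have : IsTrans _ R := ⟨fun a b c h1 h2 => by
    rcases h1 with rfl | h1
    · exact h2
    · rcases h2 with rfl | h2
      · exact Or.inr h1
      · exact Or.inr (h1.trans h2)⟩
  have : Std.Antisymm R := ⟨fun a b h1 h2 => by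
    rcases h1 with rfl | h1
    · rfl
    · rcases h2 with h2 | h2
      · exact h2.symm
      · exact absurd h2 h1.asymm⟩
  have : Std.Total R := ⟨fun a b => by
    obtain ⟨a1, a2⟩ := a
    obtain ⟨b1, b2⟩ := b
    simp only [R, Before, Prod.mk.injEq]
    omega⟩
  refine ⟨S.sort R, ?_, fun e => Finset.mem_sort R⟩
  refine ((Finset.pairwise_sort S R).and (Finset.sort_nodup S R)).imp ?_
  rintro a b ⟨h1, h2⟩
  exact h1.resolve_left h2

theorem nodup_of_pairwise_before {L : List (ℕ × ℕ)} (h : L.Pairwise Before) : L.Nodup :=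
  h.imp fun {a b} hab heq => by subst heq; exact hab.asymm hab

/-- If the boxes listed on diagonal `d` are those in the rows from `N d` up to `ρ`, the diagonal has
grown to length `ρ`. Injectivity of the letters on the diagonal makes the entries of `A` correspond
to boxes. -/
theorem run_eq_of_mem_iff {N M : ℕ → ℕ} {t : ℕ → ℕ → ℕ} {A : List (ℕ × ℕ)} (hA : A.Nodup) {d ρ : ℕ}
    (hinj : ∀ r r', N d ≤ r → r < M d → N d ≤ r' → r' < M d → t r d = t r' d → r = r')
    (hmem : ∀ σ, (σ, d) ∈ A → ∃ r, N d ≤ r ∧ r < M d ∧ t r d = σ)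
    (hρ : N d ≤ ρ) (hρM : ρ ≤ M d)
    (hiff : ∀ r, N d ≤ r → r < M d → ((t r d, d) ∈ A ↔ r < ρ)) :
    run N (A.map Prod.snd) d = ρ := by
  have h1 : (A.map Prod.snd).count d = (A.toFinset.filter fun e => e.2 = d).card := by
    have h3 : A.toFinset.filter (fun e => e.2 = d) = (A.filter fun e => e.2 = d).toFinset := by
      ext e
      simp
    rw [h3, List.toFinset_card_of_nodup (hA.filter _), List.count, List.countP_map,
      List.countP_eq_length_filter]
    congr 1
  have h2 : A.toFinset.filter (fun e => e.2 = d) = (Finset.Ico (N d) ρ).image fun r => (t r d, d) := by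
    ext ⟨σ, c⟩
    simp only [Finset.mem_filter, List.mem_toFinset, Finset.mem_image, Finset.mem_Ico,
      Prod.mk.injEq]
    constructor
    · rintro ⟨h3, rfl⟩
      obtain ⟨r, h4, h5, rfl⟩ := hmem σ h3
      exact ⟨r, ⟨h4, (hiff r h4 h5).mp h3⟩, rfl, rfl⟩
    · rintro ⟨r, ⟨h3, h4⟩, rfl, rfl⟩
      exact ⟨(hiff r h3 (by omega)).mpr h4, rfl⟩
  unfold run
  rw [h1, h2, Finset.card_image_of_injOn, Nat.card_Ico]
  · omega
  · intro r hr r' hr' heq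
    simp only [Finset.coe_Ico, Set.mem_Ico] at hr hr'
    exact hinj r r' hr.1 (by omega) hr'.1 (by omega) (Prod.mk.inj heq).1

theorem SkewTableau.run_eq {N M : ℕ → ℕ} {t : ℕ → ℕ → ℕ} (h : SkewTableau N M t)
    (hN : IsProfile N) (hM : IsProfile M) (hNM : ∀ c, N c ≤ M c) {L : List (ℕ × ℕ)}
    (hL : L.Pairwise Before) (hLt : Lists N M t L) : run N (L.map Prod.snd) = M := by
  funext d
  refine run_eq_of_mem_iff (M := M) (t := t) (nodup_of_pairwise_before hL) ?_ (fun σ => (hLt σ d).mp)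
    (hNM d) le_rfl (fun r h1 h2 => ?_)
  · exact fun r r' => h.diag_injective hN hM
  · exact iff_of_true ((hLt _ _).mpr ⟨r, h1, h2, rfl⟩) h2

/-- As letters increase strictly along a diagonal, it suffices to compare `e` with the last box that
should precede it and the first one that should not. -/
theorem SkewTableau.run_prefix {N M : ℕ → ℕ} {t : ℕ → ℕ → ℕ} (h : SkewTableau N M t)
    (hN : IsProfile N) (hM : IsProfile M) {L A B : List (ℕ × ℕ)} {e : ℕ × ℕ}
    (hL : L.Pairwise Before) (hLt : Lists N M t L) (hs : L = A ++ e :: B) {d ρ : ℕ}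
    (hρ : N d ≤ ρ) (hρM : ρ ≤ M d)
    (hlt : ∀ r, N d ≤ r → r + 1 = ρ → Before (t r d, d) e)
    (hge : ρ < M d → (t ρ d, d) = e ∨ Before e (t ρ d, d)) :
    run N (A.map Prod.snd) d = ρ := by
  have hp := hL
  rw [hs, List.pairwise_append, List.pairwise_cons] at hp
  have hd := nodup_of_pairwise_before hL
  have hmono {r r' : ℕ} (h1 : N d ≤ r) (h2 : r' < M d) (h3 : r < r') :
      Before (t r d, d) (t r' d, d) := by
    have := h.diag hN hM h1 h2 h3.le
    exact Or.inl (by simp only; omega)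
  have hmA {e' : ℕ × ℕ} (h1 : e' ∈ L) : e' ∈ A ↔ Before e' e := by
    constructor
    · exact fun h2 => hp.2.2 _ h2 _ (by simp)
    · intro h2
      rw [hs, List.mem_append, List.mem_cons] at h1
      rcases h1 with h1 | rfl | h1
      · exact h1
      · exact absurd h2 h2.asymm
      · exact absurd (hp.2.1.1 _ h1) h2.asymm
  refine run_eq_of_mem_iff (M := M) (t := t) (nodup_of_pairwise_before hp.1)
    (fun r r' => h.diag_injective hN hM)
    (fun σ hσ => (hLt σ d).mp (by rw [hs]; exact List.mem_append_left _ hσ)) hρ hρM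
    fun r h1 h2 => ?_
  rw [hmA ((hLt _ _).mpr ⟨r, h1, h2, rfl⟩)]
  constructor
  · intro h3
    by_contra h4
    have h5 : (t r d, d) = e ∨ Before e (t r d, d) := by
      rcases hge (by omega) with h5 | h5
      · by_cases h6 : ρ = r
        · exact Or.inl (h6 ▸ h5)
        · exact Or.inr (h5 ▸ hmono hρ h2 (by omega))
      · by_cases h6 : ρ = r
        · exact Or.inr (h6 ▸ h5)
        · exact Or.inr (h5.trans (hmono hρ h2 (by omega)))
    rcases h5 with rfl | h5
    · exact h3.asymm h3
    · exact h3.asymm h5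
  · intro h3
    by_cases h4 : r + 1 = ρ
    · exact hlt r h1 h4
    · exact (hmono h1 (show ρ - 1 < M d by omega) (by omega)).trans
        (hlt (ρ - 1) (by omega) (by omega))

/-- When the box in row `r` of a diagonal is added, the row and column conditions place its left and
upper neighbours before it, its right and lower neighbours after it. This fixes the lengths of the
adjacent diagonals. -/
theorem SkewTableau.valid {N M : ℕ → ℕ} {t : ℕ → ℕ → ℕ} (h : SkewTableau N M t)
    (hN : IsProfile N) (hM : IsProfile M) {L : List (ℕ × ℕ)}
    (hL : L.Pairwise Before) (hLt : Lists N M t L) : Valid N (L.map Prod.snd) := by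
  rw [valid_iff_forall_split]
  intro A' c B' hs
  obtain ⟨A, L₂, rfl, rfl, hL₂⟩ := List.map_eq_append_iff.mp hs
  obtain ⟨⟨σ, c'⟩, B, rfl, hc', -⟩ := List.map_eq_cons_iff.mp hL₂
  simp only at hc'
  subst hc'
  obtain ⟨r, hr, hrM, rfl⟩ := (hLt σ c').mp (by simp)
  have hstep {r d : ℕ} (h1 : N d ≤ r) (h2 : r + 1 < M d) : Before (t r d, d) (t (r + 1) d, d) :=
    Or.inl (by
      have := h.diag_step hN hM h1 h2
      simp only
      omega)
  have h0 : run N (A.map Prod.snd) c' = r := by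
    refine h.run_prefix hN hM hL hLt rfl hr hrM.le (fun r' h1 h2 => ?_) fun _ => Or.inl rfl
    subst h2
    exact hstep h1 hrM
  refine ⟨?_, ?_⟩
  · rw [h0]
    have h1 := hN c'
    have h2 := hM c'
    refine (h.run_prefix hN hM hL hLt rfl (by omega) (by omega) (fun r' h3 h4 => ?_)
      fun h3 => Or.inr (h.row r c' hr h3)).symm
    subst h4
    exact h.col r' c' h3 hrM
  · rintro d rfl
    rw [h0]
    have h1 := hN d
    have h2 := hM d
    refine h.run_prefix hN hM hL hLt rfl (by omega) (by omega) (fun r' h3 h4 => ?_)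
      fun h3 => Or.inr (h.col r d hr h3)
    obtain rfl : r' = r := by omega
    exact h.row r' d h3 hrM

/-- Every standard word comes from a tableau. -/
theorem exists_skewTableau {N M : ℕ → ℕ} {L : List (ℕ × ℕ)} (hN : IsProfile N)
    (hL : L.Pairwise Before) (hv : Valid N (L.map Prod.snd)) (hr : run N (L.map Prod.snd) = M) :
    ∃ t, SkewTableau N M t ∧ Lists N M t L := by
  induction L using List.reverseRecOn generalizing M with
  | nil =>
    simp only [List.map_nil, run_nil] at hr
    subst hr
    refine ⟨fun _ _ => 0, ⟨fun r c h1 h2 => ?_, fun r c h1 h2 => ?_⟩, fun σ c => ?_⟩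
    · have := hN.antitone (Nat.le_succ c)
      simp only [Nat.succ_eq_add_one] at this
      omega
    · have := hN c
      omega
    · simp only [List.not_mem_nil, false_iff]
      rintro ⟨r, h1, h2, -⟩
      omega
  | append_singleton L e ih =>
    obtain ⟨σ, c⟩ := e
    rw [List.pairwise_append] at hL
    rw [List.map_append, valid_append] at hv
    obtain ⟨t, ht, hLt⟩ := ih hL.1 hv.1 rfl
    set M' := run N (L.map Prod.snd) with hM'
    obtain ⟨hc1, hc2⟩ : Addable M' c := hv.2.1
    have hM : ∀ d, M d = if d = c then M' c + 1 else M' d := by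
      intro d
      rw [← hr, List.map_append, run_append, ← hM', List.map_singleton, run_cons, run_nil, grow]
      split_ifs with h1
      · rw [h1]
      · rfl
    have hlast : ∀ e ∈ L, Before e (σ, c) := fun e he => hL.2.2 e he _ (by simp)
    -- The last letter goes to the end of its diagonal, which is row `M' c`.
    refine ⟨fun r d => if d = c ∧ r = M' c then σ else t r d,
      ⟨fun r d h1 h2 => ?_, fun r d h1 h2 => ?_⟩, fun τ d => ?_⟩
    · have hMd := hM (d + 1)
      by_cases ha : d + 1 = c ∧ r = M' c
      · have hb : ¬ (d = c ∧ r = M' c) := by omega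
        rw [if_pos ha, if_neg hb]
        have := hc2 d ha.1
        rw [ha.1]
        exact hlast _ ((hLt _ _).mpr ⟨r, h1, by omega, rfl⟩)
      · by_cases hb : d = c ∧ r = M' c
        · obtain ⟨rfl, rfl⟩ := hb
          rw [if_neg (by omega)] at hMd
          omega
        · rw [if_neg ha, if_neg hb]
          refine ht.row r d h1 ?_
          split_ifs at hMd with h3
          · rw [h3] at h2 hMd ⊢
            omega
          · omega
    · have hMd := hM d
      by_cases ha : d = c ∧ r + 1 = M' c
      · have hb : ¬ (d + 1 = c ∧ r = M' c) := by omega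
        rw [if_pos ha, if_neg hb]
        obtain ⟨rfl, ha⟩ := ha
        rw [if_pos rfl] at hMd
        exact hlast _ ((hLt _ _).mpr ⟨r, h1, by omega, rfl⟩)
      · by_cases hb : d + 1 = c ∧ r = M' c
        · have := hc2 d hb.1
          rw [if_neg (by omega)] at hMd
          omega
        · rw [if_neg ha, if_neg hb]
          refine ht.col r d h1 ?_
          split_ifs at hMd with h3
          · rw [h3] at h2 hMd ⊢
            omega
          · omega
    · have hNM : N c ≤ M' c := Nat.le_add_right _ _
      have hMd := hM d
      simp only [List.mem_append, List.mem_singleton, Prod.mk.injEq]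
      rw [hLt]
      constructor
      · rintro (⟨r, h1, h2, rfl⟩ | ⟨rfl, rfl⟩)
        · refine ⟨r, h1, ?_, if_neg ?_⟩
          · split_ifs at hMd with h3
            · subst h3
              omega
            · omega
          · rintro ⟨rfl, rfl⟩
            omega
        · rw [if_pos rfl] at hMd
          exact ⟨M' d, hNM, by omega, if_pos ⟨rfl, rfl⟩⟩
      · rintro ⟨r, h1, h2, h3⟩
        split_ifs at h3 with h4
        · exact Or.inr ⟨h3.symm, h4.1⟩
        · refine Or.inl ⟨r, h1, ?_, h3⟩
          split_ifs at hMd with h5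
          · subst h5
            omega
          · omega

/-- The list determines the set of letters on each diagonal, and along a diagonal they increase. -/
theorem skewTableau_unique {N M : ℕ → ℕ} {t t' : ℕ → ℕ → ℕ} (h : SkewTableau N M t)
    (h' : SkewTableau N M t') (hN : IsProfile N) (hM : IsProfile M) {L : List (ℕ × ℕ)}
    (hL : Lists N M t L) (hL' : Lists N M t' L) {r c : ℕ} (hr : N c ≤ r) (hrM : r < M c) :
    t r c = t' r c := by
  induction r using Nat.strong_induction_on with
  | _ r ih =>
    have key {t t' : ℕ → ℕ → ℕ} (h : SkewTableau N M t)
        (h' : SkewTableau N M t') (hL : Lists N M t L) (hL' : Lists N M t' L)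
        (ih : ∀ m < r, N c ≤ m → m < M c → t m c = t' m c) : t' r c ≤ t r c := by
      obtain ⟨r', h1, h2, h3⟩ := (hL' _ _).mp ((hL _ _).mpr ⟨r, hr, hrM, rfl⟩)
      by_cases h4 : r' < r
      · rw [← ih r' h4 h1 h2] at h3
        have := h.diag_injective hN hM h1 h2 hr hrM h3
        omega
      · rw [← h3]
        by_cases h5 : r = r'
        · rw [h5]
        · have := h'.diag hN hM hr h2 (show r ≤ r' by omega)
          omega
    exact le_antisymm (key h' h hL' hL fun m h1 h2 h3 => (ih m h1 h2 h3).symm)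
      (key h h' hL hL' ih)

/-! ### Reading order in terms of contents -/

/-- The reading order of boxes, given by their rows and contents. -/
def ReadBefore (x y : ℕ × ℕ) : Prop := x.1 < y.1 ∨ x.1 = y.1 ∧ y.2 < x.2

open Classical in
/-- The number of boxes with a given letter and a given property. -/
noncomputable def numBox (S : Finset (ℕ × ℕ)) (t : ℕ → ℕ → ℕ) (τ : ℕ) (Q : ℕ × ℕ → Prop) : ℕ :=
  (S.filter fun x => t x.1 x.2 = τ ∧ Q x).card

/-- The lattice condition for the `i`-th letter and its successor, in terms of the reading
order. -/
structure BoxLattice (S : Finset (ℕ × ℕ)) (t : ℕ → ℕ → ℕ) (i : ℕ) : Prop where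
  read : ∀ b ∈ S, t b.1 b.2 = 2 * i + 2 ∨ t b.1 b.2 = 2 * i + 3 →
    numBox S t (2 * i + 3) (ReadBefore · b) < numBox S t (2 * i + 1) (ReadBefore · b)
  hat : ∀ b ∈ S, t b.1 b.2 = 2 * i + 1 ∨ t b.1 b.2 = 2 * i + 2 →
    numBox S t (2 * i + 3) (fun _ => True) + numBox S t (2 * i + 2) (ReadBefore b ·) <
      numBox S t (2 * i + 1) (fun _ => True) + numBox S t (2 * i) (ReadBefore b ·)

section

variable {N M : ℕ → ℕ} {t : ℕ → ℕ → ℕ} {S : Finset (ℕ × ℕ)} {L : List (ℕ × ℕ)}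

-- A letter occurs at most once on a diagonal, so boxes with this letter may be counted by their
-- contents.
open Classical in
theorem numBox_eq (h : SkewTableau N M t) (hN : IsProfile N) (hM : IsProfile M)
    (hS : ∀ r c, (r, c) ∈ S ↔ N c ≤ r ∧ r < M c) (hLt : Lists N M t L) (τ : ℕ)
    {Q : ℕ × ℕ → Prop} {P : ℕ → Prop} (hQ : ∀ r c, (r, c) ∈ S → t r c = τ → (Q (r, c) ↔ P c)) :
    numBox S t τ Q = ((contents τ L).filter P).card := by
  have : (contents τ L).filter P = (S.filter fun x => t x.1 x.2 = τ ∧ Q x).image Prod.snd := by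
    ext c
    simp only [Finset.mem_filter, mem_contents, Finset.mem_image, Prod.exists, exists_eq_right]
    rw [hLt]
    constructor
    · rintro ⟨⟨r, h1, h2, h3⟩, h4⟩
      have h5 := (hS r c).mpr ⟨h1, h2⟩
      exact ⟨r, h5, h3, (hQ r c h5 h3).mpr h4⟩
    · rintro ⟨r, h1, h2, h3⟩
      have h4 := (hS r c).mp h1
      exact ⟨⟨r, h4.1, h4.2, h2⟩, (hQ r c h1 h2).mp h3⟩
  rw [this, Finset.card_image_of_injOn, numBox]
  rintro ⟨r, c⟩ hx ⟨r', c'⟩ hy hxy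
  simp only [Finset.coe_filter, Set.mem_ofPred_eq] at hx hy hxy
  subst hxy
  have h1 := (hS r c).mp hx.1
  have h2 := (hS r' c).mp hy.1
  rw [h.diag_injective hN hM h1.1 h1.2 h2.1 h2.2 (hx.2.1.trans hy.2.1.symm)]

theorem numBox_eq_numGE (h : SkewTableau N M t) (hN : IsProfile N) (hM : IsProfile M)
    (hS : ∀ r c, (r, c) ∈ S ↔ N c ≤ r ∧ r < M c) (hLt : Lists N M t L) (τ x : ℕ)
    {Q : ℕ × ℕ → Prop} (hQ : ∀ r c, (r, c) ∈ S → t r c = τ → (Q (r, c) ↔ x ≤ c)) :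
    numBox S t τ Q = numGE (contents τ L) x := by
  rw [numBox_eq h hN hM hS hLt τ hQ, numGE]
  congr

theorem numBox_eq_numLT (h : SkewTableau N M t) (hN : IsProfile N) (hM : IsProfile M)
    (hS : ∀ r c, (r, c) ∈ S ↔ N c ≤ r ∧ r < M c) (hLt : Lists N M t L) (τ x : ℕ)
    {Q : ℕ × ℕ → Prop} (hQ : ∀ r c, (r, c) ∈ S → t r c = τ → (Q (r, c) ↔ c < x)) :
    numBox S t τ Q = numLT (contents τ L) x := by
  rw [numBox_eq h hN hM hS hLt τ hQ, numLT]
  congr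

/-- Boxes with the same letter, up to marks, are read by decreasing content. -/
theorem readBefore_iff_of_half_eq (h : SkewTableau N M t) (hN : IsProfile N) (hM : IsProfile M)
    {x y : ℕ × ℕ} (hx : N x.2 ≤ x.1 ∧ x.1 < M x.2) (hy : N y.2 ≤ y.1 ∧ y.1 < M y.2)
    (hxy : t x.1 x.2 / 2 = t y.1 y.2 / 2) : ReadBefore x y ↔ y.2 < x.2 := by
  have h1 := h.half_le hN hM (r := x.1) (r' := y.1) (c := x.2) (c' := y.2) hx.1 hy.2
  have h2 := h.half_le hN hM (r := y.1) (r' := x.1) (c := y.2) (c' := x.2) hy.1 hx.2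
  unfold ReadBefore
  omega

/-- A box with a smaller letter and at least the same content is read before. -/
theorem readBefore_of_half_lt (h : SkewTableau N M t) (hN : IsProfile N) (hM : IsProfile M)
    {x y : ℕ × ℕ} (hx : N x.2 ≤ x.1 ∧ x.1 < M x.2) (hy : N y.2 ≤ y.1 ∧ y.1 < M y.2)
    (hxy : t x.1 x.2 / 2 < t y.1 y.2 / 2) (hc : y.2 ≤ x.2) : ReadBefore x y := by
  have h1 := h.half_le hN hM (r := y.1) (r' := x.1) (c := y.2) (c' := x.2) hy.1 hx.2
  unfold ReadBefore
  omega

/-- For boxes with consecutive letters, the larger of which is marked, the reading order can be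
read off the contents. -/
theorem readBefore_iff_of_marked (h : SkewTableau N M t) (hN : IsProfile N) (hM : IsProfile M)
    {x y : ℕ × ℕ} (hx : N x.2 ≤ x.1 ∧ x.1 < M x.2) (hy : N y.2 ≤ y.1 ∧ y.1 < M y.2)
    (hxy : t y.1 y.2 = 2 * (t x.1 x.2 / 2) + 2) : ReadBefore x y ↔ y.2 ≤ x.2 := by
  refine ⟨fun hb => ?_, readBefore_of_half_lt h hN hM hx hy (by omega)⟩
  by_contra hc
  have := h.row_le hN hM (r := x.1) (r' := y.1) (c := x.2) (c' := y.2) hx.1 hy.2 (by omega) hxy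
  unfold ReadBefore at hb
  omega

theorem readBefore_iff_not {x y : ℕ × ℕ} (hxy : x ≠ y) : ReadBefore x y ↔ ¬ ReadBefore y x := by
  obtain ⟨r, c⟩ := x
  obtain ⟨r', c'⟩ := y
  simp only [ne_eq, Prod.mk.injEq] at hxy
  unfold ReadBefore
  omega

/-- The reading order is decided by contents for equal letters up to marks, and for consecutive
letters the larger of which is marked; in the latter case equal contents are allowed, hence the `d +
1` in `hat1`. So the `hat` conditions agree term by term. In `read`, a smaller letter may precede
the box although its content is smaller; by `eq_unmarked` this requires an unmarked smaller letter
on the same diagonal as the box. -/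
theorem boxLattice_iff (h : SkewTableau N M t) (hN : IsProfile N) (hM : IsProfile M)
    (hS : ∀ r c, (r, c) ∈ S ↔ N c ≤ r ∧ r < M c) (hLt : Lists N M t L) (i : ℕ) :
    BoxLattice S t i ↔ LatticeAt i L := by
  have hcard (τ : ℕ) : numBox S t τ (fun _ => True) = (contents τ L).card := by
    rw [numBox_eq h hN hM hS hLt τ (P := fun _ => True) fun _ _ _ _ => Iff.rfl]
    simp
  have hmem {τ c : ℕ} : c ∈ contents τ L ↔ ∃ r, (r, c) ∈ S ∧ t r c = τ := by
    rw [mem_contents, hLt]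
    simp only [hS, and_assoc]
  have hat1 {r d : ℕ} (hb : (r, d) ∈ S) (ht : t r d = 2 * i + 1) :
      numBox S t (2 * i + 2) (ReadBefore (r, d) ·) = numLT (contents (2 * i + 2) L) (d + 1) ∧
      numBox S t (2 * i) (ReadBefore (r, d) ·) = numLT (contents (2 * i) L) d := by
    have hb' := (hS r d).mp hb
    constructor
    · refine numBox_eq_numLT h hN hM hS hLt _ _ fun r' c' hx hx' => ?_
      rw [readBefore_iff_of_marked h hN hM hb' ((hS r' c').mp hx) (by simp only; omega),
        Nat.lt_succ_iff]
    · refine numBox_eq_numLT h hN hM hS hLt _ _ fun r' c' hx hx' => ?_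
      exact readBefore_iff_of_half_eq h hN hM hb' ((hS r' c').mp hx) (by simp only; omega)
  have hat2 {r d : ℕ} (hb : (r, d) ∈ S) (ht : t r d = 2 * i + 2) :
      numBox S t (2 * i + 2) (ReadBefore (r, d) ·) = numLT (contents (2 * i + 2) L) d ∧
      numBox S t (2 * i) (ReadBefore (r, d) ·) = numLT (contents (2 * i) L) d := by
    have hb' := (hS r d).mp hb
    constructor
    · refine numBox_eq_numLT h hN hM hS hLt _ _ fun r' c' hx hx' => ?_
      exact readBefore_iff_of_half_eq h hN hM hb' ((hS r' c').mp hx) (by simp only; omega)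
    · refine numBox_eq_numLT h hN hM hS hLt _ _ fun r' c' hx hx' => ?_
      rw [readBefore_iff_not, readBefore_iff_of_marked h hN hM ((hS r' c').mp hx) hb'
        (by simp only; omega), not_le]
      rintro heq
      simp only [Prod.mk.injEq] at heq
      rw [heq.1, heq.2] at ht
      omega
  have read2 {r d : ℕ} (hb : (r, d) ∈ S) (ht : t r d = 2 * i + 2 ∨ t r d = 2 * i + 3) :
      numBox S t (2 * i + 3) (ReadBefore · (r, d)) = numGE (contents (2 * i + 3) L) (d + 1) := by
    refine numBox_eq_numGE h hN hM hS hLt _ _ fun r' c' hx hx' => ?_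
    exact readBefore_iff_of_half_eq h hN hM ((hS r' c').mp hx) ((hS r d).mp hb)
      (by simp only; omega)
  have read1 {r d : ℕ} (hb : (r, d) ∈ S) (ht : t r d = 2 * i + 2 ∨ t r d = 2 * i + 3) :
      numGE (contents (2 * i + 1) L) d ≤ numBox S t (2 * i + 1) (ReadBefore · (r, d)) := by
    have : numGE (contents (2 * i + 1) L) d =
        numBox S t (2 * i + 1) (fun x => d ≤ x.2) :=
      (numBox_eq_numGE h hN hM hS hLt _ _ fun r' c' hx hx' => Iff.rfl).symm
    rw [this]
    unfold numBox
    refine Finset.card_le_card fun x hx => ?_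
    simp only [Finset.mem_filter] at hx ⊢
    exact ⟨hx.1, hx.2.1, readBefore_of_half_lt h hN hM ((hS _ _).mp hx.1) ((hS r d).mp hb)
      (by simp only; omega) hx.2.2⟩
  have read1' {r d : ℕ} (hb : (r, d) ∈ S) (ht : t r d = 2 * i + 2 ∨ t r d = 2 * i + 3)
      (hd : d ∉ contents (2 * i + 1) L) :
      numBox S t (2 * i + 1) (ReadBefore · (r, d)) = numGE (contents (2 * i + 1) L) d := by
    refine numBox_eq_numGE h hN hM hS hLt _ _ fun r' c' hx hx' => ?_
    have hbS := (hS r d).mp hb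
    have hxS := (hS r' c').mp hx
    refine ⟨fun h1 => ?_, readBefore_of_half_lt h hN hM (x := (r', c')) (y := (r, d)) hxS hbS (by simp only; omega)⟩
    by_contra h2
    have h4 : r' < r := by
      rcases h1 with h1 | h1
      · exact h1
      · simp only at h1
        omega
    have h5 := (h.eq_unmarked hN hM hxS.1 hbS.2 (not_le.mp h2) h4 (by omega)).2
    refine hd (hmem.mpr ⟨r', (hS _ _).mpr ⟨?_, by omega⟩, by omega⟩)
    exact (hN.antitone (not_le.mp h2).le).trans hxS.1
  constructor
  · intro hB
    refine ⟨?_, fun d hd => ?_, fun d hd => ?_⟩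
    · have key : ∀ k d, numGE (contents (2 * i + 3) L) (d + 1) = k →
          d ∈ contents (2 * i + 3) L ∨ d ∈ contents (2 * i + 2) L →
          numGE (contents (2 * i + 3) L) (d + 1) < numGE (contents (2 * i + 1) L) d := by
        intro k
        induction k using Nat.strong_induction_on with
        | _ k ih =>
          intro d hk hd
          by_cases hd1 : d ∈ contents (2 * i + 1) L
          · have h1 := numGE_succ_of_mem hd1
            rcases Nat.eq_zero_or_pos (numGE (contents (2 * i + 3) L) (d + 1)) with h0 | h0
            · omega
            · obtain ⟨e, he, hde, h2⟩ := exists_least_of_numGE_pos h0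
              have h3 := ih _ (by omega) e rfl (Or.inl he)
              have h4 := numGE_anti (contents (2 * i + 1) L) hde
              omega
          · obtain ⟨r, hb, ht⟩ : ∃ r, (r, d) ∈ S ∧ (t r d = 2 * i + 2 ∨ t r d = 2 * i + 3) := by
              rcases hd with hd | hd
              · obtain ⟨r, hb, ht⟩ := hmem.mp hd
                exact ⟨r, hb, Or.inr ht⟩
              · obtain ⟨r, hb, ht⟩ := hmem.mp hd
                exact ⟨r, hb, Or.inl ht⟩
            rw [← read1' hb ht hd1, ← read2 hb ht]
            exact hB.read _ hb ht
      exact fun d hd => key _ d rfl hd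
    · obtain ⟨r, hb, ht⟩ := hmem.mp hd
      have h1 := hB.hat _ hb (Or.inl ht)
      simpa only [(hat1 hb ht).1, (hat1 hb ht).2, hcard] using h1
    · obtain ⟨r, hb, ht⟩ := hmem.mp hd
      have h1 := hB.hat _ hb (Or.inr ht)
      simpa only [(hat2 hb ht).1, (hat2 hb ht).2, hcard] using h1
  · intro hB
    refine ⟨fun ⟨r, d⟩ hb ht => ?_, fun ⟨r, d⟩ hb ht => ?_⟩
    · rw [read2 hb ht]
      refine (hB.unmarked_gt d ?_).trans_le (read1 hb ht)
      exact ht.symm.imp (fun h => hmem.mpr ⟨r, hb, h⟩) fun h => hmem.mpr ⟨r, hb, h⟩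
    · rcases ht with ht | ht
      · have h1 := hB.of_mem_unmarked d (hmem.mpr ⟨r, hb, ht⟩)
        simpa only [(hat1 hb ht).1, (hat1 hb ht).2, hcard] using h1
      · have h1 := hB.of_mem_marked d (hmem.mpr ⟨r, hb, ht⟩)
        simpa only [(hat2 hb ht).1, (hat2 hb ht).2, hcard] using h1

end

/-! ### Translation of fillings into tagged words -/

/-- The position of a letter in the ordered alphabet. -/
def code (a : Letter) : ℕ := 2 * (ofLex a).1.natPred + if (ofLex a).2 then 1 else 0

theorem code_marked (i : ℕ+) : code (marked i) = 2 * i.natPred := by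
  simp [code, marked]

theorem code_unmarked (i : ℕ+) : code (unmarked i) = 2 * i.natPred + 1 := by
  simp [code, unmarked]

theorem code_injective : Function.Injective code := by
  intro a b h
  obtain ⟨⟨i, x⟩, rfl⟩ := toLex.surjective a
  obtain ⟨⟨j, y⟩, rfl⟩ := toLex.surjective b
  have h1 : i.natPred = j.natPred ∧ x = y := by
    cases x <;> cases y <;> simp [code] at h ⊢ <;> omega
  rw [PNat.natPred_injective h1.1, h1.2]

theorem code_surjective : Function.Surjective code := by
  intro k
  rcases Nat.even_or_odd' k with ⟨j, rfl | rfl⟩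
  · exact ⟨marked j.succPNat, by simp [code_marked]⟩
  · exact ⟨unmarked j.succPNat, by simp [code_unmarked]⟩

theorem code_le_iff {a b : Letter} : code a ≤ code b ↔ a ≤ b := by
  obtain ⟨⟨i, x⟩, rfl⟩ := toLex.surjective a
  obtain ⟨⟨j, y⟩, rfl⟩ := toLex.surjective b
  rw [Prod.Lex.toLex_le_toLex, ← PNat.natPred_lt_natPred, ← PNat.natPred_injective.eq_iff]
  simp only [code, ofLex_toLex]
  generalize i.natPred = m
  generalize j.natPred = k
  cases x <;> cases y <;> simp <;> omega

theorem eq_marked_iff {a : Letter} {i : ℕ+} : a = marked i ↔ code a = 2 * i.natPred := by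
  rw [← code_marked, code_injective.eq_iff]

theorem eq_unmarked_iff {a : Letter} {i : ℕ+} : a = unmarked i ↔ code a = 2 * i.natPred + 1 := by
  rw [← code_unmarked, code_injective.eq_iff]

theorem natPred_add_one (i : ℕ+) : (i + 1).natPred = i.natPred + 1 := by
  have h1 := PNat.natPred_add_one (i + 1)
  have h2 := PNat.natPred_add_one i
  rw [PNat.add_coe, PNat.one_coe] at h1
  omega

theorem code_hatLetter (a : Letter) : code (hatLetter a) = code a + 1 := by
  unfold hatLetter
  split_ifs with h
  · rw [code_marked, natPred_add_one]
    simp only [code, h, if_true]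
    omega
  · rw [code_unmarked]
    simp [code, h]

theorem mem_shiftedSkew {lam mu : StrictPartition} {r c : ℕ} :
    (r, r + c) ∈ shiftedSkew lam mu ↔ mu.diag c ≤ r ∧ r < lam.diag c := by
  simp only [shiftedSkew, Finset.mem_sdiff, mem_shifted]
  rw [Nat.add_sub_cancel_left]
  have : r ≤ r + c := by omega
  simp only [this, true_and]
  omega

theorem le_of_mem_shiftedSkew {lam mu : StrictPartition} {b : ℕ × ℕ}
    (h : b ∈ shiftedSkew lam mu) : b.1 ≤ b.2 := by
  obtain ⟨r, j⟩ := b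
  exact (mem_shifted.mp (Finset.mem_sdiff.mp h).1).1

/-- The row and the content of a box. -/
def loc (b : ℕ × ℕ) : ℕ × ℕ := (b.1, b.2 - b.1)

/-- The boxes of a shifted skew shape, given by their rows and contents. -/
def boxSet (lam mu : StrictPartition) : Finset (ℕ × ℕ) := (shiftedSkew lam mu).image loc

theorem mem_boxSet {lam mu : StrictPartition} {r c : ℕ} :
    (r, c) ∈ boxSet lam mu ↔ mu.diag c ≤ r ∧ r < lam.diag c := by
  rw [← mem_shiftedSkew, boxSet, Finset.mem_image]
  constructor
  · rintro ⟨⟨r', j⟩, h1, h2⟩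
    have h3 := le_of_mem_shiftedSkew h1
    simp only [loc, Prod.mk.injEq] at h2 h3
    obtain ⟨rfl, rfl⟩ := h2
    rwa [Nat.add_sub_cancel' h3]
  · intro h
    exact ⟨_, h, by simp [loc]⟩

/-- The letters of a filling, indexed by rows and contents. -/
noncomputable def tags {lam mu : StrictPartition} (T : Filling lam mu) (r c : ℕ) : ℕ :=
  if h : (r, r + c) ∈ shiftedSkew lam mu then code (T ⟨_, h⟩) else 0

theorem tags_loc {lam mu : StrictPartition} (T : Filling lam mu)
    (b : {b // b ∈ shiftedSkew lam mu}) : tags T (loc b.1).1 (loc b.1).2 = code (T b) := by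
  obtain ⟨⟨r, j⟩, hb⟩ := b
  have h1 := le_of_mem_shiftedSkew hb
  simp only at h1
  have h2 : r + (j - r) = j := by omega
  simp only [tags, loc, h2, hb, dif_pos]

theorem loc_injOn {lam mu : StrictPartition} {a b : ℕ × ℕ} (ha : a ∈ shiftedSkew lam mu)
    (hb : b ∈ shiftedSkew lam mu) (h : loc a = loc b) : a = b := by
  have h1 := le_of_mem_shiftedSkew ha
  have h2 := le_of_mem_shiftedSkew hb
  simp only [loc, Prod.mk.injEq] at h
  exact Prod.ext h.1 (by omega)

theorem loc_mem_boxSet {lam mu : StrictPartition} {b : ℕ × ℕ} (h : b ∈ shiftedSkew lam mu) :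
    loc b ∈ boxSet lam mu := Finset.mem_image_of_mem _ h

theorem loc_bounds {lam mu : StrictPartition} (b : {b // b ∈ shiftedSkew lam mu}) :
    mu.diag (loc b.1).2 ≤ (loc b.1).1 ∧ (loc b.1).1 < lam.diag (loc b.1).2 :=
  mem_boxSet.mp (loc_mem_boxSet b.2)

theorem exists_loc_eq {lam mu : StrictPartition} {r c : ℕ} (h : mu.diag c ≤ r ∧ r < lam.diag c) :
    ∃ b : {b // b ∈ shiftedSkew lam mu}, loc b.1 = (r, c) :=
  ⟨⟨_, mem_shiftedSkew.mpr h⟩, by simp [loc]⟩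

/-- `Before` is strict: in a row, where contents increase, it allows equal letters only if they are
unmarked, and in a column, where contents decrease, only if they are marked. For the rules on all
pairs of boxes the conditions on neighbours are chained. -/
theorem isShiftedTableau_iff {lam mu : StrictPartition} (T : Filling lam mu) :
    IsShiftedTableau T ↔ SkewTableau mu.diag lam.diag (tags T) := by
  have hN := isProfile_diag mu
  have hM := isProfile_diag lam
  constructor
  · rintro ⟨h1, h2, h3, h4⟩
    refine ⟨fun r c ha hb => ?_, fun r c ha hb => ?_⟩
    · have hNc := hN.antitone (Nat.le_succ c)
      have hMc := hM.antitone (Nat.le_succ c)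
      simp only [Nat.succ_eq_add_one] at hNc hMc
      obtain ⟨a, ha'⟩ := exists_loc_eq (lam := lam) (mu := mu) (r := r) (c := c) (by omega)
      obtain ⟨b, hb'⟩ := exists_loc_eq (lam := lam) (mu := mu) (r := r) (c := c + 1) (by omega)
      have ta := tags_loc T a
      have tb := tags_loc T b
      rw [ha'] at ta
      rw [hb'] at tb
      have la := le_of_mem_shiftedSkew a.2
      have lb := le_of_mem_shiftedSkew b.2
      simp only [loc, Prod.mk.injEq] at ha' hb' ta tb
      have h5 := code_le_iff.mpr (h1 a b (by omega) (by omega))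
      rw [← ta, ← tb] at h5
      rcases h5.lt_or_eq with h6 | h6
      · exact Or.inl h6
      · refine Or.inr ⟨h6, Or.inr ⟨?_, Nat.lt_succ_self c⟩⟩
        by_contra h7
        have h8 : tags T r c = 2 * (tags T r c / 2).succPNat.natPred := by
          simp only [Nat.natPred_succPNat] at h7 ⊢
          omega
        have := h3 _ a b (by omega) (eq_marked_iff.mpr (by rw [← ta]; exact h8))
          (eq_marked_iff.mpr (by rw [← tb, ← h6]; exact h8))
        subst this
        omega
    · have hNc := hN c
      have hMc := hM c
      obtain ⟨a, ha'⟩ := exists_loc_eq (lam := lam) (mu := mu) (r := r) (c := c + 1) (by omega)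
      obtain ⟨b, hb'⟩ := exists_loc_eq (lam := lam) (mu := mu) (r := r + 1) (c := c) (by omega)
      have ta := tags_loc T a
      have tb := tags_loc T b
      rw [ha'] at ta
      rw [hb'] at tb
      have la := le_of_mem_shiftedSkew a.2
      have lb := le_of_mem_shiftedSkew b.2
      simp only [loc, Prod.mk.injEq] at ha' hb' ta tb
      have h5 := code_le_iff.mpr (h2 a b (by omega) (by omega))
      rw [← ta, ← tb] at h5
      rcases h5.lt_or_eq with h6 | h6
      · exact Or.inl h6
      · refine Or.inr ⟨h6, Or.inl ⟨?_, Nat.lt_succ_self c⟩⟩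
        by_contra h7
        have h8 : tags T r (c + 1) = 2 * (tags T r (c + 1) / 2).succPNat.natPred + 1 := by
          simp only [Nat.natPred_succPNat] at h7 ⊢
          omega
        have := h4 _ a b (by omega) (eq_unmarked_iff.mpr (by rw [← ta]; exact h8))
          (eq_unmarked_iff.mpr (by rw [← tb, ← h6]; exact h8))
        subst this
        omega
  · intro h
    have hrow {a b : {b // b ∈ shiftedSkew lam mu}} (h1 : a.1.1 = b.1.1) (h2 : a.1.2 < b.1.2) :
        Before (code (T a), a.1.2 - a.1.1) (code (T b), b.1.2 - b.1.1) := by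
      have ha := loc_bounds a
      have hb := loc_bounds b
      have la := le_of_mem_shiftedSkew a.2
      rw [← tags_loc T a, ← tags_loc T b]
      simp only [loc]
      rw [← h1]
      exact h.before hN hM ha.1 (by rw [h1]; exact hb.2) (by omega)
    have hcol {a b : {b // b ∈ shiftedSkew lam mu}} (h1 : a.1.2 = b.1.2) (h2 : a.1.1 < b.1.1) :
        Before (code (T a), a.1.2 - a.1.1) (code (T b), b.1.2 - b.1.1) := by
      have ha := loc_bounds a
      have hb := loc_bounds b
      have la := le_of_mem_shiftedSkew a.2
      have lb := le_of_mem_shiftedSkew b.2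
      rw [← tags_loc T a, ← tags_loc T b]
      have e1 : a.1.2 - a.1.1 = (b.1.2 - b.1.1) + (b.1.1 - a.1.1) := by omega
      have e2 : b.1.1 = a.1.1 + (b.1.1 - a.1.1) := by omega
      have := h.before_col hN hM (r := a.1.1) (c := b.1.2 - b.1.1) (k := b.1.1 - a.1.1) (by omega)
        (by rw [← e1]; exact ha.1) (by rw [← e2]; exact hb.2)
      rw [← e1, ← e2] at this
      exact this
    refine ⟨fun a b h1 h2 => ?_, fun a b h1 h2 => ?_, fun i a b h1 ha hb => ?_,
      fun i a b h1 ha hb => ?_⟩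
    · rcases h2.eq_or_lt with h2 | h2
      · rw [show a = b from Subtype.ext (Prod.ext h1 h2)]
      · rw [← code_le_iff]
        have := hrow h1 h2
        simp only [Before] at this
        omega
    · rcases h2.eq_or_lt with h2 | h2
      · rw [show a = b from Subtype.ext (Prod.ext h2 h1)]
      · rw [← code_le_iff]
        have := hcol h1 h2
        simp only [Before] at this
        omega
    · rw [eq_marked_iff] at ha hb
      rcases lt_trichotomy a.1.2 b.1.2 with h2 | h2 | h2
      · have := hrow h1 h2
        simp only [Before] at this
        omega
      · exact Subtype.ext (Prod.ext h1 h2)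
      · have := hrow h1.symm h2
        simp only [Before] at this
        omega
    · rw [eq_unmarked_iff] at ha hb
      rcases lt_trichotomy a.1.1 b.1.1 with h2 | h2 | h2
      · have := hcol h1 h2
        simp only [Before] at this
        omega
      · exact Subtype.ext (Prod.ext h2 h1)
      · have := hcol h1.symm h2
        simp only [Before] at this
        omega

/-- The boxes of a shifted skew shape in reading order. -/
def readingList (lam mu : StrictPartition) : List {b // b ∈ shiftedSkew lam mu} :=
  (readingOrder lam mu).attach.map fun b => ⟨b.1, mem_of_mem_readingOrder b.2⟩

theorem word_eq {lam mu : StrictPartition} (T : Filling lam mu) :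
    word T = (readingList lam mu).map T := by
  simp [word, readingList]

theorem pairwise_readingOrder (lam mu : StrictPartition) :
    (readingOrder lam mu).Pairwise fun a b => a.1 < b.1 ∨ a.1 = b.1 ∧ b.2 < a.2 := by
  unfold readingOrder
  rw [List.pairwise_flatMap]
  constructor
  · intro i _
    refine List.Pairwise.filter _ ?_
    rw [List.pairwise_map, List.pairwise_reverse]
    exact (List.pairwise_lt_range).imp fun h => Or.inr ⟨rfl, h⟩
  · refine (List.pairwise_lt_range).imp fun {i i'} h x hx y hy => Or.inl ?_
    obtain ⟨j, -, rfl⟩ := List.mem_map.mp (List.mem_filter.mp hx).1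
    obtain ⟨j', -, rfl⟩ := List.mem_map.mp (List.mem_filter.mp hy).1
    exact h

theorem mem_readingOrder {lam mu : StrictPartition} {b : ℕ × ℕ} (h : b ∈ shiftedSkew lam mu) :
    b ∈ readingOrder lam mu := by
  have h1 := (Finset.mem_sdiff.mp h).1
  unfold shifted at h1
  simp only [Finset.mem_biUnion, Finset.mem_range, Finset.mem_image] at h1
  obtain ⟨i, hi, j, hj, rfl⟩ := h1
  unfold readingOrder
  rw [List.mem_flatMap]
  exact ⟨i, by simpa using hi, List.mem_filter.mpr ⟨by simpa using hj, by simpa using h⟩⟩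

theorem mem_readingList {lam mu : StrictPartition} (b : {b // b ∈ shiftedSkew lam mu}) :
    b ∈ readingList lam mu := by
  unfold readingList
  rw [List.mem_map]
  exact ⟨⟨b.1, mem_readingOrder b.2⟩, by simp, rfl⟩

theorem pairwise_readingList (lam mu : StrictPartition) :
    (readingList lam mu).Pairwise fun a b => ReadBefore (loc a.1) (loc b.1) := by
  unfold readingList
  rw [List.pairwise_map]
  have h := pairwise_readingOrder lam mu
  rw [← List.attach_map_subtype_val (readingOrder lam mu), List.pairwise_map] at h
  refine h.imp fun {a b} h1 => ?_
  have la := le_of_mem_shiftedSkew (mem_of_mem_readingOrder a.2)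
  have lb := le_of_mem_shiftedSkew (mem_of_mem_readingOrder b.2)
  simp only [ReadBefore, loc]
  omega

theorem hatLetter_eq_unmarked_iff {a : Letter} {i : ℕ+} :
    hatLetter a = unmarked i ↔ a = marked i := by
  rw [eq_unmarked_iff, eq_marked_iff, code_hatLetter]
  omega

theorem hatLetter_eq_marked_iff {a : Letter} {i : ℕ+} :
    hatLetter a = marked (i + 1) ↔ a = unmarked i := by
  rw [eq_unmarked_iff, eq_marked_iff, code_hatLetter, natPred_add_one]
  omega

theorem count_hatWord (w : List Letter) (i : ℕ+) :
    (hatWord w).count (unmarked i) = w.count (marked i) := by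
  unfold hatWord
  rw [List.count_reverse, List.count, List.countP_map, List.count]
  congr 1
  funext a
  have := hatLetter_eq_unmarked_iff (a := a) (i := i)
  simp only [Function.comp_apply, beq_eq_beq, this]

/-- The lattice condition for a word followed by its hat, in terms of the word only. -/
theorem isLatticeWord_append_hatWord_iff (w : List Letter) :
    IsLatticeWord (w ++ hatWord w) ↔ ∀ (i : ℕ+) (x y : List Letter) (b : Letter), w = x ++ b :: y →
      ((b = unmarked (i + 1) ∨ b = marked (i + 1)) →
        x.count (unmarked (i + 1)) < x.count (unmarked i)) ∧
      ((b = unmarked i ∨ b = marked (i + 1)) →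
        w.count (unmarked (i + 1)) + y.count (marked (i + 1)) <
          w.count (unmarked i) + y.count (marked i)) := by
  constructor
  · intro h i x y b hw
    refine ⟨h i x (y ++ hatWord w) b (by simp [hw]), fun hb => ?_⟩
    have := h i (w ++ hatWord y) (hatWord x) (hatLetter b) (by simp [hw, hatWord]) ?_
    · simpa only [List.count_append, count_hatWord] using this
    · rw [hatLetter_eq_marked_iff, hatLetter_eq_unmarked_iff]
      exact hb.symm
  · intro h i x y a hs ha
    -- A letter in the second half is the hat of some `b` in `w`. It is preceded by `w` and by the
    -- hats of the letters following `b`, among which the unmarked `i` are the hats of `i'`.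
    have hat (z : List Letter) (hz : hatWord w = z ++ a :: y) :
        (w ++ z).count (unmarked (i + 1)) < (w ++ z).count (unmarked i) := by
      have h1 : w.map hatLetter = y.reverse ++ a :: z.reverse := by
        rw [← List.reverse_reverse (w.map hatLetter)]
        change (hatWord w).reverse = _
        rw [hz]
        simp
      obtain ⟨w₁, w₂, h2, -, h3⟩ := List.map_eq_append_iff.mp h1
      obtain ⟨b, w₃, rfl, rfl, h4⟩ := List.map_eq_cons_iff.mp h3
      have h5 : z = hatWord w₃ := by
        rw [hatWord, h4, List.reverse_reverse]
      rw [h5, List.count_append, List.count_append, count_hatWord, count_hatWord]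
      refine (h i w₁ w₃ b h2).2 ?_
      rw [hatLetter_eq_marked_iff, hatLetter_eq_unmarked_iff] at ha
      exact ha.symm
    rcases List.append_eq_append_iff.mp hs with ⟨z, rfl, h2⟩ | ⟨z, h1, h2⟩
    · exact hat z h2
    · cases z with
      | nil =>
        rw [List.append_nil] at h1
        subst h1
        simpa using hat [] h2.symm
      | cons b z =>
        obtain ⟨rfl, -⟩ := List.cons.inj h2
        exact (h i x z _ h1).1 ha

theorem exists_last_split {α : Type*} {a : α} {w : List α} (h : a ∈ w) :
    ∃ x y, w = x ++ a :: y ∧ a ∉ y := by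
  obtain ⟨x, y, h1, h2⟩ := List.eq_append_cons_of_mem (List.mem_reverse.mpr h)
  refine ⟨y.reverse, x.reverse, ?_, by simpa using h2⟩
  rw [← List.reverse_reverse w, h1]
  simp

section

variable {lam mu : StrictPartition} (T : Filling lam mu)

theorem count_map (X : List {b // b ∈ shiftedSkew lam mu}) (hX : X.Nodup) (a : Letter)
    (Q : ℕ × ℕ → Prop) (hQ : ∀ b, b ∈ X ↔ Q (loc b.1)) :
    (X.map T).count a = numBox (boxSet lam mu) (tags T) (code a) Q := by
  classical
  have h1 : (X.map T).count a = (X.toFinset.filter fun b => T b = a).card := by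
    have h3 : X.toFinset.filter (fun b => T b = a) = (X.filter fun b => T b = a).toFinset := by
      ext e
      simp
    rw [h3, List.toFinset_card_of_nodup (hX.filter _), List.count, List.countP_map,
      List.countP_eq_length_filter]
    congr 2
    funext b
    rw [Bool.eq_iff_iff, Function.comp_apply, beq_iff_eq, decide_eq_true_eq]
  rw [h1, numBox]
  refine Finset.card_bij (fun b _ => loc b.1) ?_ ?_ ?_
  · intro b hb
    simp only [Finset.mem_filter, List.mem_toFinset] at hb ⊢
    exact ⟨loc_mem_boxSet b.2, by rw [tags_loc, hb.2], (hQ b).mp hb.1⟩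
  · intro b _ b' _ hbb
    exact Subtype.ext (loc_injOn b.2 b'.2 hbb)
  · rintro ⟨r, c⟩ hx
    rw [Finset.mem_filter] at hx
    obtain ⟨b, hb⟩ := exists_loc_eq (mem_boxSet.mp hx.1)
    refine ⟨b, ?_, hb⟩
    rw [← hb, tags_loc, code_injective.eq_iff] at hx
    simp only [Finset.mem_filter, List.mem_toFinset]
    exact ⟨(hQ b).mpr hx.2.2, hx.2.1⟩

theorem ReadBefore.asymm {x y : ℕ × ℕ} (h : ReadBefore x y) : ¬ ReadBefore y x := by
  unfold ReadBefore at *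
  omega

theorem nodup_readingList (lam mu : StrictPartition) : (readingList lam mu).Nodup :=
  (pairwise_readingList lam mu).imp fun {a b} h heq => by subst heq; exact h.asymm h

theorem mem_split_readingList {X Y : List {b // b ∈ shiftedSkew lam mu}}
    {b : {b // b ∈ shiftedSkew lam mu}} (h : readingList lam mu = X ++ b :: Y)
    (b' : {b // b ∈ shiftedSkew lam mu}) :
    (b' ∈ X ↔ ReadBefore (loc b'.1) (loc b.1)) ∧ (b' ∈ Y ↔ ReadBefore (loc b.1) (loc b'.1)) := by
  have hp := pairwise_readingList lam mu
  rw [h, List.pairwise_append, List.pairwise_cons] at hp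
  have hX : ∀ b' ∈ X, ReadBefore (loc b'.1) (loc b.1) := fun b' h1 => hp.2.2 _ h1 _ (by simp)
  have hY := hp.2.1.1
  have hmem := mem_readingList b'
  rw [h, List.mem_append, List.mem_cons] at hmem
  refine ⟨⟨hX b', fun h1 => ?_⟩, ⟨hY b', fun h1 => ?_⟩⟩
  · rcases hmem with h2 | rfl | h2
    · exact h2
    · exact absurd h1 h1.asymm
    · exact absurd h1 (hY _ h2).asymm
  · rcases hmem with h2 | rfl | h2
    · exact absurd h1 (hX _ h2).asymm
    · exact absurd h1 h1.asymm
    · exact h2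

theorem isLatticeWord_iff :
    IsLatticeWord (word T ++ hatWord (word T)) ↔ ∀ i, BoxLattice (boxSet lam mu) (tags T) i := by
  have hnd := nodup_readingList lam mu
  have hw (a : Letter) : (word T).count a = numBox (boxSet lam mu) (tags T) (code a) fun _ => True := by
    rw [word_eq]
    exact count_map T _ hnd a _ fun b => iff_of_true (mem_readingList b) trivial
  have hX {X Y : List {b // b ∈ shiftedSkew lam mu}} {b : {b // b ∈ shiftedSkew lam mu}}
      (h : readingList lam mu = X ++ b :: Y) (a : Letter) :
      (X.map T).count a =
        numBox (boxSet lam mu) (tags T) (code a) (ReadBefore · (loc b.1)) :=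
    count_map T _ (by rw [h] at hnd; exact hnd.of_append_left) a _
      fun b' => (mem_split_readingList h b').1
  have hY {X Y : List {b // b ∈ shiftedSkew lam mu}} {b : {b // b ∈ shiftedSkew lam mu}}
      (h : readingList lam mu = X ++ b :: Y) (a : Letter) :
      (Y.map T).count a =
        numBox (boxSet lam mu) (tags T) (code a) (ReadBefore (loc b.1) ·) :=
    count_map T _ (by rw [h] at hnd; exact hnd.of_append_right.of_cons) a _
      fun b' => (mem_split_readingList h b').2
  rw [isLatticeWord_append_hatWord_iff]
  constructor
  · intro h i
    have key (b : {b // b ∈ shiftedSkew lam mu}) :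
        ((code (T b) = 2 * (i + 1) + 1 ∨ code (T b) = 2 * (i + 1)) →
          numBox (boxSet lam mu) (tags T) (2 * (i + 1) + 1) (ReadBefore · (loc b.1)) <
            numBox (boxSet lam mu) (tags T) (2 * i + 1) (ReadBefore · (loc b.1))) ∧
        ((code (T b) = 2 * i + 1 ∨ code (T b) = 2 * (i + 1)) →
          numBox (boxSet lam mu) (tags T) (2 * (i + 1) + 1) (fun _ => True) +
            numBox (boxSet lam mu) (tags T) (2 * (i + 1)) (ReadBefore (loc b.1) ·) <
          numBox (boxSet lam mu) (tags T) (2 * i + 1) (fun _ => True) +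
            numBox (boxSet lam mu) (tags T) (2 * i) (ReadBefore (loc b.1) ·)) := by
      obtain ⟨X, Y, hs⟩ := List.append_of_mem (mem_readingList b)
      have := h i.succPNat (X.map T) (Y.map T) (T b) (by rw [word_eq, hs]; simp)
      rw [hX hs, hX hs, hY hs, hY hs, hw, hw] at this
      simp only [eq_marked_iff, eq_unmarked_iff, code_marked, code_unmarked, natPred_add_one,
        Nat.natPred_succPNat] at this
      exact this
    refine ⟨fun ⟨r, c⟩ hb ht => ?_, fun ⟨r, c⟩ hb ht => ?_⟩
    · obtain ⟨b, hb'⟩ := exists_loc_eq (mem_boxSet.mp hb)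
      have ht' := tags_loc T b
      rw [hb'] at ht'
      have := (key b).1 (by simp only at ht ht'; omega)
      rwa [hb'] at this
    · obtain ⟨b, hb'⟩ := exists_loc_eq (mem_boxSet.mp hb)
      have ht' := tags_loc T b
      rw [hb'] at ht'
      have := (key b).2 (by simp only at ht ht'; omega)
      rwa [hb'] at this
  · intro h i x y b hs
    rw [word_eq] at hs
    obtain ⟨X, Y', hs', rfl, hY'⟩ := List.map_eq_append_iff.mp hs
    obtain ⟨b, Y, rfl, rfl, rfl⟩ := List.map_eq_cons_iff.mp hY'
    rw [hX hs', hX hs', hY hs', hY hs', hw, hw]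
    simp only [eq_marked_iff, eq_unmarked_iff, code_marked, code_unmarked, natPred_add_one]
    have h1 := h i.natPred
    refine ⟨fun hb => h1.read _ (loc_mem_boxSet b.2) ?_, fun hb => h1.hat _ (loc_mem_boxSet b.2) ?_⟩
    · rw [tags_loc]
      omega
    · rw [tags_loc]
      omega

/-- Boxes with entries `i` or `i'` are read by decreasing content. So an unmarked `i` after the last
`i'` is an unmarked `i` of smaller content than every `i'`, and such a letter exists as soon as each
`i'` has a partner. -/
theorem normal_iff (h : SkewTableau mu.diag lam.diag (tags T)) {L : List (ℕ × ℕ)}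
    (hL : Lists mu.diag lam.diag (tags T) L) :
    (∀ (i : ℕ+) (x y : List Letter), word T = x ++ marked i :: y → marked i ∉ y → unmarked i ∈ y) ↔
      Normal L := by
  have hN := isProfile_diag mu
  have hM := isProfile_diag lam
  have hread {b b' : {b // b ∈ shiftedSkew lam mu}} (hbb : code (T b) / 2 = code (T b') / 2) :
      ReadBefore (loc b.1) (loc b'.1) ↔ (loc b'.1).2 < (loc b.1).2 :=
    readBefore_iff_of_half_eq h hN hM (loc_bounds b)
      (loc_bounds b') (by rw [tags_loc, tags_loc, hbb])
  have hmem {σ c : ℕ} : (σ, c) ∈ L ↔ ∃ b, code (T b) = σ ∧ (loc b.1).2 = c := by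
    rw [hL]
    constructor
    · rintro ⟨r, h1, h2, h3⟩
      obtain ⟨b, hb⟩ := exists_loc_eq ⟨h1, h2⟩
      exact ⟨b, by rw [← tags_loc, hb, h3], by rw [hb]⟩
    · rintro ⟨b, rfl, rfl⟩
      have := loc_bounds b
      exact ⟨_, this.1, this.2, tags_loc T b⟩
  constructor
  · intro h1 j c hc
    obtain ⟨b, hb, rfl⟩ := hmem.mp hc
    have hb1 : T b = marked j.succPNat := eq_marked_iff.mpr (by simpa using hb)
    obtain ⟨X, Y, hs⟩ := List.append_of_mem (mem_readingList b)
    have hu : unmarked j.succPNat ∈ Y.map T := by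
      by_cases hm : marked j.succPNat ∈ Y.map T
      · obtain ⟨x, y, h2, h3⟩ := exists_last_split hm
        have := h1 j.succPNat (X.map T ++ T b :: x) y (by rw [word_eq, hs]; simp [h2]) h3
        rw [h2]
        simp [this]
      · exact h1 j.succPNat (X.map T) (Y.map T) (by rw [word_eq, hs]; simp [hb1]) hm
    obtain ⟨b', hb', hu'⟩ := List.mem_map.mp hu
    have h4 := eq_unmarked_iff.mp hu'
    rw [Nat.natPred_succPNat] at h4
    have h5 := (hread (by omega)).mp ((mem_split_readingList hs b').2.mp hb')
    exact ⟨_, h5, hmem.mpr ⟨b', h4, rfl⟩⟩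
  · intro hn i x y hs _
    rw [word_eq] at hs
    obtain ⟨X, Y', hs', rfl, hY'⟩ := List.map_eq_append_iff.mp hs
    obtain ⟨b, Y, rfl, hb, rfl⟩ := List.map_eq_cons_iff.mp hY'
    rw [eq_marked_iff] at hb
    obtain ⟨c', h1, h2⟩ := hn _ _ (hmem.mpr ⟨b, hb, rfl⟩)
    obtain ⟨b', h3, rfl⟩ := hmem.mp h2
    have h4 := (mem_split_readingList hs' b').2.mpr ((hread (by omega)).mpr h1)
    exact List.mem_map.mpr ⟨b', h4, eq_unmarked_iff.mpr h3⟩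

theorem hasContent_iff (h : SkewTableau mu.diag lam.diag (tags T)) {L : List (ℕ × ℕ)}
    (hp : L.Pairwise Before) (hL : Lists mu.diag lam.diag (tags T) L) (kap : StrictPartition) :
    HasContent T kap ↔ ∀ j, (L.filter fun e => e.1 / 2 = j).length = kap.part j := by
  have hN := isProfile_diag mu
  have hM := isProfile_diag lam
  have key (i : ℕ+) : (Finset.univ.filter fun b => T b = marked i ∨ T b = unmarked i).card =
      (L.filter fun e => e.1 / 2 = i.natPred).length := by
    rw [← List.toFinset_card_of_nodup ((nodup_of_pairwise_before hp).filter _)]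
    refine Finset.card_bij (fun b _ => (code (T b), (loc b.1).2)) ?_ ?_ ?_
    · intro b hb
      simp only [Finset.mem_filter, Finset.mem_univ, true_and, eq_marked_iff, eq_unmarked_iff] at hb
      simp only [List.mem_toFinset, List.mem_filter, decide_eq_true_eq]
      have := loc_bounds b
      exact ⟨(hL _ _).mpr ⟨_, this.1, this.2, tags_loc T b⟩, by omega⟩
    · intro b _ b' _ hbb
      simp only [Prod.mk.injEq] at hbb
      have h1 := loc_bounds b
      have h2 := loc_bounds b'
      rw [← tags_loc, ← tags_loc] at hbb
      rw [← hbb.2] at h2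
      have h3 := h.diag_injective hN hM h1.1 h1.2 h2.1 h2.2 (by rw [hbb.1, hbb.2])
      exact Subtype.ext (loc_injOn b.2 b'.2 (Prod.ext h3 hbb.2))
    · rintro ⟨σ, c⟩ he
      simp only [List.mem_toFinset, List.mem_filter, decide_eq_true_eq] at he
      obtain ⟨r, h1, h2, h3⟩ := (hL _ _).mp he.1
      obtain ⟨b, hb⟩ := exists_loc_eq ⟨h1, h2⟩
      have h4 := tags_loc T b
      rw [hb] at h4
      refine ⟨b, ?_, by rw [← h4, hb, ← h3]⟩
      simp only [Finset.mem_filter, Finset.mem_univ, true_and, eq_marked_iff, eq_unmarked_iff]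
      simp only at h4
      omega
  constructor
  · intro hc j
    have := hc j.succPNat
    rwa [key, Nat.natPred_succPNat] at this
  · intro hc i
    rw [key, hc]

end

/-! ### LRS tableaux as words in blocks -/

/-- The words of Littlewood-Richardson-Stembridge tableaux between two profiles. -/
def lrsWords (N M : ℕ → ℕ) (kap : StrictPartition) : Set (List (ℕ × ℕ)) :=
  {L | Standard L ∧ Valid N (L.map Prod.snd) ∧ run N (L.map Prod.snd) = M ∧
    (∀ i, LatticeAt i L) ∧ ∀ j, (L.filter fun e => e.1 / 2 = j).length = kap.part j}

theorem exists_lists {lam mu : StrictPartition} (T : Filling lam mu) :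
    ∃ L : List (ℕ × ℕ), L.Pairwise Before ∧ Lists mu.diag lam.diag (tags T) L := by
  obtain ⟨L, h1, h2⟩ := exists_pairwise_before
    ((boxSet lam mu).image fun x => (tags T x.1 x.2, x.2))
  refine ⟨L, h1, fun σ c => ?_⟩
  rw [h2, Finset.mem_image]
  constructor
  · rintro ⟨⟨r, c'⟩, h3, h4⟩
    simp only [Prod.mk.injEq] at h4
    obtain ⟨h4, rfl⟩ := h4
    have := mem_boxSet.mp h3
    exact ⟨r, this.1, this.2, h4⟩
  · rintro ⟨r, h3, h4, rfl⟩
    exact ⟨(r, c), mem_boxSet.mpr ⟨h3, h4⟩, rfl⟩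

theorem mem_lrsTableaux_iff {lam mu kap : StrictPartition} (hle : mu ≤ lam) (T : Filling lam mu)
    {L : List (ℕ × ℕ)} (hp : L.Pairwise Before) (hL : Lists mu.diag lam.diag (tags T) L) :
    T ∈ lrsTableaux lam mu kap ↔
      SkewTableau mu.diag lam.diag (tags T) ∧ L ∈ lrsWords mu.diag lam.diag kap := by
  have hN := isProfile_diag mu
  have hM := isProfile_diag lam
  simp only [lrsTableaux, Set.mem_ofPred_eq, isShiftedTableau_iff, IsLRSWord, isLatticeWord_iff]
  refine and_congr_right fun h => ?_
  rw [normal_iff T h hL, hasContent_iff T h hp hL]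
  simp only [boxLattice_iff h hN hM (fun r c => mem_boxSet) hL]
  have h1 := h.valid hN hM hp hL
  have h2 := h.run_eq hN hM (le_iff_diag.mp hle) hp hL
  simp only [lrsWords, Set.mem_ofPred_eq, Standard, hp, h1, h2, true_and]
  tauto

/-- A tableau corresponds to its list of letters and contents in standard order. Injectivity is
`skewTableau_unique`, surjectivity is `exists_skewTableau`. -/
theorem ncard_lrsTableaux {lam mu kap : StrictPartition} (hle : mu ≤ lam) :
    (lrsTableaux lam mu kap).ncard = (lrsWords mu.diag lam.diag kap).ncard := by
  have hN := isProfile_diag mu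
  have hM := isProfile_diag lam
  choose L hp hL using fun T : Filling lam mu => exists_lists T
  refine Set.ncard_congr (fun T _ => L T) ?_ ?_ ?_
  · exact fun T hT => ((mem_lrsTableaux_iff hle T (hp T) (hL T)).mp hT).2
  · intro T T' hT hT' heq
    have h1 := ((mem_lrsTableaux_iff hle T (hp T) (hL T)).mp hT).1
    have h2 := ((mem_lrsTableaux_iff hle T' (hp T') (hL T')).mp hT').1
    funext b
    apply code_injective
    have hb := loc_bounds b
    rw [← tags_loc, ← tags_loc]
    exact skewTableau_unique h1 h2 hN hM (hL T) (heq ▸ hL T') hb.1 hb.2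
  · intro K hK
    obtain ⟨t, ht, hKt⟩ := exists_skewTableau hN hK.1.1 hK.2.1 hK.2.2.1
    choose letter hletter using code_surjective
    let T : Filling lam mu := fun b => letter (t (loc b.1).1 (loc b.1).2)
    have hT {r c : ℕ} (hb : mu.diag c ≤ r ∧ r < lam.diag c) : tags T r c = t r c := by
      obtain ⟨b, hb'⟩ := exists_loc_eq hb
      have := tags_loc T b
      rw [hb'] at this
      simp only [T, hletter, hb'] at this
      exact this
    have hTt : SkewTableau mu.diag lam.diag (tags T) := by
      refine ⟨fun r c h1 h2 => ?_, fun r c h1 h2 => ?_⟩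
      · have h3 := hN c
        have h4 := hM c
        rw [hT ⟨h1, by omega⟩, hT ⟨by omega, h2⟩]
        exact ht.row r c h1 h2
      · have h3 := hN c
        have h4 := hM c
        rw [hT ⟨h1, by omega⟩, hT ⟨by omega, h2⟩]
        exact ht.col r c h1 h2
    have hKT : Lists mu.diag lam.diag (tags T) K := by
      intro σ c
      rw [hKt]
      refine exists_congr fun r => ⟨fun h => ?_, fun h => ?_⟩
      · exact ⟨h.1, h.2.1, by rw [hT ⟨h.1, h.2.1⟩, h.2.2]⟩
      · exact ⟨h.1, h.2.1, by rw [← hT ⟨h.1, h.2.1⟩, h.2.2]⟩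
    refine ⟨T, (mem_lrsTableaux_iff hle T hK.1.1 hKT).mpr ⟨hTt, hK⟩, ?_⟩
    refine pairwise_before_unique (hp T) hK.1.1 fun ⟨σ, c⟩ => ?_
    rw [hL T, hKT]

theorem length_filter_tagAll (i k : ℕ) (T : List (List ℕ)) :
    ((tagAll i T).filter fun e => e.1 / 2 = i + k).length = (T.map List.length).getD k 0 := by
  induction T generalizing i k with
  | nil => simp [tagAll]
  | cons v T ih =>
    rw [tagAll, List.filter_append, List.length_append]
    cases k with
    | zero =>
      rw [List.filter_eq_self.mpr, List.filter_eq_nil_iff.mpr]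
      · have := congrArg List.length (tagBlock_snd i v)
        simpa using this
      · intro e he
        have := fst_of_mem_tagAll he
        simp only [decide_eq_true_eq]
        omega
      · intro e he
        have := fst_of_mem_tagBlock he
        simp only [decide_eq_true_eq]
        omega
    | succ k =>
      rw [List.filter_eq_nil_iff.mpr]
      · have := ih (i + 1) k
        rw [show i + 1 + k = i + (k + 1) by omega] at this
        simpa using this
      · intro e he
        have := fst_of_mem_tagBlock he
        simp only [decide_eq_true_eq]
        omega

/-- The contents of the boxes of a standard word, in blocks according to the letters. -/
def blocks (K : List (ℕ × ℕ)) (i m : ℕ) : List (List ℕ) :=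
  (List.range' i m).map fun j => (K.filter fun e => e.1 / 2 = j).map Prod.snd

theorem standard_filter {K : List (ℕ × ℕ)} (h : Standard K) (j : ℕ) :
    Standard (K.filter fun e => e.1 / 2 = j) := by
  refine ⟨h.1.filter _, fun i c hc => ?_⟩
  simp only [List.mem_filter, decide_eq_true_eq] at hc ⊢
  obtain ⟨c', h1, h2⟩ := h.2 i c hc.1
  exact ⟨c', h1, h2, by omega⟩

theorem tagAll_blocks {K : List (ℕ × ℕ)} (h : Standard K) (i m : ℕ) :
    tagAll i (blocks K i m) = (List.range' i m).flatMap fun j => K.filter fun e => e.1 / 2 = j := by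
  induction m generalizing i with
  | zero => rfl
  | succ m ih =>
    rw [blocks, List.range'_succ, List.map_cons, tagAll, List.flatMap_cons, ← eq_tagBlock]
    · exact congrArg _ (ih (i + 1))
    · exact standard_filter h i
    · intro e he
      simp only [List.mem_filter, decide_eq_true_eq] at he
      omega

theorem tagAll_blocks_eq {K : List (ℕ × ℕ)} (h : Standard K) {m : ℕ}
    (hm : ∀ e ∈ K, e.1 / 2 < m) : tagAll 0 (blocks K 0 m) = K := by
  rw [tagAll_blocks h]
  refine pairwise_before_unique ?_ h.1 fun e => ?_
  · rw [List.pairwise_flatMap]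
    refine ⟨fun j _ => h.1.filter _, ?_⟩
    refine (List.pairwise_lt_range' (s := 0) (n := m)).imp fun {j j'} hj x hx y hy => Or.inl ?_
    simp only [List.mem_filter, decide_eq_true_eq] at hx hy
    omega
  · simp only [List.mem_flatMap, List.mem_range'_1, List.mem_filter, decide_eq_true_eq]
    constructor
    · rintro ⟨j, -, h1, -⟩
      exact h1
    · intro h1
      exact ⟨_, ⟨Nat.zero_le _, by simpa using hm e h1⟩, h1, rfl⟩

/-- The words in blocks that correspond to the Littlewood-Richardson-Stembridge tableaux between
two profiles. -/
def tableaux (N M : ℕ → ℕ) (kap : StrictPartition) : Set (List (List ℕ)) :=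
  {T | IsTableau N (kap.parts.sort (fun a b => a ≥ b)) T ∧ run N T.flatten = M}

/-- Tagging the blocks is inverse to cutting a standard word by letters and dropping the tags. The
prescribed block lengths are the content of the tableau. -/
theorem ncard_tableaux (N M : ℕ → ℕ) (kap : StrictPartition) :
    (tableaux N M kap).ncard = (lrsWords N M kap).ncard := by
  refine Set.ncard_congr (fun T _ => tagAll 0 T) ?_ ?_ ?_
  · rintro T ⟨hT, hr⟩
    refine ⟨standard_tagAll 0 hT.noPeak hT.valid, ?_, ?_, hT.lattice, fun j => ?_⟩
    · rw [tagAll_snd]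
      exact hT.valid
    · rw [tagAll_snd, hr]
    · have := length_filter_tagAll 0 j T
      rw [zero_add, hT.map_length] at this
      exact this
  · rintro T T' ⟨hT, -⟩ ⟨hT', -⟩ heq
    rw [List.eq_iff_flatten_eq, hT.map_length, hT'.map_length]
    refine ⟨?_, rfl⟩
    rw [← tagAll_snd 0, ← tagAll_snd 0, heq]
  · rintro K ⟨h1, h2, h3, h4, h5⟩
    -- Parts beyond the last one are `0`, so only as many letters occur as there are blocks.
    have hm : ∀ e ∈ K, e.1 / 2 < kap.parts.card := by
      intro e he
      have h6 : 0 < kap.part (e.1 / 2) := by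
        rw [← h5, List.length_pos_iff_exists_mem]
        exact ⟨e, List.mem_filter.mpr ⟨he, by simp⟩⟩
      by_contra h7
      have : kap.part (e.1 / 2) = 0 := List.getD_eq_default _ _ (by
        rw [Finset.length_sort]
        omega)
      omega
    have htag := tagAll_blocks_eq h1 hm
    have hflat : (blocks K 0 kap.parts.card).flatten = K.map Prod.snd := by
      rw [← tagAll_snd 0, htag]
    refine ⟨blocks K 0 kap.parts.card, ⟨⟨?_, ?_, ?_, ?_⟩, ?_⟩, htag⟩
    · refine List.ext_getElem (by simp [blocks]) fun j hj hj' => ?_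
      have := h5 j
      rw [part, List.getD_eq_getElem _ _ hj'] at this
      rw [← this]
      simp [blocks]
    · intro v hv
      obtain ⟨j, -, rfl⟩ := List.mem_map.mp hv
      refine noPeak_of_pairwise (i := j) (h1.1.filter _) fun e he => ?_
      simp only [List.mem_filter, decide_eq_true_eq] at he
      omega
    · rwa [hflat]
    · rwa [htag]
    · rw [hflat, h3]

/-- Words only enlarge a shape, so there are none if `mu` is not contained in the dual, in
accordance with the value `0`. -/
theorem lrsNumber_eq (n : ℕ) (lam mu nu : StrictPartition) :
    lrsNumber n lam mu nu = (tableaux mu.diag (dual n lam).diag (dual n nu)).ncard := by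
  unfold lrsNumber
  split_ifs with h
  · rw [ncard_lrsTableaux h, ncard_tableaux]
  · have : tableaux mu.diag (dual n lam).diag (dual n nu) = ∅ := by
      rw [Set.eq_empty_iff_forall_notMem]
      rintro T ⟨-, hT⟩
      refine h (le_iff_diag.mpr fun c => ?_)
      rw [← hT]
      exact Nat.le_add_right _ _
    rw [this, Set.ncard_empty]

/-! ### Sums over intermediate shapes and the final identity -/

/-- Any two such words use each content equally often, so they are permutations of one another.
Finiteness is needed since infinite sets have `ncard` zero. -/
theorem finite_run_eq (N M : ℕ → ℕ) : {k : List ℕ | run N k = M}.Finite := by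
  rcases Set.eq_empty_or_nonempty {k : List ℕ | run N k = M} with h | ⟨k, hk⟩
  · rw [h]
    exact Set.finite_empty
  · refine (List.finite_toSet k.permutations).subset fun l hl => List.mem_permutations.mpr ?_
    refine List.perm_iff_count.mpr fun c => ?_
    have := congrFun (Eq.trans hl hk.symm) c
    simp only [run] at this
    omega

theorem ncard_eq_sum_of_fibers {α ι : Type*} {X : Set α} (hX : X.Finite) (s : Finset ι)
    (F : ι → Set α) (hF : ∀ x, x ∈ X ↔ ∃ i ∈ s, x ∈ F i)
    (hd : ∀ i ∈ s, ∀ j ∈ s, ∀ x, x ∈ F i → x ∈ F j → i = j) : X.ncard = ∑ i ∈ s, (F i).ncard := by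
  classical
  induction s using Finset.induction_on generalizing X with
  | empty =>
    have : X = ∅ := by
      ext x
      simp [hF]
    simp [this]
  | insert i s hi ih =>
    have hsub : ∀ x ∈ F i, x ∈ X := fun x hx => (hF x).mpr ⟨i, by simp, hx⟩
    have h1 : (X \ F i).ncard = ∑ j ∈ s, (F j).ncard := by
      refine ih hX.sdiff (fun x => ?_) fun j hj k hk => hd j (by simp [hj]) k (by simp [hk])
      rw [Set.mem_sdiff, hF]
      constructor
      · rintro ⟨⟨j, hj, hx⟩, hxi⟩
        rcases Finset.mem_insert.mp hj with rfl | hj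
        · exact absurd hx hxi
        · exact ⟨j, hj, hx⟩
      · rintro ⟨j, hj, hx⟩
        refine ⟨⟨j, by simp [hj], hx⟩, fun hxi => ?_⟩
        obtain rfl := hd i (by simp) j (by simp [hj]) x hxi hx
        exact hi hj
    rw [Finset.sum_insert hi, ← h1, add_comm, Set.ncard_sdiff_add_ncard_of_subset hsub hX]

theorem le_rho_of_mem_pieri {n : ℕ} {p : ℤ} {lam lamt : StrictPartition}
    (h : lamt ∈ pieri n p lam) : lamt ≤ rho n := by
  simp only [pieri, Set.Finite.mem_toFinset, Set.mem_ofPred_eq] at h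
  exact h.1

theorem le_rho_of_diag_le {n : ℕ} {lam : StrictPartition} {N : ℕ → ℕ}
    (h : ∀ c, lam.diag c ≤ N c) (hN : ∀ c, N c ≤ n - c) : lam ≤ rho n := by
  rw [le_iff_diag]
  intro c
  rw [diag_rho]
  exact (h c).trans (hN c)

theorem diag_le_of_le_rho {n : ℕ} {lam : StrictPartition} (h : lam ≤ rho n) (c : ℕ) :
    lam.diag c ≤ n - c := by
  rw [← diag_rho]
  exact le_iff_diag.mp h c

theorem StripPair.dual {n : ℕ} {lam lamt : StrictPartition} (hlam : lam ≤ rho n)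
    (hlamt : lamt ≤ rho n) (h : StripPair n lam.diag lamt.diag) :
    StripPair n (dual n lamt).diag (dual n lam).diag := by
  have h1 := diag_dual hlam
  have h2 := diag_dual hlamt
  have h3 := diag_le_of_le_rho hlam
  have h4 := diag_le_of_le_rho hlamt
  refine ⟨isProfile_diag _, isProfile_diag _, fun c => ?_, fun c => ?_, fun c hc => ?_⟩
  · have := h.le c
    have := h1 c
    have := h2 c
    omega
  · have := h.le_succ c
    have := h1 c
    have := h2 c
    omega
  · have := h1 c
    omega

theorem stripSet_dual {n : ℕ} {lam lamt : StrictPartition} (hlam : lam ≤ rho n)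
    (hlamt : lamt ≤ rho n) :
    stripSet n (dual n lamt).diag (dual n lam).diag = stripSet n lam.diag lamt.diag := by
  ext c
  have h1 := diag_dual hlam c
  have h2 := diag_dual hlamt c
  simp only [stripSet, Finset.mem_filter]
  refine and_congr_right fun _ => ?_
  omega

theorem diag_dual_injective {n : ℕ} {lam mu : StrictPartition} (hlam : lam ≤ rho n)
    (hmu : mu ≤ rho n) (h : (dual n lam).diag = (dual n mu).diag) : lam = mu := by
  rw [← dual_dual hlam, ← dual_dual hmu, diag_injective h]

/-- Pairs of a tableau and a strip added to it, between two profiles. -/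
def tableauStrips (N M : ℕ → ℕ) (kap : StrictPartition) (p : ℕ) :
    Set (List (List ℕ) × List ℕ) :=
  {x | IsTableau N (kap.parts.sort (fun a b => a ≥ b)) x.1 ∧
    IsStrip (run N x.1.flatten) p x.2 ∧ run N (x.1.flatten ++ x.2) = M}

/-- Pairs of a strip and a tableau added to it, between two profiles. -/
def stripTableaux (N M : ℕ → ℕ) (kap : StrictPartition) (p : ℕ) :
    Set (List ℕ × List (List ℕ)) :=
  {y | IsStrip N p y.1 ∧ IsTableau (run N y.1) (kap.parts.sort (fun a b => a ≥ b)) y.2 ∧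
    run N (y.1 ++ y.2.flatten) = M}

theorem ncard_tableauStrips (N M : ℕ → ℕ) (kap : StrictPartition) (p : ℕ) :
    (tableauStrips N M kap p).ncard = (stripTableaux N M kap p).ncard := by
  have h := switchBlocks_bijOn N M (kap.parts.sort (fun a b => a ≥ b)) p
  have h1 := h.injOn.ncard_image
  rw [h.image_eq] at h1
  exact h1.symm

theorem finite_tableauStrips (N M : ℕ → ℕ) (kap : StrictPartition) (p : ℕ) :
    (tableauStrips N M kap p).Finite := by
  refine Set.Finite.of_injOn (f := fun x : List (List ℕ) × List ℕ => x.1.flatten ++ x.2) (t := {k | run N k = M})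
    (fun x hx => hx.2.2) ?_ (finite_run_eq N M)
  rintro ⟨T, U⟩ ⟨hT, -, -⟩ ⟨T', U'⟩ ⟨hT', -, -⟩ heq
  have hl : T.flatten.length = T'.flatten.length := by
    rw [List.length_flatten, List.length_flatten, hT.map_length, hT'.map_length]
  obtain ⟨h1, rfl⟩ := List.append_inj heq hl
  have : T = T' := List.eq_iff_flatten_eq.mpr ⟨h1, hT.map_length.trans hT'.map_length.symm⟩
  rw [this]

theorem finite_stripTableaux (N M : ℕ → ℕ) (kap : StrictPartition) (p : ℕ) :
    (stripTableaux N M kap p).Finite := by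
  have h := switchBlocks_bijOn N M (kap.parts.sort (fun a b => a ≥ b)) p
  have h1 := (finite_tableauStrips N M kap p).image (fun x => switchBlocks x.1 x.2)
  rw [tableauStrips, h.image_eq] at h1
  exact h1

/-- The pairs are sorted by the shape reached after the tableau. This shape is the dual of `lamt`,
and the strip from it to the dual of `lam` is dual to the strip from `lam` to `lamt`. -/
theorem ncard_tableauStrips_eq_sum {n p : ℕ} {lam mu kap : StrictPartition} (hlam : lam ≤ rho n) :
    (tableauStrips mu.diag (dual n lam).diag kap p).ncard = ∑ lamt ∈ pieri n p lam,
      (tableaux mu.diag (dual n lamt).diag kap ×ˢ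
        strips (dual n lamt).diag (dual n lam).diag p).ncard := by
  refine ncard_eq_sum_of_fibers (finite_tableauStrips _ _ _ _) _ _ ?_ ?_
  · rintro ⟨T, U⟩
    constructor
    · rintro ⟨hT, hU, hr⟩
      simp only at hT hU hr
      rw [run_append] at hr
      have hprof := (isProfile_diag mu).run hT.valid
      have hle : ∀ c, run mu.diag T.flatten c ≤ (dual n lam).diag c := by
        intro c
        rw [← hr]
        exact Nat.le_add_right _ _
      have h0 : ∀ c, n ≤ c → (dual n lam).diag c = 0 := fun c hc =>
        diag_eq_zero_of_le_rho (dual_le_rho n lam) hc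
      -- The intermediate sequence is the profile of a strict partition, as it vanishes where the
      -- final one does.
      obtain ⟨kap', hk⟩ := exists_diag_eq hprof (n := n) fun c hc => by
        have := hle c
        rw [h0 c hc] at this
        omega
      have hk' : kap' ≤ rho n := le_rho_of_diag_le (fun c => (congrFun hk c).le.trans (hle c))
        (diag_le_of_le_rho (dual_le_rho n lam))
      have hsp := StripPair.of_isStrip hprof hU (n := n) (by rw [hr]; exact h0)
      rw [hr, ← hk] at hsp
      have h1 := hsp.1.dual hk' (dual_le_rho n lam)
      have h2 := stripSet_dual hk' (dual_le_rho n lam)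
      rw [dual_dual hlam] at h1 h2
      refine ⟨dual n kap', mem_pieri.mpr ⟨h1, by rw [h2, hsp.2]⟩, ?_⟩
      rw [dual_dual hk', hk]
      exact ⟨⟨hT, rfl⟩, hU, hr⟩
    · rintro ⟨lamt, hm, ⟨hT, hr⟩, hU, hr'⟩
      simp only at hr hT hU hr'
      rw [← hr] at hU hr'
      exact ⟨hT, hU, by rw [run_append]; exact hr'⟩
  · rintro a ha b hb ⟨T, U⟩ ⟨⟨-, h1⟩, -⟩ ⟨⟨-, h2⟩, -⟩
    exact diag_dual_injective (le_rho_of_mem_pieri ha) (le_rho_of_mem_pieri hb) (h1.symm.trans h2)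

theorem ncard_stripTableaux_eq_sum {n p : ℕ} {mu kap : StrictPartition} {M : ℕ → ℕ}
    (hM : ∀ c, M c ≤ n - c) :
    (stripTableaux mu.diag M kap p).ncard = ∑ muT ∈ pieri n p mu,
      (strips mu.diag muT.diag p ×ˢ tableaux muT.diag M kap).ncard := by
  refine ncard_eq_sum_of_fibers (finite_stripTableaux _ _ _ _) _ _ ?_ ?_
  · rintro ⟨U, T⟩
    constructor
    · rintro ⟨hU, hT, hr⟩
      simp only at hT hU hr
      rw [run_append] at hr
      have hprof := (isProfile_diag mu).run hU.valid
      have h0 : ∀ c, n ≤ c → run mu.diag U c = 0 := by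
        intro c hc
        have h1 := hM c
        rw [← hr] at h1
        have h2 : run mu.diag U c ≤ run (run mu.diag U) T.flatten c := Nat.le_add_right _ _
        omega
      obtain ⟨muT, hk⟩ := exists_diag_eq hprof h0
      have hsp := StripPair.of_isStrip (isProfile_diag mu) hU h0
      rw [← hk] at hsp
      refine ⟨muT, mem_pieri.mpr ⟨hsp.1, by rw [hsp.2]⟩, ?_⟩
      rw [hk]
      exact ⟨⟨hU, rfl⟩, hT, hr⟩
    · rintro ⟨muT, hm, ⟨hU, hr⟩, hT, hr'⟩
      simp only at hr hT hU hr'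
      rw [← hr] at hT hr'
      exact ⟨hU, hT, by rw [run_append]; exact hr'⟩
  · rintro a ha b hb ⟨U, T⟩ ⟨⟨-, h1⟩, -⟩ ⟨⟨-, h2⟩, -⟩
    exact diag_injective (h1.symm.trans h2)

end StrictPartition

theorem mainTheorem4 (n : ℕ) (p : ℤ) (hp : p ≤ n) (lam mu nu : StrictPartition)
    (hlam : lam ≤ StrictPartition.rho n) (hmu : mu ≤ StrictPartition.rho n)
    (hnu : nu ≤ StrictPartition.rho n) :
    ∑ lamT ∈ StrictPartition.pieri n p lam,
        (2 : ℚ) ^ StrictPartition.borderN lamT lam * StrictPartition.lrsNumber n lamT mu nu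
      = ∑ muT ∈ StrictPartition.pieri n p mu,
        (2 : ℚ) ^ StrictPartition.borderN muT mu * StrictPartition.lrsNumber n lam muT nu := by
  open StrictPartition in
  rcases lt_or_ge p 0 with hp0 | hp0
  · have hempty (kap : StrictPartition) : pieri n p kap = ∅ := by
      rw [Finset.eq_empty_iff_forall_notMem]
      intro x hx
      have := (mem_pieri.mp hx).2
      omega
    rw [hempty, hempty, Finset.sum_empty, Finset.sum_empty]
  · obtain ⟨q, rfl⟩ := Int.eq_ofNat_of_zero_le hp0
    -- On this side the strip is counted between the dual shapes, where it follows the tableau; on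
    -- the other side it is counted where it stands. The factor for `q = 0` is the same in both
    -- cases.
    have hL : ∀ lamT ∈ pieri n q lam, (2 : ℚ) ^ borderN lamT lam * lrsNumber n lamT mu nu =
        (if q = 0 then 1 / 2 else 1) * ((tableaux mu.diag (dual n lamT).diag (dual n nu) ×ˢ
          strips (dual n lamT).diag (dual n lam).diag q).ncard : ℚ) := by
      intro lamT hT
      have h1 := mem_pieri.mp hT
      have h2 := le_rho_of_mem_pieri hT
      rw [two_zpow_borderN h1.1 (h1.1.dual hlam h2) (stripSet_dual hlam h2)
        (by exact_mod_cast h1.2), lrsNumber_eq, Set.ncard_prod]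
      push_cast
      ring
    have hR : ∀ muT ∈ pieri n q mu, (2 : ℚ) ^ borderN muT mu * lrsNumber n lam muT nu =
        (if q = 0 then 1 / 2 else 1) * ((strips mu.diag muT.diag q ×ˢ
          tableaux muT.diag (dual n lam).diag (dual n nu)).ncard : ℚ) := by
      intro muT hT
      have h1 := mem_pieri.mp hT
      rw [two_zpow_borderN h1.1 h1.1 rfl (by exact_mod_cast h1.2), lrsNumber_eq, Set.ncard_prod]
      push_cast
      ring
    -- After removing the common factor, both sums count stacked pairs from `mu` to the dual of
    -- `lam`, which switching matches.
    rw [Finset.sum_congr rfl hL, Finset.sum_congr rfl hR, ← Finset.mul_sum, ← Finset.mul_sum,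
      ← Nat.cast_sum, ← Nat.cast_sum, ← ncard_tableauStrips_eq_sum hlam,
      ← ncard_stripTableaux_eq_sum (diag_le_of_le_rho (dual_le_rho n lam)), ncard_tableauStrips]
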